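/- Let $a<b$ and let $f\in C^2([a,b])$ be a positive function. Separating variables $u(x,\theta)=\varphi(x)e^{ik\theta}$ in the eigenvalue equation $\Delta u=-\lambda u$ with Dirichlet boundary conditions on the surface of revolution generated by the graph of $f$ gives, for $k=0$, the Sturm--Liouville problem $$\varphi''+\Big(\frac{f'}{f}-\frac{f'f''}{1+f'^2}\Big)\varphi'+\lambda(1+f'^2)\varphi=0\ \text{ on }[a,b],\qquad \varphi(a)=\varphi(b)=0 .$$ For $\lambda\in\mathbb C$, the same differential equation with initial conditions $\varphi(a)=0$, $\varphi'(a)=1$ has exactly one $C^2$ solution on $[a,b]$; denote it by $\varphi_0(\lambda;\cdot)$, and put $D_0(\lambda)=\varphi_0(\lambda;b)/\varphi_0(0;b)$. By this uniqueness the eigenspaces of the Sturm--Liouville problem are one-dimensional. Its eigenvalues are positive real numbers; denote them by $\lambda_{0,1}<\lambda_{0,2}<\cdots$. Then there is a meromorphic function $\zeta_1$ on $\{\operatorname{Re}s>-1\}$, holomorphic except possibly at $s=\pm\frac12$, such that $$\zeta_1(s)=\sum_{n\ge1}\lambda_{0,n}^{-s}\quad(\operatorname{Re}s>\tfrac12),\qquad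 \zeta_1(s)=\frac{\sin\pi s}{\pi}\int_0^\infty y^{-s}\,\frac{d}{dy}\ln D_0(-y)\,dy\quad(\tfrac12<\operatorname{Re}s<1),$$ where the sum and the integral converge absolutely. This function satisfies $$\zeta_1'(0)=-\frac{\ln f(a)+\ln f(b)}{2}-\ln(2A),\qquad A=\int_a^b\frac{\sqrt{1+f'(x)^2}}{f(x)}\,dx,$$ and $\zeta_1(0)=-\frac12$. At $s=\pm\frac12$ it has at most simple poles, with residues $$\operatorname{Res}_{s=1/2}\zeta_1=\frac1{2\pi}\int_a^b\sqrt{1+f'^2}\,dx,\qquad \operatorname{Res}_{s=-1/2}\zeta_1=\frac1{2\pi}\int_a^b\Big[-\frac18\frac{f'^2}{f^2\sqrt{1+f'^2}}+\frac14\frac{f''}{f(1+f'^2)^{3/2}}\Big]dx .$$ -/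

import Mathlib

namespace RevolutionSurface

/-- First derivative of `g` on the closed interval `[a, b]` (one-sided at the end points). -/
noncomputable def d1 {E : Type*} [NormedAddCommGroup E] [NormedSpace ℝ E]
    (a b : ℝ) (g : ℝ → E) (x : ℝ) : E :=
  derivWithin g (Set.Icc a b) x

/-- Second derivative of `g` on the closed interval `[a, b]` (one-sided at the end points). -/
noncomputable def d2 {E : Type*} [NormedAddCommGroup E] [NormedSpace ℝ E]
    (a b : ℝ) (g : ℝ → E) (x : ℝ) : E :=
  derivWithin (d1 a b g) (Set.Icc a b) x

/-- `φ` is a `C²` solution on `[a, b]` of the radial equation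
`φ'' + (f'/f - f' f''/(1 + f'²)) φ' + (lam - k²/f²) (1 + f'²) φ = 0`,
obtained from `Δ u = - lam u` on the surface of revolution of the graph of `f`
by the separation `u (x, θ) = φ x * exp (i k θ)`. -/
def IsRadialSolution (f : ℝ → ℝ) (a b : ℝ) (k : ℤ) (lam : ℂ) (φ : ℝ → ℂ) : Prop :=
  ContDiffOn ℝ 2 φ (Set.Icc a b) ∧
  ∀ x ∈ Set.Icc a b,
    d2 a b φ x
      + ((d1 a b f x / f x - d1 a b f x * d2 a b f x / (1 + d1 a b f x ^ 2) : ℝ) : ℂ)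
          * d1 a b φ x
      + (lam - (((k : ℝ) ^ 2 / f x ^ 2 : ℝ) : ℂ)) * ((1 + d1 a b f x ^ 2 : ℝ) : ℂ) * φ x = 0

/-- The Dirichlet eigenvalues of the `k`-th radial problem: those `lam` for which there is a
nontrivial solution vanishing at both end points. Every eigenspace is one-dimensional
(a solution with `φ a = 0` is determined by `φ' a`), so each eigenvalue has multiplicity one
in the `k`-th problem. -/
def radialSpectrum (f : ℝ → ℝ) (a b : ℝ) (k : ℤ) : Set ℂ :=
  {lam | ∃ φ : ℝ → ℂ, IsRadialSolution f a b k lam φ ∧ φ a = 0 ∧ φ b = 0 ∧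
    ∃ x ∈ Set.Icc a b, φ x ≠ 0}

/-- `φ` solves the radial initial value problem `φ a = 0`, `φ' a = 1` on `[a, b]`. -/
def IsInitialSolution (f : ℝ → ℝ) (a b : ℝ) (k : ℤ) (lam : ℂ) (φ : ℝ → ℂ) : Prop :=
  IsRadialSolution f a b k lam φ ∧ φ a = 0 ∧ d1 a b φ a = 1

open Classical in
/-- `φ_k(lam; x)`: the solution of the initial value problem (unique on `[a, b]`). -/
noncomputable def phi (f : ℝ → ℝ) (a b : ℝ) (k : ℤ) (lam : ℂ) : ℝ → ℂ :=
  if h : ∃ φ, IsInitialSolution f a b k lam φ then h.choose else 0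

/-- `D_k(lam) = φ_k(lam; b) / φ_k(0; b)`. -/
noncomputable def charFun (f : ℝ → ℝ) (a b : ℝ) (k : ℤ) (lam : ℂ) : ℂ :=
  phi f a b k lam b / phi f a b k 0 b

/-- The integrand `y ^ (-s) * d/dy (ln D_0(-y))`, for real `y > 0`. -/
noncomputable def zetaOneIntegrand (f : ℝ → ℝ) (a b : ℝ) (s : ℂ) (y : ℝ) : ℂ :=
  (y : ℂ) ^ (-s) * deriv (fun t : ℝ => Complex.log (charFun f a b 0 (-(t : ℂ)))) y

/-- `A = ∫_a^b √(1 + f'²) / f dx`. -/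
noncomputable def constA (f : ℝ → ℝ) (a b : ℝ) : ℝ :=
  ∫ x in a..b, Real.sqrt (1 + d1 a b f x ^ 2) / f x

/-- `Z` is the meromorphic continuation of `ζ₁` to `Re s > -1`: it is holomorphic there off the
points `±1/2`, it is the sum of `lam ^ (-s)` over
the `k = 0` Dirichlet eigenvalues where this converges (`Re s > 1/2`), and it is
`(sin πs / π) ∫_0^∞ y ^ (-s) (d/dy) ln D_0(-y) dy` where this integral converges
(`1/2 < Re s < 1`). By the identity theorem, `Z` is unique off `±1/2`. -/
structure IsZetaOne (f : ℝ → ℝ) (a b : ℝ) (Z : ℂ → ℂ) : Prop where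
  meromorphic : MeromorphicOn Z {s : ℂ | -1 < s.re}
  holomorphic : DifferentiableOn ℂ Z ({s : ℂ | -1 < s.re} \ {1 / 2, -1 / 2})
  hasSum : ∀ s : ℂ, 1 / 2 < s.re →
    HasSum (fun lam : radialSpectrum f a b 0 => (lam : ℂ) ^ (-s)) (Z s)
  integrable : ∀ s : ℂ, 1 / 2 < s.re → s.re < 1 →
    MeasureTheory.IntegrableOn (zetaOneIntegrand f a b s) (Set.Ioi 0)
  integral_eq : ∀ s : ℂ, 1 / 2 < s.re → s.re < 1 →
    Z s = Complex.sin (Real.pi * s) / Real.pi * ∫ y in Set.Ioi (0 : ℝ), zetaOneIntegrand f a b s y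

end RevolutionSurface

/-!
The differential equation is the Sturm–Liouville equation `(p φ')' + lam ρ φ = 0` with
`p = f / √(1 + f'²)` and `ρ = f √(1 + f'²)`. Its initial solution is a power series in `lam` whose
coefficients are iterated integrals (`sturmSol`), so `D₀` is entire with
`|D₀ (lam)| ≤ exp (C (1 + √|lam|))`. The zeros of `D₀` are the Dirichlet eigenvalues. They are
positive, by `∫ p |φ'|² = lam ∫ ρ |φ|²`, and simple, because the Lagrange identity gives the
derivative of `D₀` at a zero as a nonzero multiple of `∫ ρ φ²`.

*Trace formula.* Dividing out the zeros in a disc of radius `R` leaves an entire function without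
zeros in the disc, bounded there by `exp (C (1 + √(2R)))`. The Borel–Carathéodory theorem and
Cauchy's estimate show that its logarithmic derivative tends to zero as `R → ∞`. Hence
`d/dy log D₀ (-y) = ∑ 1 / (lam_n + y)` (`hasSum_inv_zeros_add`).

*Expansion.* In terms of arc length `S`, the function `u = √f φ` solves `u'' = (κ² + q) u` for
`lam = -κ²`, with `q = (√f)'' / √f`. The functions `e^{-κS} (u' + κ u)` and `e^{-κS} (u' - κ u)`
are controlled by the maximum of `κ e^{-κS} |u|` alone, and since `q` is bounded this gives
`log D₀ (-y) = L √y - (log y) / 2 + c + (Q / 2) / √y + O (1 / y)`, where `L` is the length of the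
graph, `Q = ∫ q dS` and `c = -(log f(a) + log f(b)) / 2 - log (2 A)` (`isBigO_log_charFun_sub`).

*Zeta function.* Integrating the trace formula against `y^{-s}` with
`∫ y^{-s} / (l + y) dy = l^{-s} π / sin πs` gives the spectral sum for `1/2 < Re s < 1`;
integrability of `y^{-s} (log D₀ (-y))'` comes from the expansion and the monotonicity of
`log D₀ (-y)`. After an integration by parts the Mellin transform of the expansion is computed
term by term. The logarithm is subtracted as `log (1 + y) / 2`, whose contribution is exactly
`-1/2`. The remainder is `O (y)` at `0` and `O (1 / y)` at infinity, so its Mellin transform is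
holomorphic for `-1 < Re s < 1`. The resulting formula (`zetaFormula`) shows the poles, the
residues, the value and the derivative at `0` (`exists_meromorphic_zeta`).
-/


namespace RevolutionSurface

open Complex Set Filter Topology MeasureTheory

/-! ### Entire functions of order one half with simple zeros -/

/-- The Borel–Carathéodory theorem for a branch of `log G` on the disc, followed by Cauchy's estimate
for its derivative. -/
lemma norm_logDeriv_le_of_norm_le_exp {G : ℂ → ℂ} {R A : ℝ} (hR : 0 < R) (hA : 0 < A)
    (hG : Differentiable ℂ G) (h0 : G 0 = 1) (hne : ∀ z ∈ Metric.ball (0 : ℂ) R, G z ≠ 0)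
    (hb : ∀ z ∈ Metric.ball (0 : ℂ) R, ‖G z‖ ≤ Real.exp A) {z : ℂ} (hz : ‖z‖ ≤ R / 4) :
    ‖deriv G z / G z‖ ≤ 8 * A / R := by
  have hd : DifferentiableOn ℂ (fun z => deriv G z / G z) (Metric.ball 0 R) :=
    (hG.differentiableOn.deriv Metric.isOpen_ball).div hG.differentiableOn hne
  obtain ⟨h, hh0, hh⟩ := hd.isExactOn_ball.with_val_at 0 0
  have hhd : DifferentiableOn ℂ h (Metric.ball 0 R) := fun x hx =>
    (hh x hx).differentiableAt.differentiableWithinAt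
  have hexp : ∀ x ∈ Metric.ball (0 : ℂ) R, G x = Complex.exp (h x) := by
    have key : ∀ x ∈ Metric.ball (0 : ℂ) R,
        HasDerivAt (fun x => G x * Complex.exp (-h x)) 0 x := by
      intro x hx
      have := (hG x).hasDerivAt.mul ((hh x hx).neg.cexp)
      refine this.congr_deriv ?_
      rw [mul_neg, mul_neg, mul_comm (Complex.exp _), ← mul_assoc, mul_div_cancel₀ _ (hne x hx),
        add_neg_cancel]
    intro x hx
    have h1 := Metric.isOpen_ball.is_const_of_deriv_eq_zero
      (convex_ball (0 : ℂ) R).isPreconnected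
      (fun x hx => (key x hx).differentiableAt.differentiableWithinAt)
      (fun x hx => (key x hx).deriv) hx (Metric.mem_ball_self hR)
    simp only [h0, hh0, neg_zero, Complex.exp_zero, mul_one] at h1
    rw [Complex.exp_neg] at h1
    field_simp at h1
    exact h1
  have hre : MapsTo h (Metric.ball 0 R) {z | z.re ≤ A} := by
    intro x hx
    have := hb x hx
    rw [hexp x hx, Complex.norm_exp] at this
    exact Real.exp_le_exp.1 this
  have hzR : z ∈ Metric.ball (0 : ℂ) R := by rw [mem_ball_zero_iff]; linarith
  have hsub : Metric.closedBall z (R / 4) ⊆ Metric.closedBall 0 (R / 2) := by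
    intro w hw
    rw [Metric.mem_closedBall, dist_eq_norm] at hw
    rw [mem_closedBall_zero_iff]
    have := norm_add_le (w - z) z
    rw [sub_add_cancel] at this
    linarith
  have hsub' : Metric.closedBall (0 : ℂ) (R / 2) ⊆ Metric.ball 0 R := Metric.closedBall_subset_ball (by linarith)
  have hcauchy := norm_deriv_le_of_forall_mem_sphere_norm_le (f := h) (c := z) (R := R / 4)
    (C := 2 * A) (by positivity)
    ((hhd.mono (hsub.trans hsub')).diffContOnCl_ball le_rfl) (by
      intro w hw
      have hw2 := hsub (Metric.sphere_subset_closedBall hw)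
      have := borelCaratheodory_zero hA hhd hre hR (hsub' hw2) hh0
      rw [mem_closedBall_zero_iff] at hw2
      refine this.trans ?_
      rw [div_le_iff₀ (by linarith)]
      nlinarith)
  rw [(hh z hzR).deriv] at hcauchy
  refine hcauchy.trans (le_of_eq ?_)
  field_simp
  ring

/-- Finitely many distinct zeros of an entire function can be divided out. -/
lemma exists_eq_prod_mul {D : ℂ → ℂ} (hD : Differentiable ℂ D) (S : Finset ℂ)
    (hS : ∀ l ∈ S, l ≠ 0 ∧ D l = 0) :
    ∃ G : ℂ → ℂ, Differentiable ℂ G ∧ ∀ z, D z = (∏ l ∈ S, (1 - z / l)) * G z := by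
  classical
  induction S using Finset.induction_on with
  | empty => exact ⟨D, hD, by simp⟩
  | insert l S hl ih =>
    obtain ⟨G, hG, hDG⟩ := ih fun m hm => hS m (Finset.mem_insert_of_mem hm)
    obtain ⟨hl0, hDl⟩ := hS l (Finset.mem_insert_self _ _)
    have hGl : G l = 0 := by
      have h1 := hDG l
      rw [hDl, eq_comm, mul_eq_zero] at h1
      refine h1.resolve_left (Finset.prod_ne_zero_iff.2 fun m hm h => ?_)
      have hm0 := (hS m (Finset.mem_insert_of_mem hm)).1
      rw [sub_eq_zero, eq_comm, div_eq_one_iff_eq hm0] at h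
      exact hl (h ▸ hm)
    refine ⟨fun z => -l * dslope G l z, ?_, fun z => ?_⟩
    · have : DifferentiableOn ℂ (dslope G l) univ :=
        (differentiableOn_dslope univ_mem).2 hG.differentiableOn
      exact (differentiableOn_univ.1 this).const_mul _
    · have h1 := sub_smul_dslope G l z
      rw [hGl, sub_zero, smul_eq_mul] at h1
      rw [hDG z, Finset.prod_insert hl, ← h1]
      field_simp
      ring

lemma finite_zeros_inter_closedBall {D : ℂ → ℂ} (hD : Differentiable ℂ D) (h0 : D 0 = 1) (R : ℝ) :
    {z | D z = 0 ∧ ‖z‖ ≤ R}.Finite := by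
  by_contra hinf
  obtain ⟨x, -, hx⟩ := Set.Infinite.exists_accPt_of_subset_isCompact hinf
    (isCompact_closedBall (0 : ℂ) R) (fun z hz => by simpa using hz.2)
  have hfr : ∃ᶠ z in 𝓝[≠] x, D z = 0 := by
    rw [accPt_iff_frequently_nhdsNE] at hx
    exact hx.mono fun z hz => hz.1
  have := (hD.differentiableOn.analyticOnNhd isOpen_univ).eqOn_zero_of_preconnected_of_frequently_eq_zero
    isPreconnected_univ (mem_univ x) hfr (mem_univ 0)
  simp [h0] at this

/-- The logarithmic derivative of an entire function of order at most `1/2` with simple zeros is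
the limit of the sums of `1 / (z - l)` over the zeros `l` in growing discs: the quotient of
`D` by its linear factors in the disc of radius `R` has logarithmic derivative `O (1 / √R)` at a
fixed point, by the maximum principle and `norm_logDeriv_le_of_norm_le_exp`. -/
lemma tendsto_sum_inv_sub_zeros {D : ℂ → ℂ} {C : ℝ} (hD : Differentiable ℂ D) (h0 : D 0 = 1)
    (hC : ∀ z, ‖D z‖ ≤ Real.exp (C * (1 + √‖z‖))) (hsimple : ∀ z, D z = 0 → deriv D z ≠ 0)
    {z : ℂ} (hz : D z ≠ 0) :
    Tendsto (fun R : ℝ => ∑ l ∈ (finite_zeros_inter_closedBall hD h0 R).toFinset, 1 / (z - l))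
      atTop (𝓝 (deriv D z / D z)) := by
  have hC0 : 0 ≤ C := by
    have := hC 0
    simp only [h0, norm_one, norm_zero, Real.sqrt_zero, add_zero, mul_one] at this
    exact Real.one_le_exp_iff.1 this
  have hbound : ∀ᶠ R : ℝ in atTop,
      ‖deriv D z / D z - ∑ l ∈ (finite_zeros_inter_closedBall hD h0 R).toFinset, 1 / (z - l)‖
        ≤ 8 * ((C + 1) * (1 + √(2 * R))) / R := by
    filter_upwards [eventually_gt_atTop 0, eventually_ge_atTop (4 * ‖z‖)] with R hR hRz
    set S := (finite_zeros_inter_closedBall hD h0 R).toFinset with hS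
    have hmem : ∀ l, l ∈ S ↔ D l = 0 ∧ ‖l‖ ≤ R := fun l => by simp [hS]
    have hSne : ∀ l ∈ S, l ≠ 0 := by
      rintro l hl rfl
      simp [hmem, h0] at hl
    obtain ⟨G, hG, hDG⟩ := exists_eq_prod_mul hD S fun l hl => ⟨hSne l hl, ((hmem l).1 hl).1⟩
    have hG0 : G 0 = 1 := by
      have := hDG 0
      simpa [h0, eq_comm] using this
    set P : ℂ → ℂ := fun z => ∏ l ∈ S, (1 - z / l) with hP
    have hPd : Differentiable ℂ P := by
      rw [hP]; fun_prop
    have hDPG : D = fun z => P z * G z := funext hDG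
    have hGne : ∀ w ∈ Metric.ball (0 : ℂ) R, G w ≠ 0 := by
      intro w hw hGw
      have hDw : D w = 0 := by rw [hDG, hGw, mul_zero]
      have hwS : w ∈ S := (hmem w).2 ⟨hDw, (mem_ball_zero_iff.1 hw).le⟩
      have hPw : P w = 0 := Finset.prod_eq_zero hwS (by rw [div_self (hSne w hwS), sub_self])
      apply hsimple w hDw
      have := (hPd w).hasDerivAt.mul (hG w).hasDerivAt
      rw [hDPG]
      exact this.deriv.trans (by rw [hPw, hGw]; ring)
    have hGb : ∀ w ∈ Metric.ball (0 : ℂ) R, ‖G w‖ ≤ Real.exp ((C + 1) * (1 + √(2 * R))) := by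
      intro w hw
      refine norm_le_of_forall_mem_frontier_norm_le (U := Metric.ball (0 : ℂ) (2 * R)) Metric.isBounded_ball
        hG.diffContOnCl (fun v hv => ?_) (subset_closure (Metric.ball_subset_ball (by linarith) hw))
      rw [frontier_ball _ (by positivity), mem_sphere_zero_iff_norm] at hv
      have hP1 : 1 ≤ ‖P v‖ := by
        rw [hP]
        simp only [norm_prod]
        refine Finset.one_le_prod fun l hl => ?_
        have hl' := norm_pos_iff.2 (hSne l hl)
        have h1 : 2 ≤ ‖v / l‖ := by
          rw [norm_div, hv, le_div_iff₀ hl']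
          linarith [((hmem l).1 hl).2]
        have h2 := norm_sub_norm_le (v / l) 1
        rw [norm_one, norm_sub_rev] at h2
        linarith
      calc ‖G v‖ ≤ ‖P v‖ * ‖G v‖ := le_mul_of_one_le_left (norm_nonneg _) hP1
        _ = ‖D v‖ := by rw [hDG v, norm_mul]
        _ ≤ Real.exp (C * (1 + √‖v‖)) := hC v
        _ ≤ _ := by
          rw [hv]
          gcongr
          linarith
    have hmain := norm_logDeriv_le_of_norm_le_exp hR (by positivity) hG hG0 hGne hGb
      (z := z) (by linarith)
    have hPz : P z ≠ 0 := fun h => hz (by rw [hDG z]; exact mul_eq_zero_of_left h _)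
    have hGz : G z ≠ 0 := fun h => hz (by rw [hDG z, h, mul_zero])
    have hlog : deriv D z / D z = (∑ l ∈ S, 1 / (z - l)) + deriv G z / G z := by
      have h1 : logDeriv D z = logDeriv P z + logDeriv G z := by
        rw [hDPG]
        exact logDeriv_mul z hPz hGz (hPd z) (hG z)
      have h2 : logDeriv P z = ∑ l ∈ S, 1 / (z - l) := by
        have hne : ∀ l ∈ S, 1 - z / l ≠ 0 := Finset.prod_ne_zero_iff.1 hPz
        have h3 := logDeriv_prod (𝕜 := ℂ) (s := S) (f := fun l z => 1 - z / l) (x := z) hne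
          (fun l _ => by fun_prop)
        rw [hP]
        refine h3.trans ?_
        refine Finset.sum_congr rfl fun l hl => ?_
        have hl0 := hSne l hl
        have h4 : HasDerivAt (fun z : ℂ => 1 - z / l) (-(1 / l)) z :=
          ((hasDerivAt_id z).div_const l).const_sub 1
        have h5 : z - l ≠ 0 := fun h => hne l hl (by rw [sub_eq_zero.1 h, div_self hl0, sub_self])
        have h6 := hne l hl
        rw [logDeriv_apply, h4.deriv, div_eq_div_iff h6 h5]
        field_simp
        ring
      simp only [← logDeriv_apply]
      rw [h1, h2]
    rw [hlog, add_sub_cancel_left]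
    exact hmain
  have hlim : Tendsto (fun R : ℝ => 8 * ((C + 1) * (1 + √(2 * R))) / R) atTop (𝓝 0) := by
    have h1 : Tendsto (fun R : ℝ => (8 * (C + 1)) * R⁻¹ + (8 * (C + 1) * √2) * (√R)⁻¹) atTop
        (𝓝 ((8 * (C + 1)) * 0 + (8 * (C + 1) * √2) * 0)) :=
      (tendsto_inv_atTop_zero.const_mul _).add
        ((tendsto_inv_atTop_zero.comp Real.tendsto_sqrt_atTop).const_mul _)
    rw [mul_zero, mul_zero, add_zero] at h1
    refine h1.congr' ?_
    filter_upwards [eventually_gt_atTop 0] with R hR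
    rw [Real.sqrt_mul (by norm_num)]
    have h2 : √R * √R = R := Real.mul_self_sqrt hR.le
    have h3 : 0 < √R := Real.sqrt_pos.2 hR
    have h4 : R⁻¹ = (√R)⁻¹ * (√R)⁻¹ := by rw [← mul_inv, h2]
    rw [div_eq_mul_inv, h4]
    field_simp
  have := squeeze_zero_norm' hbound hlim
  have h2 := (tendsto_const_nhds (x := deriv D z / D z)).sub this
  simpa using h2

/-- Partial fractions on the negative axis for an entire function of order at most `1/2` whose
zeros are simple and positive. -/
theorem hasSum_inv_zeros_add {D : ℂ → ℂ} {C : ℝ} (hD : Differentiable ℂ D) (h0 : D 0 = 1)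
    (hC : ∀ z, ‖D z‖ ≤ Real.exp (C * (1 + √‖z‖))) (hsimple : ∀ z, D z = 0 → deriv D z ≠ 0)
    (hpos : ∀ z, D z = 0 → ∃ r : ℝ, 0 < r ∧ z = r) {y : ℝ} (hy : 0 ≤ y) :
    ∃ d : ℝ, HasSum (fun l : {z | D z = 0} => 1 / ((l : ℂ).re + y)) d ∧
      deriv D (-y) / D (-y) = -(d : ℂ) := by
  have hDy : D (-y) ≠ 0 := by
    intro h
    obtain ⟨r, hr, h⟩ := hpos _ h
    have : -y = r := by exact_mod_cast h
    linarith
  have hlim := tendsto_sum_inv_sub_zeros hD h0 hC hsimple hDy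
  set T : ℝ → Finset {z | D z = 0} := fun R =>
    (finite_zeros_inter_closedBall hD h0 R).toFinset.subtype _ with hT
  have hsum : ∀ R : ℝ, ∑ l ∈ (finite_zeros_inter_closedBall hD h0 R).toFinset, 1 / (-(y : ℂ) - l)
      = ((-∑ l ∈ T R, 1 / ((l : ℂ).re + y) : ℝ) : ℂ) := by
    intro R
    push_cast
    rw [hT, ← Finset.sum_neg_distrib]
    rw [← Finset.sum_subtype_of_mem (p := fun z => z ∈ {z | D z = 0}) (fun l : ℂ => 1 / (-(y : ℂ) - l))
      (fun l hl => by simpa using (by simpa using hl : D l = 0 ∧ ‖l‖ ≤ R).1)]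
    refine Finset.sum_congr rfl fun l _ => ?_
    obtain ⟨r, hr, hl⟩ := hpos l l.2
    rw [hl, Complex.ofReal_re, ← neg_add', add_comm, one_div_neg_eq_neg_one_div]
  simp only [hsum] at hlim
  have hre := (Complex.continuous_re.tendsto _).comp hlim
  have him := (Complex.continuous_im.tendsto _).comp hlim
  simp only [Function.comp_def, Complex.ofReal_re, Complex.ofReal_im] at hre him
  have him0 := tendsto_nhds_unique him tendsto_const_nhds
  have hre' := hre.neg
  simp only [neg_neg] at hre'
  refine ⟨-(deriv D (-y) / D (-y)).re, ?_, ?_⟩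
  · have hTmono : Monotone T := by
      intro R R' hRR' l hl
      simp only [hT, Finset.mem_subtype, Finite.mem_toFinset, mem_ofPred_eq] at hl ⊢
      exact ⟨hl.1, hl.2.trans hRR'⟩
    have hTtop : Tendsto T atTop atTop := by
      refine tendsto_atTop_finset_of_monotone hTmono fun l => ⟨‖(l : ℂ)‖, ?_⟩
      simp only [hT, Finset.mem_subtype, Finite.mem_toFinset, mem_ofPred_eq]
      exact ⟨l.2, le_rfl⟩
    have hnn : ∀ l : {z | D z = 0}, 0 ≤ 1 / ((l : ℂ).re + y) := by
      intro l
      obtain ⟨r, hr, hl⟩ := hpos l l.2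
      rw [hl, Complex.ofReal_re]
      positivity
    have hmono : Monotone fun R => ∑ l ∈ T R, 1 / ((l : ℂ).re + y) := by
      intro R R' hRR'
      exact Finset.sum_le_sum_of_subset_of_nonneg (hTmono hRR') fun l _ _ => hnn l
    have hsummable : Summable fun l : {z | D z = 0} => 1 / ((l : ℂ).re + y) := by
      refine summable_of_sum_le (c := -(deriv D (-y) / D (-y)).re) hnn fun u => ?_
      obtain ⟨R, hR⟩ := (hTtop.eventually_ge_atTop u).exists
      exact (Finset.sum_le_sum_of_subset_of_nonneg hR fun l _ _ => hnn l).trans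
        (hmono.ge_of_tendsto hre' R)
    have := hsummable.hasSum
    rwa [tendsto_nhds_unique (this.comp hTtop) hre'] at this
  · apply Complex.ext <;> simp [him0]

/-! ### Mellin integrals of resolvents -/

/-- `∫₀^∞ y^{-s} / (l + y) dy = l^{-s} π / sin (π s)`: the Euler beta integral in the variable
`y / (l + y)`. -/
lemma integrableOn_and_integral_cpow_div_add {l : ℝ} (hl : 0 < l) {s : ℂ} (h0 : 0 < s.re)
    (h1 : s.re < 1) :
    IntegrableOn (fun y : ℝ => (y : ℂ) ^ (-s) * (1 / (l + y) : ℝ)) (Ioi 0) ∧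
    ∫ y in Ioi (0 : ℝ), (y : ℂ) ^ (-s) * (1 / (l + y) : ℝ)
      = (l : ℂ) ^ (-s) * (Real.pi / Complex.sin (Real.pi * s)) := by
  have hl' : (l : ℂ) ≠ 0 := by exact_mod_cast hl.ne'
  have hne : ∀ y ∈ Ioi (0 : ℝ), l + y ≠ 0 := fun y hy => (add_pos hl hy).ne'
  have hder : ∀ y ∈ Ioi (0 : ℝ), HasDerivWithinAt (fun y => y / (l + y)) (l / (l + y) ^ 2)
      (Ioi 0) y := by
    intro y hy
    have h2 := ((hasDerivAt_id y).div ((hasDerivAt_id y).const_add l) (hne y hy)).hasDerivWithinAt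
      (s := Ioi 0)
    refine h2.congr_deriv ?_
    simp
  have hinj : InjOn (fun y => y / (l + y)) (Ioi (0 : ℝ)) := by
    intro x hx y hy hxy
    have h2 := (div_eq_div_iff (hne x hx) (hne y hy)).1 hxy
    have : l * (x - y) = 0 := by linarith
    have h3 := (mul_eq_zero.1 this).resolve_left hl.ne'
    linarith
  have himg : (fun y => y / (l + y)) '' Ioi (0 : ℝ) = Ioo 0 1 := by
    ext u
    constructor
    · rintro ⟨y, hy, rfl⟩
      have h2 : 0 < l + y := add_pos hl hy
      exact ⟨div_pos hy h2, (div_lt_one h2).2 (by linarith)⟩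
    · rintro ⟨hu0, hu1⟩
      have h2 : 0 < 1 - u := by linarith
      refine ⟨l * u / (1 - u), div_pos (mul_pos hl hu0) h2, ?_⟩
      have h3 : l + l * u / (1 - u) = l / (1 - u) := by field_simp; ring
      simp only [h3]
      field_simp
  set B : ℝ → ℂ := fun x => (x : ℂ) ^ ((1 - s) - 1) * (1 - (x : ℂ)) ^ (s - 1) with hB
  have hcomp : ∀ y ∈ Ioi (0 : ℝ), |l / (l + y) ^ 2| • B (y / (l + y))
      = (l : ℂ) ^ s * ((y : ℂ) ^ (-s) * (1 / (l + y) : ℝ)) := by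
    intro y hy
    have hy : 0 < y := hy
    have hly : 0 < l + y := add_pos hl hy
    have hlyc : ((l + y : ℝ) : ℂ) ≠ 0 := by exact_mod_cast hly.ne'
    rw [abs_of_pos (by positivity), hB]
    have e1 : (1 : ℂ) - ((y / (l + y) : ℝ) : ℂ) = ((l / (l + y) : ℝ) : ℂ) := by
      rw [← Complex.ofReal_one, ← Complex.ofReal_sub]
      congr 1
      field_simp
      ring
    simp only [e1]
    have e2 : ∀ (x : ℝ) (_ : 0 < x) (z : ℂ), ((x / (l + y) : ℝ) : ℂ) ^ z
        = (x : ℂ) ^ z * ((l + y : ℝ) : ℂ) ^ (-z) := by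
      intro x hx z
      rw [div_eq_mul_inv, Complex.ofReal_mul, Complex.mul_cpow_ofReal_nonneg hx.le (by positivity),
        Complex.ofReal_inv, Complex.inv_cpow _ _ (by
          rw [Complex.arg_ofReal_of_nonneg hly.le]; exact Real.pi_pos.ne), Complex.cpow_neg]
    rw [e2 y hy, e2 l hl, real_smul]
    have e3 : (l : ℂ) ^ s = (l : ℂ) ^ (s - 1) * l := by
      rw [Complex.cpow_sub _ _ hl', Complex.cpow_one]
      field_simp
    have e4 : ((l + y : ℝ) : ℂ) ^ (-(1 - s - 1)) * ((l + y : ℝ) : ℂ) ^ (-(s - 1))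
        = ((l + y : ℝ) : ℂ) := by
      rw [← Complex.cpow_add _ _ hlyc]
      ring_nf
      exact Complex.cpow_one _
    have e5 : 1 - s - 1 = -s := by ring
    rw [e3]
    calc _ = ((l / (l + y) ^ 2 : ℝ) : ℂ) * ((y : ℂ) ^ (1 - s - 1) * (l : ℂ) ^ (s - 1)) *
          (((l + y : ℝ) : ℂ) ^ (-(1 - s - 1)) * ((l + y : ℝ) : ℂ) ^ (-(s - 1))) := by ring
      _ = _ := by
        rw [e4, e5]
        push_cast at hlyc ⊢
        field_simp
  have hls : (l : ℂ) ^ s ≠ 0 := by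
    rw [Ne, Complex.cpow_eq_zero_iff]
    exact fun h => hl' h.1
  have hsre : 0 < (1 - s).re := by simpa using h1
  have hBint : IntegrableOn B (Ioo 0 1) := by
    have := Complex.betaIntegral_convergent hsre h0
    rw [intervalIntegrable_iff_integrableOn_Ioo_of_le zero_le_one] at this
    exact this
  constructor
  · have h2 := (integrableOn_image_iff_integrableOn_abs_deriv_smul measurableSet_Ioi hder hinj B).1
      (by rw [himg]; exact hBint)
    rw [integrableOn_congr_fun hcomp measurableSet_Ioi] at h2
    have h3 := h2.const_mul (((l : ℂ) ^ s)⁻¹)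
    exact h3.congr (Eventually.of_forall fun y => inv_mul_cancel_left₀ hls _)
  · have h2 := integral_image_eq_integral_abs_deriv_smul measurableSet_Ioi hder hinj B
    rw [himg, setIntegral_congr_fun measurableSet_Ioi hcomp, integral_const_mul,
      ← integral_Ioc_eq_integral_Ioo, ← intervalIntegral.integral_of_le zero_le_one] at h2
    have h3 : ∫ x in (0 : ℝ)..1, B x = Complex.betaIntegral (1 - s) s := rfl
    have h4 := Complex.Gamma_mul_Gamma_eq_betaIntegral hsre h0
    rw [sub_add_cancel, Complex.Gamma_one, one_mul, mul_comm, Complex.Gamma_mul_Gamma_one_sub] at h4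
    rw [h3, ← h4] at h2
    rw [h2, Complex.cpow_neg, inv_mul_cancel_left₀ hls]

lemma integral_rpow_div_add {l : ℝ} (hl : 0 < l) {σ : ℝ} (h0 : 0 < σ) (h1 : σ < 1) :
    IntegrableOn (fun y : ℝ => y ^ (-σ) * (1 / (l + y))) (Ioi 0) ∧
    ∫ y in Ioi (0 : ℝ), y ^ (-σ) * (1 / (l + y)) = l ^ (-σ) * (Real.pi / Real.sin (Real.pi * σ)) := by
  obtain ⟨hi, he⟩ := integrableOn_and_integral_cpow_div_add hl (s := σ) (by simpa) (by simpa)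
  have hc : ∀ y ∈ Ioi (0 : ℝ), (y : ℂ) ^ (-(σ : ℂ)) * (1 / (l + y) : ℝ)
      = ((y ^ (-σ) * (1 / (l + y)) : ℝ) : ℂ) := by
    intro y hy
    rw [Complex.ofReal_mul, Complex.ofReal_cpow (le_of_lt hy), Complex.ofReal_neg]
  rw [integrableOn_congr_fun hc measurableSet_Ioi] at hi
  rw [setIntegral_congr_fun measurableSet_Ioi hc, integral_complex_ofReal] at he
  refine ⟨hi.re, ?_⟩
  have h2 : (l : ℂ) ^ (-(σ : ℂ)) = ((l ^ (-σ) : ℝ) : ℂ) := by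
    rw [Complex.ofReal_cpow hl.le, Complex.ofReal_neg]
  rw [h2] at he
  exact_mod_cast he

lemma locallyIntegrableOn_ofReal_of_hasDerivAt {k k' : ℝ → ℝ}
    (hk : ∀ y ∈ Ioi (0 : ℝ), HasDerivAt k (k' y) y) :
    LocallyIntegrableOn (fun y => (k y : ℂ)) (Ioi 0) := by
  refine ContinuousOn.locallyIntegrableOn (fun y hy => ?_) measurableSet_Ioi
  exact (Complex.continuous_ofReal.continuousAt.comp (hk y hy).continuousAt).continuousWithinAt

lemma mellinConvergent_neg {k k' : ℝ → ℝ}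
    (hk : ∀ y ∈ Ioi (0 : ℝ), HasDerivAt k (k' y) y)
    (hk0 : k =O[𝓝[>] 0] fun y => y) (hkt : k =O[atTop] fun y => √y)
    {s : ℂ} (h1 : 1 / 2 < s.re) (h2 : s.re < 1) :
    MellinConvergent (fun y => (k y : ℂ)) (-s) := by
  refine mellinConvergent_of_isBigO_rpow (a := -(1 / 2)) (b := -1)
    (locallyIntegrableOn_ofReal_of_hasDerivAt hk) ?_ (by simpa using h1) ?_ (by simpa using h2)
  · refine (Asymptotics.IsBigO.of_norm_left (f' := fun y => (k y : ℂ)) ?_)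
    simp only [norm_real, neg_neg, ← Real.sqrt_eq_rpow]
    exact hkt.norm_left
  · refine (Asymptotics.IsBigO.of_norm_left (f' := fun y => (k y : ℂ)) ?_)
    simp only [norm_real, neg_neg, Real.rpow_one]
    exact hk0.norm_left

/-- Integration by parts; the growth bounds make both boundary terms vanish for
`1 / 2 < Re s < 1`. -/
lemma integral_cpow_mul_deriv_eq_mellin {k k' : ℝ → ℝ}
    (hk : ∀ y ∈ Ioi (0 : ℝ), HasDerivAt k (k' y) y)
    (hk0 : k =O[𝓝[>] 0] fun y => y) (hkt : k =O[atTop] fun y => √y)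
    {s : ℂ} (h1 : 1 / 2 < s.re) (h2 : s.re < 1)
    (hint : IntegrableOn (fun y : ℝ => (y : ℂ) ^ (-s) * (k' y : ℂ)) (Ioi 0)) :
    ∫ y in Ioi (0 : ℝ), (y : ℂ) ^ (-s) * (k' y : ℂ) = s * mellin (fun y => (k y : ℂ)) (-s) := by
  have hs0 : -s ≠ 0 := by
    intro h
    have := congrArg Complex.re h
    simp only [neg_re, zero_re] at this
    linarith
  have hu : ∀ y ∈ Ioi (0 : ℝ), HasDerivAt (fun y : ℝ => (y : ℂ) ^ (-s))
      ((-s) * (y : ℂ) ^ (-s - 1)) y := by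
    intro y hy
    exact hasDerivAt_ofReal_cpow_const (ne_of_gt hy) hs0
  have hconv := mellinConvergent_neg hk hk0 hkt h1 h2
  have hnorm : ∀ y ∈ Ioi (0 : ℝ), ‖(y : ℂ) ^ (-s) * (k y : ℂ)‖ = y ^ (-s.re) * |k y| := by
    intro y hy
    rw [norm_mul, norm_real, Real.norm_eq_abs, Complex.norm_cpow_eq_rpow_re_of_pos hy, neg_re]
  have hz : Tendsto ((fun y : ℝ => (y : ℂ) ^ (-s)) * fun y => (k y : ℂ)) (𝓝[>] 0) (𝓝 0) := by
    obtain ⟨C, hC⟩ := hk0.bound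
    refine squeeze_zero_norm' (a := fun y => C * y ^ (1 - s.re)) ?_ ?_
    · filter_upwards [hC, self_mem_nhdsWithin] with y hy hy0
      have hy0' : 0 < y := hy0
      refine (hnorm y hy0).trans_le ?_
      rw [Real.norm_eq_abs, Real.norm_eq_abs, abs_of_pos hy0'] at hy
      calc y ^ (-s.re) * |k y| ≤ y ^ (-s.re) * (C * y) := by gcongr
        _ = C * (y ^ (-s.re) * y ^ (1 : ℝ)) := by rw [Real.rpow_one]; ring
        _ = _ := by rw [← Real.rpow_add hy0']; ring_nf
    · have : Tendsto (fun y : ℝ => C * y ^ (1 - s.re)) (𝓝 0) (𝓝 (C * 0 ^ (1 - s.re))) :=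
        ((Real.continuousAt_rpow_const 0 _ (Or.inr (by linarith))).const_mul C)
      rw [Real.zero_rpow (by linarith), mul_zero] at this
      exact this.mono_left nhdsWithin_le_nhds
  have hi : Tendsto ((fun y : ℝ => (y : ℂ) ^ (-s)) * fun y => (k y : ℂ)) atTop (𝓝 0) := by
    obtain ⟨C, hC⟩ := hkt.bound
    refine squeeze_zero_norm' (a := fun y => C * y ^ (-(s.re - 1 / 2))) ?_ ?_
    · filter_upwards [hC, eventually_gt_atTop 0] with y hy hy0
      refine (hnorm y hy0).trans_le ?_
      rw [Real.norm_eq_abs, Real.norm_eq_abs, abs_of_nonneg (Real.sqrt_nonneg _),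
        Real.sqrt_eq_rpow] at hy
      calc y ^ (-s.re) * |k y| ≤ y ^ (-s.re) * (C * y ^ (1 / 2 : ℝ)) := by gcongr
        _ = C * (y ^ (-s.re) * y ^ (1 / 2 : ℝ)) := by ring
        _ = _ := by rw [← Real.rpow_add hy0]; ring_nf
    · simpa using (tendsto_rpow_neg_atTop (y := s.re - 1 / 2) (by linarith)).const_mul C
  have hcong : ∀ y : ℝ, (-s * (y : ℂ) ^ (-s - 1)) * (k y : ℂ)
      = -s * ((y : ℂ) ^ (-s - 1) • (k y : ℂ)) := fun y => by rw [smul_eq_mul]; ring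
  have key := integral_Ioi_mul_deriv_eq_deriv_mul (a := 0) (v := fun y => (k y : ℂ))
    (v' := fun y => (k' y : ℂ)) hu (fun y hy => (hk y hy).ofReal_comp) hint
    (by
      have := Integrable.const_mul hconv (-s)
      refine this.congr (Eventually.of_forall fun y => ?_)
      exact (hcong y).symm) hz hi
  rw [key, mellin]
  simp only [hcong]
  rw [integral_const_mul]
  ring

/-- If `k` is increasing and `O(√y)`, then `y^{-σ} k'(y)` is integrable for `1/2 < σ < 1`. -/
lemma integrableOn_rpow_mul_deriv {k k' : ℝ → ℝ}
    (hk : ∀ y ∈ Ioi (0 : ℝ), HasDerivAt k (k' y) y)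
    (hk0 : k =O[𝓝[>] 0] fun y => y) (hkt : k =O[atTop] fun y => √y)
    (hk00 : k 0 = 0) (hpos : ∀ y ∈ Ioi (0 : ℝ), 0 ≤ k' y) {σ : ℝ}
    (h1 : 1 / 2 < σ) (h2 : σ < 1) :
    IntegrableOn (fun y : ℝ => y ^ (-σ) * k' y) (Ioi 0) := by
  set q : ℝ → ℝ := fun y => y ^ (-σ - 1) * k y with hq
  have hqint : IntegrableOn q (Ioi 0) := by
    have hconv := mellinConvergent_neg hk hk0 hkt (s := σ) (by simpa using h1) (by simpa using h2)
    have hre := Integrable.re hconv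
    refine IntegrableOn.congr_fun hre (fun y hy => ?_) measurableSet_Ioi
    have : (y : ℂ) ^ (-(σ : ℂ) - 1) = ((y ^ (-σ - 1) : ℝ) : ℂ) := by
      rw [Complex.ofReal_cpow (le_of_lt hy)]
      push_cast
      rfl
    simp only [this, smul_eq_mul, ← Complex.ofReal_mul, hq]
    rfl
  have hqcont : ∀ y ∈ Ioi (0 : ℝ), ContinuousAt q y := fun y hy =>
    (Real.continuousAt_rpow_const y _ (Or.inl (ne_of_gt hy))).mul (hk y hy).continuousAt
  have hii : ∀ y : ℝ, 0 ≤ y → IntervalIntegrable q volume 0 y := fun y hy =>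
    (intervalIntegrable_iff_integrableOn_Ioc_of_le hy).2 (hqint.mono_set Ioc_subset_Ioi_self)
  -- the derivative of `y^{-σ} k(y) + σ ∫₀^y q` is the integrand
  have hder : ∀ y ∈ Ioi (0 : ℝ), HasDerivAt (fun y => y ^ (-σ) * k y + σ * ∫ t in (0 : ℝ)..y, q t)
      (y ^ (-σ) * k' y) y := by
    intro y hy
    have hy0 : 0 < y := hy
    have d1 := (Real.hasDerivAt_rpow_const (x := y) (p := -σ) (Or.inl hy0.ne')).mul (hk y hy)
    have d2 : HasDerivAt (fun y => ∫ t in (0 : ℝ)..y, q t) (q y) y :=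
      intervalIntegral.integral_hasDerivAt_right (hii y hy0.le)
        (ContinuousOn.stronglyMeasurableAtFilter isOpen_Ioi
          (fun z hz => (hqcont z hz).continuousWithinAt) y hy) (hqcont y hy)
    refine (d1.add (d2.const_mul σ)).congr_deriv ?_
    simp only [hq]
    ring
  refine integrableOn_Ioi_deriv_of_nonneg (l := 0 + σ * ∫ t in Ioi (0 : ℝ), q t) ?_ hder
    (fun y hy => mul_nonneg (Real.rpow_nonneg (le_of_lt hy) _) (hpos y hy)) ?_
  · refine ContinuousWithinAt.add ?_ (ContinuousWithinAt.mul continuousWithinAt_const ?_)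
    · rw [← continuousWithinAt_Ioi_iff_Ici]
      obtain ⟨C, hC⟩ := hk0.bound
      rw [ContinuousWithinAt, hk00, mul_zero]
      refine squeeze_zero_norm' (a := fun y => C * y ^ (1 - σ)) ?_ ?_
      · filter_upwards [hC, self_mem_nhdsWithin] with y hy hy0
        have hy0' : 0 < y := hy0
        rw [Real.norm_eq_abs y, abs_of_pos hy0'] at hy
        rw [norm_mul, Real.norm_of_nonneg (Real.rpow_nonneg hy0'.le _)]
        calc y ^ (-σ) * ‖k y‖ ≤ y ^ (-σ) * (C * y) := by gcongr
          _ = C * (y ^ (-σ) * y ^ (1 : ℝ)) := by rw [Real.rpow_one]; ring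
          _ = _ := by rw [← Real.rpow_add hy0']; ring_nf
      · have : Tendsto (fun y : ℝ => C * y ^ (1 - σ)) (𝓝 0) (𝓝 (C * 0 ^ (1 - σ))) :=
          ((Real.continuousAt_rpow_const 0 _ (Or.inr (by linarith))).const_mul C)
        rw [Real.zero_rpow (by linarith), mul_zero] at this
        exact this.mono_left nhdsWithin_le_nhds
    · have hc := intervalIntegral.continuousOn_primitive_interval' (hii 1 zero_le_one)
        (left_mem_uIcc (a := (0 : ℝ)) (b := 1))
      rw [uIcc_of_le zero_le_one] at hc
      exact (hc 0 (left_mem_Icc.2 zero_le_one)).mono_of_mem_nhdsWithin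
        (Icc_mem_nhdsGE zero_lt_one)
  · refine Tendsto.add ?_ ((intervalIntegral_tendsto_integral_Ioi 0 hqint tendsto_id).const_mul σ)
    obtain ⟨C, hC⟩ := hkt.bound
    refine squeeze_zero_norm' (a := fun y => C * y ^ (-(σ - 1 / 2))) ?_ ?_
    · filter_upwards [hC, eventually_gt_atTop 0] with y hy hy0
      rw [Real.norm_of_nonneg (Real.sqrt_nonneg _), Real.sqrt_eq_rpow] at hy
      rw [norm_mul, Real.norm_of_nonneg (Real.rpow_nonneg hy0.le _)]
      calc y ^ (-σ) * ‖k y‖ ≤ y ^ (-σ) * (C * y ^ (1 / 2 : ℝ)) := by gcongr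
        _ = C * (y ^ (-σ) * y ^ (1 / 2 : ℝ)) := by ring
        _ = _ := by rw [← Real.rpow_add hy0]; ring_nf
    · simpa using (tendsto_rpow_neg_atTop (y := σ - 1 / 2) (by linarith)).const_mul C

/-! ### Spectral sums as Mellin integrals -/

lemma summable_rpow_neg_of_integrableOn {ι : Type*} {l : ι → ℝ} (hl : ∀ i, 0 < l i) {g' : ℝ → ℝ}
    (hsum : ∀ y ∈ Ioi (0 : ℝ), HasSum (fun i => 1 / (l i + y)) (g' y)) {σ : ℝ} (h0 : 0 < σ)
    (h1 : σ < 1) (hint : IntegrableOn (fun y : ℝ => y ^ (-σ) * g' y) (Ioi 0)) :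
    Summable fun i => l i ^ (-σ) := by
  have hK : 0 < Real.pi / Real.sin (Real.pi * σ) := by
    refine div_pos Real.pi_pos (Real.sin_pos_of_pos_of_lt_pi (by positivity) ?_)
    nlinarith [Real.pi_pos]
  have hnn : ∀ i, ∀ y ∈ Ioi (0 : ℝ), 0 ≤ 1 / (l i + y) := fun i y hy =>
    one_div_nonneg.2 (add_pos (hl i) hy).le
  refine summable_of_sum_le (c := (∫ y in Ioi (0 : ℝ), y ^ (-σ) * g' y) /
    (Real.pi / Real.sin (Real.pi * σ))) (fun i => Real.rpow_nonneg (hl i).le _) fun u => ?_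
  rw [le_div_iff₀ hK, Finset.sum_mul]
  simp only [← (integral_rpow_div_add (hl _) h0 h1).2]
  rw [← integral_finsetSum _ fun i _ => (integral_rpow_div_add (hl i) h0 h1).1]
  refine setIntegral_mono_on (integrable_finsetSum _ fun i _ =>
    (integral_rpow_div_add (hl i) h0 h1).1) hint measurableSet_Ioi fun y hy => ?_
  rw [← Finset.mul_sum]
  refine mul_le_mul_of_nonneg_left ?_ (Real.rpow_nonneg (le_of_lt hy) _)
  exact sum_le_hasSum u (fun i _ => hnn i y hy) (hsum y hy)

lemma integrableOn_cpow_mul {g' : ℝ → ℝ} {s : ℂ}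
    (hint : IntegrableOn (fun y : ℝ => y ^ (-s.re) * g' y) (Ioi 0)) :
    IntegrableOn (fun y : ℝ => (y : ℂ) ^ (-s) * (g' y : ℂ)) (Ioi 0) := by
  have hcont : ContinuousOn (fun y : ℝ => (y : ℂ) ^ (-s + s.re)) (Ioi 0) := fun y hy =>
    ((continuousAt_ofReal_cpow_const y _ (Or.inr (ne_of_gt hy)))).continuousWithinAt
  have h1 : IntegrableOn
      (fun y : ℝ => ((y ^ (-s.re) * g' y : ℝ) : ℂ) * (y : ℂ) ^ (-s + s.re)) (Ioi 0) := by
    refine Integrable.mul_bdd (c := 1) hint.ofReal (hcont.aestronglyMeasurable measurableSet_Ioi) ?_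
    filter_upwards [ae_restrict_mem measurableSet_Ioi] with y hy
    rw [Complex.norm_cpow_eq_rpow_re_of_pos hy]
    simp
  refine h1.congr_fun (fun y hy => ?_) measurableSet_Ioi
  have hy0 : (y : ℂ) ≠ 0 := by exact_mod_cast (ne_of_gt hy)
  simp only
  rw [Complex.ofReal_mul, Complex.ofReal_cpow (le_of_lt hy), mul_right_comm,
    ← Complex.cpow_add _ _ hy0]
  push_cast
  ring_nf

lemma sin_pi_mul_ne_zero {s : ℂ} (h0 : 0 < s.re) (h1 : s.re < 1) :
    Complex.sin (Real.pi * s) ≠ 0 := by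
  intro h
  rw [Complex.sin_eq_zero_iff] at h
  obtain ⟨k, hk⟩ := h
  have hpi : (Real.pi : ℂ) ≠ 0 := by exact_mod_cast Real.pi_ne_zero
  have : s = k := by
    rw [mul_comm] at hk
    exact mul_right_cancel₀ hpi hk
  rw [this, Complex.intCast_re] at h0 h1
  have h2 : (0 : ℤ) < k := by exact_mod_cast h0
  have h3 : k < (1 : ℤ) := by exact_mod_cast h1
  omega

/-- Termwise integration of `g'(y) = ∑ 1 / (l + y)` against `y^{-s}`. -/
lemma hasSum_cpow_neg {ι : Type*} {l : ι → ℝ} (hl : ∀ i, 0 < l i) {g' : ℝ → ℝ}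
    (hsum : ∀ y ∈ Ioi (0 : ℝ), HasSum (fun i => 1 / (l i + y)) (g' y)) {s : ℂ} (h0 : 0 < s.re)
    (h1 : s.re < 1) (hint : IntegrableOn (fun y : ℝ => y ^ (-s.re) * g' y) (Ioi 0)) :
    HasSum (fun i => (l i : ℂ) ^ (-s))
      (Complex.sin (Real.pi * s) / Real.pi * ∫ y in Ioi (0 : ℝ), (y : ℂ) ^ (-s) * (g' y : ℂ)) := by
  have hS := summable_rpow_neg_of_integrableOn hl hsum h0 h1 hint
  have hcount : Countable ι := by
    have := hS.countable_support
    rw [show (Function.support fun i => l i ^ (-s.re)) = univ from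
      eq_univ_of_forall fun i => (Real.rpow_pos_of_pos (hl i) _).ne'] at this
    exact countable_univ_iff.1 this
  have hsin := sin_pi_mul_ne_zero h0 h1
  have hpi : (Real.pi : ℂ) ≠ 0 := by exact_mod_cast Real.pi_ne_zero
  have key := hasSum_integral_of_summable_integral_norm (μ := volume.restrict (Ioi (0 : ℝ)))
    (F := fun i (y : ℝ) => (y : ℂ) ^ (-s) * (1 / (l i + y) : ℝ))
    (fun i => (integrableOn_and_integral_cpow_div_add (hl i) h0 h1).1) (by
      refine (hS.mul_right (Real.pi / Real.sin (Real.pi * s.re))).congr fun i => ?_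
      rw [← (integral_rpow_div_add (hl i) h0 h1).2]
      refine setIntegral_congr_fun measurableSet_Ioi fun y hy => ?_
      rw [norm_mul, Complex.norm_cpow_eq_rpow_re_of_pos hy, norm_real, neg_re,
        Real.norm_of_nonneg (one_div_nonneg.2 (add_pos (hl i) hy).le)])
  simp only [(integrableOn_and_integral_cpow_div_add (hl _) h0 h1).2] at key
  have h2 : ∫ y in Ioi (0 : ℝ), ∑' i, (y : ℂ) ^ (-s) * (1 / (l i + y) : ℝ)
      = ∫ y in Ioi (0 : ℝ), (y : ℂ) ^ (-s) * (g' y : ℂ) := by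
    refine setIntegral_congr_fun measurableSet_Ioi fun y hy => ?_
    rw [tsum_mul_left, ← Complex.ofReal_tsum, (hsum y hy).tsum_eq]
  rw [h2] at key
  have h3 := key.mul_left (Complex.sin (Real.pi * s) / Real.pi)
  refine h3.congr_fun fun i => ?_
  rw [mul_left_comm, div_mul_div_cancel₀ hpi, div_self hsin, mul_one]

lemma differentiableAt_tsum_cpow_neg {ι : Type*} {l : ι → ℝ} (hl : ∀ i, 0 < l i) {σ : ℝ}
    (hS : Summable fun i => l i ^ (-σ)) (hinv : BddAbove (range fun i => (l i)⁻¹)) {s : ℂ}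
    (hs : σ < s.re) :
    (Summable fun i => (l i : ℂ) ^ (-s)) ∧
      DifferentiableAt ℂ (fun s : ℂ => ∑' i, (l i : ℂ) ^ (-s)) s := by
  obtain ⟨K, hK⟩ := hinv
  have hK' : ∀ i, (l i)⁻¹ ≤ K := fun i => hK ⟨i, rfl⟩
  set U : Set ℂ := {z | σ < z.re ∧ z.re < s.re + 1} with hU
  have hUo : IsOpen U :=
    (isOpen_lt continuous_const Complex.continuous_re).inter
      (isOpen_lt Complex.continuous_re continuous_const)
  have hb : ∀ i, ∀ z ∈ U,
      ‖(l i : ℂ) ^ (-z)‖ ≤ (max K 1) ^ (s.re + 1 - σ) * l i ^ (-σ) := by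
    intro i z hz
    rw [Complex.norm_cpow_eq_rpow_re_of_pos (hl i), neg_re,
      show -z.re = (-(z.re - σ)) + (-σ) by ring, Real.rpow_add (hl i)]
    refine mul_le_mul_of_nonneg_right ?_ (Real.rpow_nonneg (hl i).le _)
    rw [Real.rpow_neg (hl i).le, ← Real.inv_rpow (hl i).le]
    calc ((l i)⁻¹) ^ (z.re - σ) ≤ (max K 1) ^ (z.re - σ) :=
          Real.rpow_le_rpow (inv_nonneg.2 (hl i).le) ((hK' i).trans (le_max_left _ _))
            (by linarith [hz.1])
      _ ≤ _ := Real.rpow_le_rpow_of_exponent_le (le_max_right _ _) (by linarith [hz.2])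
  have hsU : s ∈ U := ⟨hs, by linarith⟩
  have hd : ∀ i, DifferentiableOn ℂ (fun z : ℂ => (l i : ℂ) ^ (-z)) U := by
    intro i
    have : (l i : ℂ) ≠ 0 := by exact_mod_cast (hl i).ne'
    exact (Differentiable.const_cpow (by fun_prop) (Or.inl this)).differentiableOn
  have := differentiableOn_tsum_of_summable_norm (hS.mul_left _) hd hUo hb
  exact ⟨(Summable.of_norm_bounded (hS.mul_left _) fun i => hb i s hsU),
    this.differentiableAt (hUo.mem_nhds hsU)⟩

/-! ### Removing the large-parameter expansion from a Mellin transform -/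

/-- The power function `y ^ e` cut off to `y > 1`. -/
noncomputable def powTail (e : ℂ) : ℝ → ℂ :=
  (Ioi (1 : ℝ)).indicator fun y => (y : ℂ) ^ e

lemma hasMellin_powTail {e s : ℂ} (h : e.re < s.re) : HasMellin (powTail e) (-s) (1 / (s - e)) := by
  have hre : (-s - 1 + e).re < -1 := by
    simp only [sub_re, add_re, neg_re, one_re]
    linarith
  have hcong : ∀ y : ℝ, (y : ℂ) ^ (-s - 1) • powTail e y
      = (Ioi (1 : ℝ)).indicator (fun y => (y : ℂ) ^ (-s - 1 + e)) y := by
    intro y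
    by_cases hy : y ∈ Ioi (1 : ℝ)
    · have hy0 : (y : ℂ) ≠ 0 := by exact_mod_cast (zero_lt_one.trans hy).ne'
      simp only [powTail, indicator_of_mem hy, smul_eq_mul, Complex.cpow_add _ _ hy0]
    · simp only [powTail, indicator_of_notMem hy, smul_zero]
  have hsub : Ioi (1 : ℝ) ∩ Ioi 0 = Ioi 1 :=
    inter_eq_left.2 (Ioi_subset_Ioi zero_le_one)
  constructor
  · rw [MellinConvergent]
    simp only [hcong]
    rw [IntegrableOn, integrable_indicator_iff measurableSet_Ioi, IntegrableOn,
      Measure.restrict_restrict measurableSet_Ioi, hsub]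
    exact integrableOn_Ioi_cpow_of_lt hre zero_lt_one
  · rw [mellin]
    simp only [hcong]
    rw [integral_indicator measurableSet_Ioi, Measure.restrict_restrict measurableSet_Ioi, hsub,
      integral_Ioi_cpow_of_lt hre zero_lt_one, Complex.ofReal_one, Complex.one_cpow]
    have h1 : s - e ≠ 0 := by
      intro h2
      have := congrArg Complex.re h2
      simp only [sub_re, zero_re] at this
      linarith
    have h2 : -s - 1 + e + 1 = -(s - e) := by ring
    rw [h2, neg_div_neg_eq]

lemma locallyIntegrableOn_powTail (e : ℂ) : LocallyIntegrableOn (powTail e) (Ioi 0) := by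
  have hc : ContinuousOn (fun y : ℝ => (y : ℂ) ^ e) (Ioi 0) := fun y hy =>
    (continuousAt_ofReal_cpow_const y _ (Or.inr (ne_of_gt hy))).continuousWithinAt
  intro y hy
  obtain ⟨U, hU, hi⟩ := hc.locallyIntegrableOn (μ := volume) measurableSet_Ioi y hy
  exact ⟨U, hU, hi.indicator measurableSet_Ioi⟩

/-- The terms `L √y + c + B / √y` of a large-`y` expansion, cut off to `y > 1`. -/
noncomputable def asympTail (L c B : ℝ) (y : ℝ) : ℂ :=
  (L : ℂ) * powTail (1 / 2) y + (c : ℂ) * powTail 0 y + (B : ℂ) * powTail (-1 / 2) y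

lemma hasMellin_asympTail (L c B : ℝ) {s : ℂ} (h : 1 / 2 < s.re) :
    HasMellin (asympTail L c B) (-s) (L / (s - 1 / 2) + c / s + B / (s + 1 / 2)) := by
  have h1 := hasMellin_powTail (e := 1 / 2) (s := s) (by norm_num; linarith)
  have h2 := hasMellin_powTail (e := 0) (s := s) (by simp; linarith)
  have h3 := hasMellin_powTail (e := -1 / 2) (s := s) (by norm_num; linarith)
  have e1 := hasMellin_add (h1.1.const_smul (L : ℂ)) (h2.1.const_smul (c : ℂ))
  have e2 := hasMellin_add e1.1 (h3.1.const_smul (B : ℂ))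
  rw [e1.2, mellin_const_smul, mellin_const_smul, mellin_const_smul, h1.2, h2.2, h3.2] at e2
  have e3 : (L : ℂ) / (s - 1 / 2) + c / s + B / (s + 1 / 2)
      = (L : ℂ) • (1 / (s - 1 / 2)) + (c : ℂ) • (1 / (s - 0)) + (B : ℂ) • (1 / (s - -1 / 2)) := by
    simp only [smul_eq_mul, sub_zero]
    rw [show s - -1 / 2 = s + 1 / 2 by ring]
    ring
  rw [e3]
  exact e2

lemma asympTail_of_one_lt (L c B : ℝ) {y : ℝ} (hy : 1 < y) :
    asympTail L c B y = ((L * √y + c + B / √y : ℝ) : ℂ) := by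
  have hy0 : (0 : ℝ) ≤ y := by linarith
  have e1 : ((√y : ℝ) : ℂ) = (y : ℂ) ^ (1 / 2 : ℂ) := by
    rw [Real.sqrt_eq_rpow, Complex.ofReal_cpow hy0]
    norm_num
  have e2 : (((√y)⁻¹ : ℝ) : ℂ) = (y : ℂ) ^ (-1 / 2 : ℂ) := by
    rw [Real.sqrt_eq_rpow, ← Real.rpow_neg hy0, Complex.ofReal_cpow hy0]
    norm_num
  have hm : y ∈ Ioi (1 : ℝ) := hy
  simp only [asympTail, powTail, indicator_of_mem hm, div_eq_mul_inv, Complex.cpow_zero]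
  rw [Complex.ofReal_add, Complex.ofReal_add, Complex.ofReal_mul, Complex.ofReal_mul, e1, e2]
  simp [div_eq_mul_inv]

lemma asympTail_of_le_one (L c B : ℝ) {y : ℝ} (hy : y ≤ 1) : asympTail L c B y = 0 := by
  have hm : y ∉ Ioi (1 : ℝ) := not_lt.2 hy
  simp [asympTail, powTail, indicator_of_notMem hm]

lemma locallyIntegrableOn_asympTail (L c B : ℝ) :
    LocallyIntegrableOn (asympTail L c B) (Ioi 0) := by
  have h : ∀ (m e : ℂ), LocallyIntegrableOn (fun y => m * powTail e y) (Ioi 0) := fun m e =>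
    (locallyIntegrableOn_powTail e).smul m
  exact ((h _ _).add (h _ _)).add (h _ _)

/-- What remains of `g`, a function with large-`y` expansion `L √y - (log y) / 2 + c + B / √y`,
after removing the expansion. The logarithm is removed as `log (1 + y) / 2`, whose Mellin
transform is known exactly and which is regular at `0`. -/
noncomputable def zetaRemainder (L c B : ℝ) (g : ℝ → ℝ) (y : ℝ) : ℂ :=
  ((g y + Real.log (1 + y) / 2 : ℝ) : ℂ) - asympTail L c B y

/-- The continuation to `-1 < Re s < 1` of `(sin πs / π) ∫₀^∞ y^{-s} g'(y) dy`. -/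
noncomputable def zetaFormula (L c B : ℝ) (g : ℝ → ℝ) (s : ℂ) : ℂ :=
  -1 / 2 + Complex.sin (Real.pi * s) / Real.pi *
    (s * L / (s - 1 / 2) + c + s * B / (s + 1 / 2) + s * mellin (zetaRemainder L c B g) (-s))

section

variable {L c B : ℝ} {g g' : ℝ → ℝ}

lemma hasDerivAt_add_log (hg : ∀ y ∈ Ici (0 : ℝ), HasDerivAt g (g' y) y) :
    ∀ y ∈ Ici (0 : ℝ),
      HasDerivAt (fun y => g y + Real.log (1 + y) / 2) (g' y + 1 / (1 + y) / 2) y := by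
  intro y hy
  have hy' : (0 : ℝ) ≤ y := hy
  exact (hg y hy).add ((((hasDerivAt_id y).const_add 1).log (by simp; linarith)).div_const 2)

lemma isBigO_zero_add_log (hg : ∀ y ∈ Ici (0 : ℝ), HasDerivAt g (g' y) y) (hg0 : g 0 = 0) :
    (fun y => g y + Real.log (1 + y) / 2) =O[𝓝[>] 0] fun y => y := by
  have := (hasDerivAt_add_log hg 0 self_mem_Ici).differentiableAt.isBigO_sub
  simp only [hg0, add_zero, Real.log_one, zero_div, sub_zero] at this
  exact this.mono nhdsWithin_le_nhds

lemma isBigO_one_sqrt :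
    (fun _ : ℝ => (1 : ℝ)) =O[atTop] (fun y : ℝ => √y) := by
  refine Asymptotics.IsBigO.of_bound 1 ?_
  filter_upwards [eventually_ge_atTop 1] with y hy
  rw [norm_one, one_mul, Real.norm_of_nonneg (Real.sqrt_nonneg _)]
  exact Real.one_le_sqrt.2 hy

lemma isBigO_inv_sqrt : (fun y : ℝ => y⁻¹) =O[atTop] (fun y : ℝ => √y) := by
  refine Asymptotics.IsBigO.trans ?_ isBigO_one_sqrt
  refine Asymptotics.IsBigO.of_bound 1 ?_
  filter_upwards [eventually_ge_atTop 1] with y hy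
  rw [Real.norm_of_nonneg (by positivity)]
  simpa using inv_le_one_of_one_le₀ hy

lemma isBigO_atTop_add_log_sub
    (hasym : (fun y => g y - (L * √y - Real.log y / 2 + c + B / √y)) =O[atTop] fun y => y⁻¹) :
    (fun y => g y + Real.log (1 + y) / 2 - (L * √y + c + B / √y)) =O[atTop] fun y => y⁻¹ := by
  have h1 : (fun y : ℝ => (Real.log (1 + y) - Real.log y) / 2) =O[atTop] fun y => y⁻¹ := by
    refine Asymptotics.IsBigO.of_bound 1 ?_
    filter_upwards [eventually_gt_atTop 0] with y hy
    have e1 : Real.log (1 + y) - Real.log y = Real.log (1 + y⁻¹) := by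
      rw [← Real.log_div (by positivity) hy.ne']
      congr 1
      field_simp
      ring
    have e2 : 0 ≤ Real.log (1 + y⁻¹) := Real.log_nonneg (by simp [hy.le])
    have e3 : Real.log (1 + y⁻¹) ≤ y⁻¹ := by
      have := Real.log_le_sub_one_of_pos (x := 1 + y⁻¹) (by positivity)
      linarith
    rw [e1, Real.norm_of_nonneg (by positivity), Real.norm_of_nonneg (by positivity)]
    linarith
  refine (hasym.add h1).congr_left fun y => ?_
  ring

lemma isBigO_atTop_add_log
    (hasym : (fun y => g y - (L * √y - Real.log y / 2 + c + B / √y)) =O[atTop] fun y => y⁻¹) :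
    (fun y => g y + Real.log (1 + y) / 2) =O[atTop] fun y => √y := by
  have h1 := (isBigO_atTop_add_log_sub hasym).trans isBigO_inv_sqrt
  have h2 : (fun y : ℝ => L * √y) =O[atTop] fun y : ℝ => √y :=
    (Asymptotics.isBigO_refl _ _).const_mul_left L
  have h3 : (fun _ : ℝ => c) =O[atTop] fun y : ℝ => √y :=
    (Asymptotics.isBigO_const_const c one_ne_zero _).trans isBigO_one_sqrt
  have h4 : (fun y : ℝ => B / √y) =O[atTop] fun y : ℝ => √y := by
    refine Asymptotics.IsBigO.trans ?_ isBigO_one_sqrt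
    refine Asymptotics.IsBigO.of_bound |B| ?_
    filter_upwards [eventually_ge_atTop 1] with y hy
    rw [norm_div, norm_one, mul_one, Real.norm_eq_abs]
    exact div_le_self (abs_nonneg _)
      ((Real.one_le_sqrt.2 hy).trans (le_abs_self _))
  refine (h1.add ((h2.add h3).add h4)).congr_left fun y => ?_
  ring

/-- The remainder is `O (y)` at `0` and `O (1 / y)` at infinity, so its Mellin transform at `-s` is
holomorphic in the strip `-1 < Re s < 1`. -/
lemma differentiableAt_mellin_zetaRemainder (hg : ∀ y ∈ Ici (0 : ℝ), HasDerivAt g (g' y) y)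
    (hg0 : g 0 = 0)
    (hasym : (fun y => g y - (L * √y - Real.log y / 2 + c + B / √y)) =O[atTop] fun y => y⁻¹)
    {s : ℂ} (h1 : -1 < s.re) (h2 : s.re < 1) :
    DifferentiableAt ℂ (fun s => mellin (zetaRemainder L c B g) (-s)) s := by
  have hk := hasDerivAt_add_log hg
  have hmain : DifferentiableAt ℂ (mellin (zetaRemainder L c B g)) (-s) := by
    refine mellin_differentiableAt_of_isBigO_rpow (a := 1) (b := -1) ?_ ?_
      (by simp only [neg_re]; linarith) ?_ (by simp only [neg_re]; linarith)
    · exact (locallyIntegrableOn_ofReal_of_hasDerivAt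
        (fun y hy => hk y (Ioi_subset_Ici_self hy))).sub (locallyIntegrableOn_asympTail L c B)
    · refine Asymptotics.IsBigO.trans (g := fun y : ℝ => y⁻¹) ?_ ?_
      · refine Asymptotics.IsBigO.congr' (Asymptotics.IsBigO.norm_left
          (isBigO_atTop_add_log_sub hasym)).norm_left ?_ EventuallyEq.rfl |>.of_norm_left
        filter_upwards [eventually_gt_atTop 1] with y hy
        rw [zetaRemainder, asympTail_of_one_lt L c B hy, ← Complex.ofReal_sub, norm_norm, norm_real]
      · simp only [Real.rpow_neg_one]
        exact Asymptotics.isBigO_refl _ _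
    · simp only [neg_neg, Real.rpow_one]
      refine Asymptotics.IsBigO.congr' (isBigO_zero_add_log hg hg0).norm_left ?_
        EventuallyEq.rfl |>.of_norm_left
      filter_upwards [nhdsWithin_le_nhds (eventually_le_nhds (zero_lt_one' ℝ))] with y hy
      rw [zetaRemainder, asympTail_of_le_one L c B hy, sub_zero, norm_real]
  exact hmain.comp s differentiableAt_id.neg

lemma zetaFormula_eq_integral (hg : ∀ y ∈ Ici (0 : ℝ), HasDerivAt g (g' y) y)
    (hg0 : g 0 = 0)
    (hasym : (fun y => g y - (L * √y - Real.log y / 2 + c + B / √y)) =O[atTop] fun y => y⁻¹)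
    {s : ℂ} (h1 : 1 / 2 < s.re) (h2 : s.re < 1)
    (hint : IntegrableOn (fun y : ℝ => (y : ℂ) ^ (-s) * (g' y : ℂ)) (Ioi 0)) :
    zetaFormula L c B g s
      = Complex.sin (Real.pi * s) / Real.pi * ∫ y in Ioi (0 : ℝ), (y : ℂ) ^ (-s) * (g' y : ℂ) := by
  have hk : ∀ y ∈ Ioi (0 : ℝ), HasDerivAt (fun y => g y + Real.log (1 + y) / 2)
      (g' y + 1 / (1 + y) / 2) y := fun y hy => hasDerivAt_add_log hg y (Ioi_subset_Ici_self hy)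
  have hk0 := isBigO_zero_add_log hg hg0
  have hkt := isBigO_atTop_add_log hasym
  have hbeta := integrableOn_and_integral_cpow_div_add zero_lt_one (s := s) (by linarith) h2
  have hcong : ∀ y : ℝ, (y : ℂ) ^ (-s) * ((g' y + 1 / (1 + y) / 2 : ℝ) : ℂ)
      = (y : ℂ) ^ (-s) * (g' y : ℂ) + (1 / 2) * ((y : ℂ) ^ (-s) * (1 / (1 + y) : ℝ)) := by
    intro y
    push_cast
    ring
  have hparts := integral_cpow_mul_deriv_eq_mellin hk hk0 hkt h1 h2 (by
    simp only [hcong]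
    exact hint.add (hbeta.1.const_mul _))
  simp only [hcong] at hparts
  rw [integral_add hint (hbeta.1.const_mul _), integral_const_mul, hbeta.2, Complex.ofReal_one,
    Complex.one_cpow, one_mul] at hparts
  have htail := hasMellin_asympTail L c B h1
  have hrem := hasMellin_sub (mellinConvergent_neg hk hk0 hkt h1 h2) htail.1
  rw [htail.2] at hrem
  have hrem2 : mellin (zetaRemainder L c B g) (-s)
      = mellin (fun y => ((g y + Real.log (1 + y) / 2 : ℝ) : ℂ)) (-s)
        - (L / (s - 1 / 2) + c / s + B / (s + 1 / 2)) := hrem.2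
  have hs : s ≠ 0 := by
    rintro rfl
    simp at h1
    linarith
  have hsin := sin_pi_mul_ne_zero (s := s) (by linarith) h2
  have hpi : (Real.pi : ℂ) ≠ 0 := by exact_mod_cast Real.pi_ne_zero
  rw [zetaFormula, hrem2]
  have e1 : s * L / (s - 1 / 2) + c + s * B / (s + 1 / 2) +
      s * (mellin (fun y => ((g y + Real.log (1 + y) / 2 : ℝ) : ℂ)) (-s)
        - (L / (s - 1 / 2) + c / s + B / (s + 1 / 2)))
      = s * mellin (fun y => ((g y + Real.log (1 + y) / 2 : ℝ) : ℂ)) (-s) := by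
    have : s * (c / s) = c := mul_div_cancel₀ _ hs
    linear_combination -this
  rw [e1, ← hparts, mul_add]
  have e2 : Complex.sin (Real.pi * s) / Real.pi * (1 / 2 * (Real.pi / Complex.sin (Real.pi * s)))
      = 1 / 2 := by
    field_simp
  rw [e2]
  ring

end

/-! ### The continued zeta function -/

section

variable {L c B : ℝ} {g g' : ℝ → ℝ}

lemma zetaFormula_zero : zetaFormula L c B g 0 = -1 / 2 := by
  simp [zetaFormula]

lemma sub_half_ne_zero {s : ℂ} (h : s ≠ 1 / 2) : s - 1 / 2 ≠ 0 := sub_ne_zero.2 h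

lemma add_half_ne_zero {s : ℂ} (h : s ≠ -1 / 2) : s + 1 / 2 ≠ 0 := by
  intro h'
  exact h (by linear_combination h')

lemma differentiableAt_zetaFormula (hg : ∀ y ∈ Ici (0 : ℝ), HasDerivAt g (g' y) y)
    (hg0 : g 0 = 0)
    (hasym : (fun y => g y - (L * √y - Real.log y / 2 + c + B / √y)) =O[atTop] fun y => y⁻¹)
    {s : ℂ} (h1 : -1 < s.re) (h2 : s.re < 1) (h3 : s ≠ 1 / 2) (h4 : s ≠ -1 / 2) :
    DifferentiableAt ℂ (zetaFormula L c B g) s := by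
  have hH := differentiableAt_mellin_zetaRemainder hg hg0 hasym h1 h2
  have e3 := sub_half_ne_zero h3
  have e4 := add_half_ne_zero h4
  unfold zetaFormula
  fun_prop (disch := assumption)

lemma meromorphicAt_zetaFormula (hg : ∀ y ∈ Ici (0 : ℝ), HasDerivAt g (g' y) y)
    (hg0 : g 0 = 0)
    (hasym : (fun y => g y - (L * √y - Real.log y / 2 + c + B / √y)) =O[atTop] fun y => y⁻¹)
    {s : ℂ} (h1 : -1 < s.re) (h2 : s.re < 1) : MeromorphicAt (zetaFormula L c B g) s := by
  have hH : MeromorphicAt (fun s => mellin (zetaRemainder L c B g) (-s)) s := by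
    refine AnalyticAt.meromorphicAt ?_
    refine DifferentiableOn.analyticAt (s := {s : ℂ | -1 < s.re} ∩ {s : ℂ | s.re < 1})
      (fun z hz => (differentiableAt_mellin_zetaRemainder hg hg0 hasym hz.1
        hz.2).differentiableWithinAt) (IsOpen.mem_nhds ?_ ⟨h1, h2⟩)
    exact (isOpen_lt continuous_const Complex.continuous_re).inter
      (isOpen_lt Complex.continuous_re continuous_const)
  have hsin : MeromorphicAt (fun s : ℂ => Complex.sin (Real.pi * s)) s :=
    AnalyticAt.meromorphicAt (Differentiable.analyticAt (by fun_prop) s)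
  unfold zetaFormula
  fun_prop

lemma hasDerivAt_zetaFormula_zero (hg : ∀ y ∈ Ici (0 : ℝ), HasDerivAt g (g' y) y)
    (hg0 : g 0 = 0)
    (hasym : (fun y => g y - (L * √y - Real.log y / 2 + c + B / √y)) =O[atTop] fun y => y⁻¹) :
    HasDerivAt (zetaFormula L c B g) (c : ℂ) 0 := by
  have hH := differentiableAt_mellin_zetaRemainder hg hg0 hasym (s := 0) (by simp) (by simp)
  have hE : DifferentiableAt ℂ (fun s : ℂ => s * L / (s - 1 / 2) + c + s * B / (s + 1 / 2)
      + s * mellin (zetaRemainder L c B g) (-s)) 0 := by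
    have e3 : (0 : ℂ) - 1 / 2 ≠ 0 := by norm_num
    have e4 : (0 : ℂ) + 1 / 2 ≠ 0 := by norm_num
    fun_prop (disch := assumption)
  have hpi : (Real.pi : ℂ) ≠ 0 := by exact_mod_cast Real.pi_ne_zero
  have hS : HasDerivAt (fun s : ℂ => Complex.sin (Real.pi * s) / Real.pi) 1 0 := by
    have h1 : HasDerivAt (fun s : ℂ => (Real.pi : ℂ) * s) (Real.pi : ℂ) 0 := by
      simpa using (hasDerivAt_id (0 : ℂ)).const_mul (Real.pi : ℂ)
    have := (h1.csin).div_const (Real.pi : ℂ)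
    simpa [hpi] using this
  have := (hS.mul hE.hasDerivAt).const_add (-1 / 2)
  refine HasDerivAt.congr_deriv this ?_
  simp

lemma tendsto_sub_half_mul_zetaFormula (hg : ∀ y ∈ Ici (0 : ℝ), HasDerivAt g (g' y) y)
    (hg0 : g 0 = 0)
    (hasym : (fun y => g y - (L * √y - Real.log y / 2 + c + B / √y)) =O[atTop] fun y => y⁻¹) :
    Tendsto (fun s : ℂ => (s - 1 / 2) * zetaFormula L c B g s) (𝓝[≠] (1 / 2))
      (𝓝 ((1 / (2 * Real.pi) * L : ℝ) : ℂ)) := by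
  have hH := (differentiableAt_mellin_zetaRemainder hg hg0 hasym (s := 1 / 2) (by norm_num)
    (by norm_num)).continuousAt
  have e4 : (1 / 2 : ℂ) + 1 / 2 ≠ 0 := by norm_num
  have hpi : (Real.pi : ℂ) ≠ 0 := by exact_mod_cast Real.pi_ne_zero
  set E : ℂ → ℂ := fun s => (s - 1 / 2) * (-1 / 2) + Complex.sin (Real.pi * s) / Real.pi *
    (s * L + (s - 1 / 2) * (c + s * B / (s + 1 / 2) + s * mellin (zetaRemainder L c B g) (-s)))
    with hEdef
  have hE : ContinuousAt E (1 / 2) := by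
    rw [hEdef]
    fun_prop (disch := assumption)
  have hval : E (1 / 2) = ((1 / (2 * Real.pi) * L : ℝ) : ℂ) := by
    have : Complex.sin (Real.pi * (1 / 2)) = 1 := by
      rw [mul_one_div, Complex.sin_pi_div_two]
    simp only [hEdef, this, sub_self, zero_mul, zero_add, add_zero]
    push_cast
    field_simp
  rw [← hval]
  refine (hE.tendsto.mono_left nhdsWithin_le_nhds).congr' ?_
  filter_upwards [self_mem_nhdsWithin] with s hs
  have e3 := sub_half_ne_zero hs
  simp only [hEdef, zetaFormula]
  have : s * L / (s - 1 / 2) * (s - 1 / 2) = s * L := div_mul_cancel₀ _ e3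
  linear_combination -(Complex.sin (Real.pi * s) / Real.pi) * this

lemma tendsto_add_half_mul_zetaFormula (hg : ∀ y ∈ Ici (0 : ℝ), HasDerivAt g (g' y) y)
    (hg0 : g 0 = 0)
    (hasym : (fun y => g y - (L * √y - Real.log y / 2 + c + B / √y)) =O[atTop] fun y => y⁻¹) :
    Tendsto (fun s : ℂ => (s + 1 / 2) * zetaFormula L c B g s) (𝓝[≠] (-1 / 2))
      (𝓝 ((1 / (2 * Real.pi) * B : ℝ) : ℂ)) := by
  have hH := (differentiableAt_mellin_zetaRemainder hg hg0 hasym (s := -1 / 2) (by norm_num)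
    (by norm_num)).continuousAt
  have e3 : (-1 / 2 : ℂ) - 1 / 2 ≠ 0 := by norm_num
  have hpi : (Real.pi : ℂ) ≠ 0 := by exact_mod_cast Real.pi_ne_zero
  set E : ℂ → ℂ := fun s => (s + 1 / 2) * (-1 / 2) + Complex.sin (Real.pi * s) / Real.pi *
    (s * B + (s + 1 / 2) * (s * L / (s - 1 / 2) + c + s * mellin (zetaRemainder L c B g) (-s)))
    with hEdef
  have hE : ContinuousAt E (-1 / 2) := by
    rw [hEdef]
    fun_prop (disch := assumption)
  have hval : E (-1 / 2) = ((1 / (2 * Real.pi) * B : ℝ) : ℂ) := by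
    have h1 : Complex.sin (Real.pi * (-1 / 2)) = -1 := by
      rw [show (Real.pi : ℂ) * (-1 / 2) = -(Real.pi / 2) by ring, Complex.sin_neg,
        Complex.sin_pi_div_two]
    have h2 : (-1 / 2 : ℂ) + 1 / 2 = 0 := by norm_num
    simp only [hEdef, h1, h2, zero_mul, zero_add, add_zero]
    push_cast
    field_simp
  rw [← hval]
  refine (hE.tendsto.mono_left nhdsWithin_le_nhds).congr' ?_
  filter_upwards [self_mem_nhdsWithin] with s hs
  have e4 := add_half_ne_zero hs
  simp only [hEdef, zetaFormula]
  have : s * B / (s + 1 / 2) * (s + 1 / 2) = s * B := div_mul_cancel₀ _ e4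
  linear_combination -(Complex.sin (Real.pi * s) / Real.pi) * this

/-- The zeta function of positive numbers `l i` whose resolvent trace `∑ 1 / (l i + y)` is the
derivative of a function `g` with `g 0 = 0` and
`g y = L √y - (log y) / 2 + c + B / √y + O(1 / y)` as `y → ∞`. -/
theorem exists_meromorphic_zeta {ι : Type*} {l : ι → ℝ} (hl : ∀ i, 0 < l i)
    (hg : ∀ y ∈ Ici (0 : ℝ), HasDerivAt g (g' y) y) (hg0 : g 0 = 0)
    (hsum : ∀ y ∈ Ici (0 : ℝ), HasSum (fun i => 1 / (l i + y)) (g' y))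
    (hasym : (fun y => g y - (L * √y - Real.log y / 2 + c + B / √y)) =O[atTop] fun y => y⁻¹) :
    ∃ Z : ℂ → ℂ, MeromorphicOn Z {s : ℂ | -1 < s.re} ∧
      DifferentiableOn ℂ Z ({s : ℂ | -1 < s.re} \ {1 / 2, -1 / 2}) ∧
      (∀ s : ℂ, 1 / 2 < s.re → HasSum (fun i => (l i : ℂ) ^ (-s)) (Z s)) ∧
      (∀ s : ℂ, 1 / 2 < s.re → s.re < 1 →
        IntegrableOn (fun y : ℝ => (y : ℂ) ^ (-s) * (g' y : ℂ)) (Ioi 0)) ∧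
      (∀ s : ℂ, 1 / 2 < s.re → s.re < 1 → Z s = Complex.sin (Real.pi * s) / Real.pi *
        ∫ y in Ioi (0 : ℝ), (y : ℂ) ^ (-s) * (g' y : ℂ)) ∧
      HasDerivAt Z (c : ℂ) 0 ∧ Z 0 = -1 / 2 ∧
      Tendsto (fun s : ℂ => (s - 1 / 2) * Z s) (𝓝[≠] (1 / 2))
        (𝓝 ((1 / (2 * Real.pi) * L : ℝ) : ℂ)) ∧
      Tendsto (fun s : ℂ => (s + 1 / 2) * Z s) (𝓝[≠] (-1 / 2))
        (𝓝 ((1 / (2 * Real.pi) * B : ℝ) : ℂ)) := by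
  have hg1 : ∀ y ∈ Ioi (0 : ℝ), HasDerivAt g (g' y) y := fun y hy => hg y (Ioi_subset_Ici_self hy)
  have hsum1 : ∀ y ∈ Ioi (0 : ℝ), HasSum (fun i => 1 / (l i + y)) (g' y) :=
    fun y hy => hsum y (Ioi_subset_Ici_self hy)
  have hgO0 : g =O[𝓝[>] 0] fun y => y := by
    have := (hg 0 self_mem_Ici).differentiableAt.isBigO_sub
    simp only [hg0, sub_zero] at this
    exact this.mono nhdsWithin_le_nhds
  have hgOt : g =O[atTop] fun y => √y := by
    have h1 : (fun y : ℝ => Real.log (1 + y) / 2) =O[atTop] fun y : ℝ => √y := by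
      refine Asymptotics.IsBigO.of_bound 1 ?_
      filter_upwards [eventually_ge_atTop 1] with y hy
      have e1 : 1 ≤ √y := Real.one_le_sqrt.2 hy
      have e2 : 0 ≤ Real.log (1 + y) := Real.log_nonneg (by linarith)
      have e3 : Real.log (1 + y) ≤ 2 * √y := by
        have e4 : 1 + y ≤ (1 + √y) ^ 2 := by
          nlinarith [Real.sq_sqrt (show (0 : ℝ) ≤ y by linarith)]
        have e5 := Real.log_le_log (by linarith) e4
        rw [Real.log_pow] at e5
        have e6 := Real.log_le_sub_one_of_pos (x := 1 + √y) (by positivity)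
        push_cast at e5
        linarith
      rw [Real.norm_of_nonneg (by positivity), Real.norm_of_nonneg (by positivity)]
      linarith
    refine ((isBigO_atTop_add_log hasym).sub h1).congr_left fun y => ?_
    ring
  have hg'pos : ∀ y ∈ Ioi (0 : ℝ), 0 ≤ g' y := fun y hy =>
    (hsum1 y hy).nonneg fun i => one_div_nonneg.2 (add_pos (hl i) hy).le
  have hintR : ∀ σ : ℝ, 1 / 2 < σ → σ < 1 → IntegrableOn (fun y : ℝ => y ^ (-σ) * g' y) (Ioi 0) :=
    fun σ h1 h2 => integrableOn_rpow_mul_deriv hg1 hgO0 hgOt hg0 hg'pos h1 h2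
  have hintC : ∀ s : ℂ, 1 / 2 < s.re → s.re < 1 →
      IntegrableOn (fun y : ℝ => (y : ℂ) ^ (-s) * (g' y : ℂ)) (Ioi 0) :=
    fun s h1 h2 => integrableOn_cpow_mul (hintR s.re h1 h2)
  have hform : ∀ s : ℂ, 1 / 2 < s.re → s.re < 1 →
      HasSum (fun i => (l i : ℂ) ^ (-s)) (zetaFormula L c B g s) := by
    intro s h1 h2
    rw [zetaFormula_eq_integral hg hg0 hasym h1 h2 (hintC s h1 h2)]
    exact hasSum_cpow_neg hl hsum1 (by linarith) h2 (hintR s.re h1 h2)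
  have hbdd : BddAbove (range fun i => (l i)⁻¹) := by
    refine ⟨g' 0, ?_⟩
    rintro _ ⟨i, rfl⟩
    have := le_hasSum (hsum 0 self_mem_Ici) i fun j _ => one_div_nonneg.2 (by simpa using (hl j).le)
    simpa using this
  have htsum : ∀ s : ℂ, 3 / 4 < s.re → (Summable fun i => (l i : ℂ) ^ (-s)) ∧
      DifferentiableAt ℂ (fun s : ℂ => ∑' i, (l i : ℂ) ^ (-s)) s := fun s hs =>
    differentiableAt_tsum_cpow_neg hl (summable_rpow_neg_of_integrableOn hl hsum1 (by norm_num)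
      (by norm_num) (hintR (3 / 4) (by norm_num) (by norm_num))) hbdd hs
  classical
  set Z : ℂ → ℂ := fun s => if s.re < 1 then zetaFormula L c B g s else ∑' i, (l i : ℂ) ^ (-s)
    with hZ
  have hZlt : ∀ {s : ℂ}, s.re < 1 → Z s = zetaFormula L c B g s := fun h => if_pos h
  have hZsum : ∀ s : ℂ, 1 / 2 < s.re → HasSum (fun i => (l i : ℂ) ^ (-s)) (Z s) := by
    intro s h1
    by_cases h2 : s.re < 1
    · rw [hZlt h2]
      exact hform s h1 h2
    · rw [show Z s = ∑' i, (l i : ℂ) ^ (-s) from if_neg h2]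
      exact (htsum s (by linarith)).1.hasSum
  have hZeq1 : ∀ {s : ℂ}, s.re < 1 → Z =ᶠ[𝓝 s] zetaFormula L c B g := fun {s} h => by
    filter_upwards [(isOpen_lt Complex.continuous_re continuous_const).mem_nhds h] with z hz
    exact hZlt hz
  have hZeq2 : ∀ {s : ℂ}, 1 ≤ s.re → Z =ᶠ[𝓝 s] fun s => ∑' i, (l i : ℂ) ^ (-s) := fun {s} h => by
    filter_upwards [(isOpen_lt continuous_const Complex.continuous_re).mem_nhds
      (show 1 / 2 < s.re by linarith)] with z hz
    exact (hZsum z hz).tsum_eq.symm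
  have hZdiff2 : ∀ {s : ℂ}, 1 ≤ s.re → DifferentiableAt ℂ Z s := fun {s} h =>
    (htsum s (by linarith)).2.congr_of_eventuallyEq (hZeq2 h)
  have half_re : (1 / 2 : ℂ).re < 1 := by norm_num
  have neg_half_re : (-1 / 2 : ℂ).re < 1 := by norm_num
  have zero_re' : (0 : ℂ).re < 1 := by simp
  refine ⟨Z, fun s hs => ?_, fun s hs => ?_, hZsum, hintC, fun s h1 h2 => ?_, ?_, ?_, ?_, ?_⟩
  · by_cases h : s.re < 1
    · exact (meromorphicAt_zetaFormula hg hg0 hasym hs h).congr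
        ((hZeq1 h).symm.filter_mono nhdsWithin_le_nhds)
    · refine AnalyticAt.meromorphicAt ?_
      rw [Complex.analyticAt_iff_eventually_differentiableAt]
      filter_upwards [(isOpen_lt continuous_const Complex.continuous_re).mem_nhds
        (show 3 / 4 < s.re by linarith)] with z hz
      refine (htsum z hz).2.congr_of_eventuallyEq ?_
      filter_upwards [(isOpen_lt continuous_const Complex.continuous_re).mem_nhds
        (show 1 / 2 < z.re by linarith [show 3 / 4 < z.re from hz])] with w hw
      exact (hZsum w hw).tsum_eq.symm
  · obtain ⟨hs1, hs2⟩ := hs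
    simp only [mem_insert_iff, mem_singleton_iff, not_or] at hs2
    by_cases h : s.re < 1
    · exact ((differentiableAt_zetaFormula hg hg0 hasym hs1 h hs2.1 hs2.2).congr_of_eventuallyEq
        (hZeq1 h)).differentiableWithinAt
    · exact (hZdiff2 (not_lt.1 h)).differentiableWithinAt
  · rw [hZlt h2]
    exact zetaFormula_eq_integral hg hg0 hasym h1 h2 (hintC s h1 h2)
  · exact (hasDerivAt_zetaFormula_zero hg hg0 hasym).congr_of_eventuallyEq (hZeq1 zero_re')
  · rw [hZlt zero_re', zetaFormula_zero]
  · refine (tendsto_sub_half_mul_zetaFormula hg hg0 hasym).congr' ?_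
    filter_upwards [(hZeq1 half_re).filter_mono nhdsWithin_le_nhds] with s hs
    rw [hs]
  · refine (tendsto_add_half_mul_zetaFormula hg hg0 hasym).congr' ?_
    filter_upwards [(hZeq1 neg_half_re).filter_mono nhdsWithin_le_nhds] with s hs
    rw [hs]

end

/-! ### The initial value problem as a power series in the spectral parameter -/

/-- Coefficients of the Sturm–Liouville equation `(p φ')' + lam ρ φ = 0`, extended to the whole
line: continuous and positive, with `1 / p` and `ρ` bounded by `M`. -/
structure SturmCoeff (p ρ : ℝ → ℝ) (M : ℝ) : Prop where
  cont_p : Continuous p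
  cont_ρ : Continuous ρ
  p_pos : ∀ x, 0 < p x
  ρ_pos : ∀ x, 0 < ρ x
  inv_p_le : ∀ x, 1 / p x ≤ M
  ρ_le : ∀ x, ρ x ≤ M

/-- The coefficient of `(-lam) ^ n` in the flux `p φ'` of the solution with `φ a = 0`,
`φ' a = 1`. -/
noncomputable def fluxIter (p ρ : ℝ → ℝ) (a : ℝ) : ℕ → ℝ → ℝ
  | 0 => fun _ => p a
  | n + 1 => fun x => ∫ t in a..x, ρ t * ∫ r in a..t, fluxIter p ρ a n r / p r

/-- The coefficient of `(-lam) ^ n` in the solution with `φ a = 0`, `φ' a = 1`. -/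
noncomputable def solIter (p ρ : ℝ → ℝ) (a : ℝ) (n : ℕ) (x : ℝ) : ℝ :=
  ∫ t in a..x, fluxIter p ρ a n t / p t

/-- The solution of `(p φ')' + lam ρ φ = 0`, `φ a = 0`, `φ' a = 1`, as a power series in `-lam`. -/
noncomputable def sturmSol (p ρ : ℝ → ℝ) (a : ℝ) (lam : ℂ) (x : ℝ) : ℂ :=
  ∑' n, (-lam) ^ n * (solIter p ρ a n x : ℂ)

/-- The flux `p φ'` of `sturmSol`. -/
noncomputable def sturmFlux (p ρ : ℝ → ℝ) (a : ℝ) (lam : ℂ) (x : ℝ) : ℂ :=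
  ∑' n, (-lam) ^ n * (fluxIter p ρ a n x : ℂ)

lemma abs_integral_le_of_abs_le_pow {g : ℝ → ℝ} {a C : ℝ} {k : ℕ}
    (hg : ∀ t, |g t| ≤ C * |t - a| ^ k) (x : ℝ) :
    |∫ t in a..x, g t| ≤ C * |x - a| ^ (k + 1) / (k + 1) := by
  have h1 := intervalIntegral.smul_integral_comp_add_mul (a := 0) (b := 1) g (x - a) a
  simp only [mul_zero, add_zero, mul_one, add_sub_cancel, smul_eq_mul] at h1
  rw [← h1, abs_mul]
  have h2 : ‖∫ u in (0 : ℝ)..1, g (a + (x - a) * u)‖ ≤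
      ∫ u in (0 : ℝ)..1, C * |x - a| ^ k * u ^ k := by
    refine intervalIntegral.norm_integral_le_of_norm_le zero_le_one ?_
      (Continuous.intervalIntegrable (by fun_prop) _ _)
    refine Eventually.of_forall fun u hu => ?_
    refine (hg _).trans (le_of_eq ?_)
    rw [add_sub_cancel_left, abs_mul, abs_of_pos hu.1, mul_pow]
    ring
  rw [intervalIntegral.integral_const_mul, integral_pow] at h2
  simp only [one_pow, ne_eq, Nat.succ_ne_zero, not_false_eq_true, zero_pow, sub_zero] at h2
  calc |x - a| * |∫ u in (0 : ℝ)..1, g (a + (x - a) * u)|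
      ≤ |x - a| * (C * |x - a| ^ k * (1 / (k + 1))) := by gcongr; exact h2
    _ = _ := by ring

namespace SturmCoeff

variable {p ρ : ℝ → ℝ} {M : ℝ}

lemma M_pos (h : SturmCoeff p ρ M) : 0 < M := (h.ρ_pos 0).trans_le (h.ρ_le 0)

lemma continuous_fluxIter_and_solIter (h : SturmCoeff p ρ M) (a : ℝ) (n : ℕ) :
    Continuous (fluxIter p ρ a n) ∧ Continuous (solIter p ρ a n) := by
  have key : ∀ n, Continuous (fluxIter p ρ a n) → Continuous (solIter p ρ a n) := by
    intro n hn
    exact intervalIntegral.continuous_primitive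
      (fun x y => (hn.div h.cont_p fun x => (h.p_pos x).ne').intervalIntegrable x y) a
  have hflux : Continuous (fluxIter p ρ a n) := by
    induction n with
    | zero => exact continuous_const
    | succ n ih =>
      exact intervalIntegral.continuous_primitive
        (fun x y => (h.cont_ρ.mul (key n ih)).intervalIntegrable x y) a
  exact ⟨hflux, key n hflux⟩

lemma hasDerivAt_solIter (h : SturmCoeff p ρ M) (a : ℝ) (n : ℕ) (x : ℝ) :
    HasDerivAt (solIter p ρ a n) (fluxIter p ρ a n x / p x) x :=
  (((h.continuous_fluxIter_and_solIter a n).1.div h.cont_p fun x =>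
    (h.p_pos x).ne')).integral_hasStrictDerivAt a x |>.hasDerivAt

lemma hasDerivAt_fluxIter_succ (h : SturmCoeff p ρ M) (a : ℝ) (n : ℕ) (x : ℝ) :
    HasDerivAt (fluxIter p ρ a (n + 1)) (ρ x * solIter p ρ a n x) x :=
  ((h.cont_ρ.mul (h.continuous_fluxIter_and_solIter a n).2).integral_hasStrictDerivAt
    a x).hasDerivAt

lemma abs_fluxIter_le_and_abs_solIter_le (h : SturmCoeff p ρ M) (a : ℝ) (n : ℕ) (x : ℝ) :
    |fluxIter p ρ a n x| ≤ p a * (M * |x - a|) ^ (2 * n) / (2 * n).factorial ∧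
    |solIter p ρ a n x| ≤ p a * (M * |x - a|) ^ (2 * n + 1) / (2 * n + 1).factorial := by
  have key : ∀ n, (∀ x, |fluxIter p ρ a n x| ≤
      p a * (M * |x - a|) ^ (2 * n) / (2 * n).factorial) → ∀ x,
      |solIter p ρ a n x| ≤ p a * (M * |x - a|) ^ (2 * n + 1) / (2 * n + 1).factorial := by
    intro n hn x
    refine (abs_integral_le_of_abs_le_pow (C := p a * M ^ (2 * n + 1) / (2 * n).factorial)
      (k := 2 * n) (fun t => ?_) x).trans (le_of_eq ?_)
    · rw [div_eq_mul_one_div, abs_mul, abs_of_pos (one_div_pos.2 (h.p_pos t))]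
      calc |fluxIter p ρ a n t| * (1 / p t)
          ≤ (p a * (M * |t - a|) ^ (2 * n) / (2 * n).factorial) * M :=
            mul_le_mul (hn t) (h.inv_p_le t) (one_div_pos.2 (h.p_pos t)).le
              ((abs_nonneg _).trans (hn t))
        _ = _ := by rw [mul_pow]; ring
    · rw [Nat.factorial_succ, mul_pow]
      push_cast
      field_simp
  have hflux : ∀ x, |fluxIter p ρ a n x| ≤ p a * (M * |x - a|) ^ (2 * n) / (2 * n).factorial := by
    induction n with
    | zero => intro x; simp [fluxIter, abs_of_pos (h.p_pos a)]
    | succ n ih =>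
      intro x
      refine (abs_integral_le_of_abs_le_pow (C := p a * M ^ (2 * n + 2) / (2 * n + 1).factorial)
        (k := 2 * n + 1) (fun t => ?_) x).trans (le_of_eq ?_)
      · change |ρ t * solIter p ρ a n t| ≤ _
        rw [abs_mul, abs_of_pos (h.ρ_pos t)]
        calc ρ t * |solIter p ρ a n t|
            ≤ M * (p a * (M * |t - a|) ^ (2 * n + 1) / (2 * n + 1).factorial) :=
              mul_le_mul (h.ρ_le t) (key n ih t) (abs_nonneg _) h.M_pos.le
          _ = _ := by rw [mul_pow]; ring
      · rw [show 2 * (n + 1) = 2 * n + 1 + 1 by ring, Nat.factorial_succ (2 * n + 1), mul_pow]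
        push_cast
        field_simp
  exact ⟨hflux x, key n hflux x⟩

/-- A common summable bound for the terms of `sturmSol` and `sturmFlux`. -/
lemma norm_terms_le (h : SturmCoeff p ρ M) {a : ℝ} (n : ℕ) {lam : ℂ} {x R : ℝ}
    (hx : |x - a| ≤ R) :
    ‖(-lam) ^ n * (solIter p ρ a n x : ℂ)‖
      ≤ p a * (M * R) * ((√‖lam‖ * (M * R)) ^ (2 * n) / (2 * n).factorial) ∧
    ‖(-lam) ^ n * (fluxIter p ρ a n x : ℂ)‖
      ≤ p a * ((√‖lam‖ * (M * R)) ^ (2 * n) / (2 * n).factorial) := by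
  have hM := h.M_pos
  have hR : 0 ≤ R := (abs_nonneg _).trans hx
  have hpa := h.p_pos a
  have hl : ‖lam‖ ^ n = √‖lam‖ ^ (2 * n) := by
    rw [pow_mul, Real.sq_sqrt (norm_nonneg _)]
  obtain ⟨h1, h2⟩ := h.abs_fluxIter_le_and_abs_solIter_le a n x
  constructor
  · rw [norm_mul, norm_pow, norm_neg, norm_real, Real.norm_eq_abs, hl]
    calc √‖lam‖ ^ (2 * n) * |solIter p ρ a n x|
        ≤ √‖lam‖ ^ (2 * n) * (p a * (M * R) ^ (2 * n + 1) / (2 * n).factorial) := by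
          gcongr
          refine h2.trans ?_
          gcongr
          omega
      _ = _ := by rw [mul_pow]; ring
  · rw [norm_mul, norm_pow, norm_neg, norm_real, Real.norm_eq_abs, hl]
    calc √‖lam‖ ^ (2 * n) * |fluxIter p ρ a n x|
        ≤ √‖lam‖ ^ (2 * n) * (p a * (M * R) ^ (2 * n) / (2 * n).factorial) := by
          gcongr
          exact h1.trans (by gcongr)
      _ = _ := by rw [mul_pow]; ring

lemma summable_solIter (h : SturmCoeff p ρ M) (a : ℝ) (lam : ℂ) (x : ℝ) :
    Summable fun n => (-lam) ^ n * (solIter p ρ a n x : ℂ) :=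
  Summable.of_norm_bounded ((Real.hasSum_cosh _).summable.mul_left _)
    fun n => (h.norm_terms_le n le_rfl).1

lemma summable_fluxIter (h : SturmCoeff p ρ M) (a : ℝ) (lam : ℂ) (x : ℝ) :
    Summable fun n => (-lam) ^ n * (fluxIter p ρ a n x : ℂ) :=
  Summable.of_norm_bounded ((Real.hasSum_cosh _).summable.mul_left _)
    fun n => (h.norm_terms_le n le_rfl).2

lemma norm_sturmSol_le (h : SturmCoeff p ρ M) {a : ℝ} (lam : ℂ) {x R : ℝ} (hx : |x - a| ≤ R) :
    ‖sturmSol p ρ a lam x‖ ≤ p a * (M * R) * Real.exp (√‖lam‖ * (M * R)) := by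
  refine (tsum_of_norm_bounded ((Real.hasSum_cosh _).mul_left _)
    fun n => (h.norm_terms_le n hx).1).trans ?_
  have hM := h.M_pos
  have hR : 0 ≤ R := (abs_nonneg _).trans hx
  have hpa := h.p_pos a
  refine mul_le_mul_of_nonneg_left ?_ (by positivity)
  rw [Real.cosh_eq]
  have : Real.exp (-(√‖lam‖ * (M * R))) ≤ Real.exp (√‖lam‖ * (M * R)) :=
    Real.exp_le_exp.2 (neg_le_self (by positivity))
  linarith

lemma sturmSol_left (p ρ : ℝ → ℝ) (a : ℝ) (lam : ℂ) : sturmSol p ρ a lam a = 0 := by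
  simp [sturmSol, solIter]

lemma sturmFlux_left (p ρ : ℝ → ℝ) (a : ℝ) (lam : ℂ) : sturmFlux p ρ a lam a = p a := by
  rw [sturmFlux, tsum_eq_single 0]
  · simp [fluxIter]
  · intro n hn
    obtain ⟨m, rfl⟩ := Nat.exists_eq_succ_of_ne_zero hn
    simp [fluxIter]

lemma hasDerivAt_sturmSol (h : SturmCoeff p ρ M) (a : ℝ) (lam : ℂ) (x : ℝ) :
    HasDerivAt (sturmSol p ρ a lam) (sturmFlux p ρ a lam x / p x) x := by
  set R := |x - a| + 1
  have hM := h.M_pos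
  have hmem : x ∈ Metric.ball a R := by
    rw [Metric.mem_ball, Real.dist_eq]; exact lt_add_one _
  have hmem0 : a ∈ Metric.ball a R := Metric.mem_ball_self (by positivity)
  have key := hasDerivAt_tsum_of_isPreconnected
    (u := fun n => M * (p a * ((√‖lam‖ * (M * R)) ^ (2 * n) / (2 * n).factorial)))
    (((Real.hasSum_cosh _).summable.mul_left _).mul_left _) Metric.isOpen_ball
    (convex_ball a R).isPreconnected
    (g := fun n x => (-lam) ^ n * (solIter p ρ a n x : ℂ))
    (g' := fun n x => (-lam) ^ n * ((fluxIter p ρ a n x / p x : ℝ) : ℂ))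
    (fun n y _ => ((h.hasDerivAt_solIter a n y).ofReal_comp).const_mul _)
    (fun n y hy => by
      rw [Metric.mem_ball, Real.dist_eq] at hy
      have h1 := (h.norm_terms_le (lam := lam) n hy.le).2
      have h2 : ‖(-lam) ^ n * ((fluxIter p ρ a n y / p y : ℝ) : ℂ)‖
          = (1 / p y) * ‖(-lam) ^ n * (fluxIter p ρ a n y : ℂ)‖ := by
        rw [norm_mul, norm_mul, norm_real, norm_real, norm_div, Real.norm_of_nonneg (h.p_pos y).le]
        ring
      rw [h2]
      exact mul_le_mul (h.inv_p_le y) h1 (norm_nonneg _) hM.le)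
    hmem0 (h.summable_solIter a lam a) hmem
  refine HasDerivAt.congr_deriv key ?_
  rw [sturmFlux, ← tsum_div_const]
  refine tsum_congr fun n => ?_
  push_cast
  ring

lemma hasDerivAt_sturmFlux (h : SturmCoeff p ρ M) (a : ℝ) (lam : ℂ) (x : ℝ) :
    HasDerivAt (sturmFlux p ρ a lam) (-lam * ρ x * sturmSol p ρ a lam x) x := by
  set R := |x - a| + 1
  have hM := h.M_pos
  have hmem : x ∈ Metric.ball a R := by
    rw [Metric.mem_ball, Real.dist_eq]; exact lt_add_one _
  have hmem0 : a ∈ Metric.ball a R := Metric.mem_ball_self (by positivity)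
  have hs : ∀ y, Summable fun n => (-lam) ^ (n + 1) * (fluxIter p ρ a (n + 1) y : ℂ) := fun y =>
    (summable_nat_add_iff 1).2 (h.summable_fluxIter a lam y)
  have hsplit : sturmFlux p ρ a lam = fun y =>
      (p a : ℂ) + ∑' n, (-lam) ^ (n + 1) * (fluxIter p ρ a (n + 1) y : ℂ) := by
    ext y
    rw [sturmFlux, (h.summable_fluxIter a lam y).tsum_eq_zero_add]
    simp [fluxIter]
  have key := hasDerivAt_tsum_of_isPreconnected
    (u := fun n => ‖lam‖ * (M * (p a * (M * R) *
      ((√‖lam‖ * (M * R)) ^ (2 * n) / (2 * n).factorial))))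
    ((((Real.hasSum_cosh _).summable.mul_left _).mul_left _).mul_left _) Metric.isOpen_ball
    (convex_ball a R).isPreconnected
    (g := fun n x => (-lam) ^ (n + 1) * (fluxIter p ρ a (n + 1) x : ℂ))
    (g' := fun n x => (-lam) ^ (n + 1) * ((ρ x * solIter p ρ a n x : ℝ) : ℂ))
    (fun n y _ => ((h.hasDerivAt_fluxIter_succ a n y).ofReal_comp).const_mul _)
    (fun n y hy => by
      rw [Metric.mem_ball, Real.dist_eq] at hy
      have h1 := (h.norm_terms_le (lam := lam) n hy.le).1
      have h2 : ‖(-lam) ^ (n + 1) * ((ρ y * solIter p ρ a n y : ℝ) : ℂ)‖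
          = ‖lam‖ * (ρ y * ‖(-lam) ^ n * (solIter p ρ a n y : ℂ)‖) := by
        rw [norm_mul, norm_mul, norm_real, norm_real, norm_mul, Real.norm_of_nonneg (h.ρ_pos y).le,
          pow_succ, norm_mul, norm_neg]
        ring
      rw [h2]
      refine mul_le_mul_of_nonneg_left ?_ (norm_nonneg _)
      exact mul_le_mul (h.ρ_le y) h1 (norm_nonneg _) hM.le)
    hmem0 (hs a) hmem
  rw [hsplit]
  refine HasDerivAt.congr_deriv (key.const_add _) ?_
  rw [sturmSol, ← tsum_mul_left]
  refine tsum_congr fun n => ?_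
  push_cast
  ring

lemma differentiable_sturmSol_param (h : SturmCoeff p ρ M) (a x : ℝ) :
    Differentiable ℂ fun lam => sturmSol p ρ a lam x := by
  intro lam
  have hM := h.M_pos
  have hpa := h.p_pos a
  have := differentiableOn_tsum_of_summable_norm
    (u := fun n => p a * (M * |x - a|) *
      ((√(‖lam‖ + 1) * (M * |x - a|)) ^ (2 * n) / (2 * n).factorial))
    ((Real.hasSum_cosh _).summable.mul_left _)
    (F := fun n (lam : ℂ) => (-lam) ^ n * (solIter p ρ a n x : ℂ))
    (U := Metric.ball 0 (‖lam‖ + 1)) (fun n => by fun_prop) Metric.isOpen_ball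
    (fun n z hz => by
      rw [mem_ball_zero_iff] at hz
      refine (h.norm_terms_le n le_rfl).1.trans ?_
      gcongr)
  exact this.differentiableAt (Metric.isOpen_ball.mem_nhds (by simp))

lemma im_sturmSol_ofReal (p ρ : ℝ → ℝ) (a r x : ℝ) : (sturmSol p ρ a r x).im = 0 := by
  have : sturmSol p ρ a r x = ((∑' n, (-r) ^ n * solIter p ρ a n x : ℝ) : ℂ) := by
    rw [sturmSol, Complex.ofReal_tsum]
    push_cast
    rfl
  rw [this, Complex.ofReal_im]

lemma sturmSol_zero (p ρ : ℝ → ℝ) (a x : ℝ) :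
    sturmSol p ρ a 0 x = ((p a * ∫ t in a..x, 1 / p t : ℝ) : ℂ) := by
  rw [sturmSol, tsum_eq_single 0]
  · simp only [pow_zero, one_mul, solIter, fluxIter]
    rw [← intervalIntegral.integral_const_mul]
    simp [div_eq_mul_inv]
  · intro n hn
    simp [hn]

end SturmCoeff

/-! ### The radial equation in divergence form -/

section IccCalculus

variable {E : Type*} [NormedAddCommGroup E] [NormedSpace ℝ E] {a b : ℝ} {g g1 g2 : ℝ → E}

lemma hasDerivWithinAt_d1_d2 (hab : a < b) (hg : ContDiffOn ℝ 2 g (Icc a b)) :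
    (∀ x ∈ Icc a b, HasDerivWithinAt g (d1 a b g x) (Icc a b) x) ∧
    (∀ x ∈ Icc a b, HasDerivWithinAt (d1 a b g) (d2 a b g x) (Icc a b) x) ∧
    ContinuousOn (d2 a b g) (Icc a b) := by
  have hu := uniqueDiffOn_Icc hab
  have h1 : ContDiffOn ℝ (1 + 1) g (Icc a b) := by
    convert hg using 1
    norm_num
  obtain ⟨hd, -, h2⟩ := (contDiffOn_succ_iff_derivWithin hu).1 h1
  have h2' : ContDiffOn ℝ (0 + 1) (derivWithin g (Icc a b)) (Icc a b) := by simpa using h2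
  obtain ⟨hd2, -, h3⟩ := (contDiffOn_succ_iff_derivWithin hu).1 h2'
  exact ⟨fun x hx => (hd x hx).hasDerivWithinAt, fun x hx => (hd2 x hx).hasDerivWithinAt,
    h3.continuousOn⟩

lemma contDiffOn_two_of_hasDerivWithinAt (hab : a < b)
    (h1 : ∀ x ∈ Icc a b, HasDerivWithinAt g (g1 x) (Icc a b) x)
    (h2 : ∀ x ∈ Icc a b, HasDerivWithinAt g1 (g2 x) (Icc a b) x)
    (h3 : ContinuousOn g2 (Icc a b)) :
    ContDiffOn ℝ 2 g (Icc a b) ∧ EqOn (d1 a b g) g1 (Icc a b) ∧ EqOn (d2 a b g) g2 (Icc a b) := by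
  have hu := uniqueDiffOn_Icc hab
  have e1 : EqOn (d1 a b g) g1 (Icc a b) := fun x hx => (h1 x hx).derivWithin (hu x hx)
  have e2 : EqOn (d2 a b g) g2 (Icc a b) := fun x hx =>
    (derivWithin_congr e1 (e1 hx)).trans ((h2 x hx).derivWithin (hu x hx))
  refine ⟨?_, e1, e2⟩
  have hg1 : ContDiffOn ℝ 1 g1 (Icc a b) := by
    have : ContDiffOn ℝ (0 + 1) g1 (Icc a b) := by
      refine (contDiffOn_succ_iff_derivWithin hu).2
        ⟨fun x hx => (h2 x hx).differentiableWithinAt, by simp, ?_⟩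
      exact contDiffOn_zero.2 (h3.congr fun x hx => (h2 x hx).derivWithin (hu x hx))
    simpa using this
  have : ContDiffOn ℝ (1 + 1) g (Icc a b) :=
    (contDiffOn_succ_iff_derivWithin hu).2
      ⟨fun x hx => (h1 x hx).differentiableWithinAt, by simp, hg1.congr e1⟩
  convert this using 1
  norm_num

end IccCalculus

/-- The arc length density `√(1 + f'²)` of the graph of `f`. -/
noncomputable def speed (f : ℝ → ℝ) (a b x : ℝ) : ℝ :=
  Real.sqrt (1 + d1 a b f x ^ 2)

/-- The nearest point of `[a, b]`. -/
noncomputable def clamp (a b x : ℝ) : ℝ :=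
  max a (min b x)

/-- The leading coefficient `f / √(1 + f'²)` of the radial equation in divergence form,
extended from `[a, b]` by constants. -/
noncomputable def coeffP (f : ℝ → ℝ) (a b x : ℝ) : ℝ :=
  f (clamp a b x) / speed f a b (clamp a b x)

/-- The weight `f √(1 + f'²)` of the radial equation in divergence form, extended from `[a, b]`
by constants. -/
noncomputable def coeffρ (f : ℝ → ℝ) (a b x : ℝ) : ℝ :=
  f (clamp a b x) * speed f a b (clamp a b x)

lemma clamp_mem {a b : ℝ} (hab : a < b) (x : ℝ) : clamp a b x ∈ Icc a b :=
  ⟨le_max_left _ _, max_le hab.le (min_le_left _ _)⟩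

lemma clamp_of_mem {a b x : ℝ} (hx : x ∈ Icc a b) : clamp a b x = x := by
  rw [clamp, min_eq_right hx.2, max_eq_right hx.1]

lemma one_le_speed (f : ℝ → ℝ) (a b x : ℝ) : 1 ≤ speed f a b x :=
  Real.one_le_sqrt.2 (by nlinarith [sq_nonneg (d1 a b f x)])

lemma speed_pos (f : ℝ → ℝ) (a b x : ℝ) : 0 < speed f a b x :=
  zero_lt_one.trans_le (one_le_speed f a b x)

lemma speed_sq (f : ℝ → ℝ) (a b x : ℝ) : speed f a b x ^ 2 = 1 + d1 a b f x ^ 2 :=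
  Real.sq_sqrt (by positivity)

section

variable {f : ℝ → ℝ} {a b : ℝ}

lemma hasDerivWithinAt_speed (hab : a < b) (hf : ContDiffOn ℝ 2 f (Icc a b)) {x : ℝ}
    (hx : x ∈ Icc a b) :
    HasDerivWithinAt (speed f a b) (d1 a b f x * d2 a b f x / speed f a b x) (Icc a b) x := by
  have h1 := ((hasDerivWithinAt_d1_d2 hab hf).2.1 x hx).pow 2
  have h2 := (h1.const_add 1).sqrt (ne_of_gt (add_pos_of_pos_of_nonneg one_pos (sq_nonneg _)))
  refine h2.congr_deriv ?_
  have h3 : √(1 + (d1 a b f ^ 2) x) = speed f a b x := rfl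
  rw [h3, ← mul_div_mul_left (d1 a b f x * d2 a b f x) _ (two_ne_zero' ℝ)]
  simp only [Nat.cast_ofNat, Nat.add_one_sub_one, pow_one, mul_assoc]

lemma continuousOn_speed (hab : a < b) (hf : ContDiffOn ℝ 2 f (Icc a b)) :
    ContinuousOn (speed f a b) (Icc a b) := fun _ hx =>
  (hasDerivWithinAt_speed hab hf hx).continuousWithinAt

lemma exists_sturmCoeff (hab : a < b) (hf : ContDiffOn ℝ 2 f (Icc a b))
    (hpos : ∀ x ∈ Icc a b, 0 < f x) : ∃ M, SturmCoeff (coeffP f a b) (coeffρ f a b) M := by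
  have hclamp : Continuous (clamp a b) := by unfold clamp; fun_prop
  have hfc : Continuous fun x => f (clamp a b x) :=
    hf.continuousOn.comp_continuous hclamp (clamp_mem hab)
  have hwc : Continuous fun x => speed f a b (clamp a b x) :=
    (continuousOn_speed hab hf).comp_continuous hclamp (clamp_mem hab)
  have hpc : Continuous (coeffP f a b) := hfc.div hwc fun x => (speed_pos _ _ _ _).ne'
  have hρc : Continuous (coeffρ f a b) := hfc.mul hwc
  have hp : ∀ x, 0 < coeffP f a b x := fun x =>
    div_pos (hpos _ (clamp_mem hab x)) (speed_pos _ _ _ _)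
  have hρ : ∀ x, 0 < coeffρ f a b x := fun x =>
    mul_pos (hpos _ (clamp_mem hab x)) (speed_pos _ _ _ _)
  have hpe : ∀ x, coeffP f a b x = coeffP f a b (clamp a b x) := fun x => by
    rw [coeffP, coeffP, clamp_of_mem (clamp_mem hab x)]
  have hρe : ∀ x, coeffρ f a b x = coeffρ f a b (clamp a b x) := fun x => by
    rw [coeffρ, coeffρ, clamp_of_mem (clamp_mem hab x)]
  obtain ⟨M1, hM1⟩ := (isCompact_Icc (a := a) (b := b)).bddAbove_image
    (f := fun x => 1 / coeffP f a b x)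
    (continuous_const.div hpc fun x => (hp x).ne').continuousOn
  obtain ⟨M2, hM2⟩ := (isCompact_Icc (a := a) (b := b)).bddAbove_image hρc.continuousOn
  refine ⟨max M1 M2, hpc, hρc, hp, hρ, fun x => ?_, fun x => ?_⟩
  · rw [hpe]
    exact (hM1 ⟨_, clamp_mem hab x, rfl⟩).trans (le_max_left _ _)
  · rw [hρe]
    exact (hM2 ⟨_, clamp_mem hab x, rfl⟩).trans (le_max_right _ _)

lemma coeffP_of_mem {x : ℝ} (hx : x ∈ Icc a b) : coeffP f a b x = f x / speed f a b x := by
  rw [coeffP, clamp_of_mem hx]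

lemma coeffρ_of_mem {x : ℝ} (hx : x ∈ Icc a b) : coeffρ f a b x = f x * speed f a b x := by
  rw [coeffρ, clamp_of_mem hx]

lemma coeffρ_eq_coeffP_mul {x : ℝ} (hx : x ∈ Icc a b) :
    coeffρ f a b x = coeffP f a b x * (1 + d1 a b f x ^ 2) := by
  have hw := speed_pos f a b x
  rw [coeffρ_of_mem hx, coeffP_of_mem hx, ← speed_sq f a b x]
  field_simp

/-- The first order coefficient of the radial equation is `p' / p`. -/
lemma hasDerivWithinAt_coeffP (hab : a < b) (hf : ContDiffOn ℝ 2 f (Icc a b))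
    (hpos : ∀ x ∈ Icc a b, 0 < f x) {x : ℝ} (hx : x ∈ Icc a b) :
    HasDerivWithinAt (coeffP f a b) (coeffP f a b x *
      (d1 a b f x / f x - d1 a b f x * d2 a b f x / (1 + d1 a b f x ^ 2))) (Icc a b) x := by
  have h1 := ((hasDerivWithinAt_d1_d2 hab hf).1 x hx).div (hasDerivWithinAt_speed hab hf hx)
    (speed_pos f a b x).ne'
  refine (h1.congr_deriv ?_).congr (fun y hy => coeffP_of_mem hy) (coeffP_of_mem hx)
  have hw := speed_pos f a b x
  have hfx := hpos x hx
  rw [coeffP_of_mem hx, ← speed_sq f a b x]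
  field_simp

/-- Uniqueness for the first order system `φ' = η / p`, `η' = -lam ρ φ`. -/
lemma SturmCoeff.eqOn_of_system {p ρ : ℝ → ℝ} {M : ℝ} (h : SturmCoeff p ρ M) {lam : ℂ}
    {φ η ψ θ : ℝ → ℂ}
    (hφ : ∀ x ∈ Icc a b, HasDerivWithinAt φ (η x / p x) (Icc a b) x)
    (hη : ∀ x ∈ Icc a b, HasDerivWithinAt η (-lam * ρ x * φ x) (Icc a b) x)
    (hψ : ∀ x ∈ Icc a b, HasDerivWithinAt ψ (θ x / p x) (Icc a b) x)
    (hθ : ∀ x ∈ Icc a b, HasDerivWithinAt θ (-lam * ρ x * ψ x) (Icc a b) x)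
    (h0 : φ a = ψ a) (h1 : η a = θ a) : EqOn φ ψ (Icc a b) := by
  set v : ℝ → ℂ × ℂ → ℂ × ℂ := fun t u => (u.2 / p t, -lam * ρ t * u.1) with hv
  have hM := h.M_pos
  set K : NNReal := ⟨max M (‖lam‖ * M), le_max_of_le_left hM.le⟩ with hK
  have hlip : ∀ t ∈ Ico a b, LipschitzOnWith K (v t) univ := by
    intro t _
    refine LipschitzOnWith.of_dist_le_mul fun u _ u' _ => ?_
    have hp0 := h.p_pos t
    have e1 : ‖u.2 / p t - u'.2 / p t‖ ≤ M * ‖u.2 - u'.2‖ := by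
      rw [← sub_div, norm_div, norm_real, Real.norm_of_nonneg hp0.le, div_eq_mul_one_div, mul_comm]
      exact mul_le_mul_of_nonneg_right (h.inv_p_le t) (norm_nonneg _)
    have e2 : ‖-lam * ρ t * u.1 - -lam * ρ t * u'.1‖ ≤ ‖lam‖ * M * ‖u.1 - u'.1‖ := by
      rw [← mul_sub, norm_mul, norm_mul, norm_neg, norm_real, Real.norm_of_nonneg (h.ρ_pos t).le]
      gcongr
      exact h.ρ_le t
    rw [dist_eq_norm, dist_eq_norm, Prod.norm_def]
    have n1 : ‖u.1 - u'.1‖ ≤ ‖u - u'‖ := norm_fst_le (u - u')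
    have n2 : ‖u.2 - u'.2‖ ≤ ‖u - u'‖ := norm_snd_le (u - u')
    refine max_le (e1.trans ?_) (e2.trans ?_)
    · exact mul_le_mul (le_max_left _ _) n2 (norm_nonneg _) K.2
    · exact mul_le_mul (le_max_right _ _) n1 (norm_nonneg _) K.2
  have hcont : ∀ {φ η : ℝ → ℂ}, (∀ x ∈ Icc a b, HasDerivWithinAt φ (η x / p x) (Icc a b) x) →
      (∀ x ∈ Icc a b, HasDerivWithinAt η (-lam * ρ x * φ x) (Icc a b) x) →
      ContinuousOn (fun x => (φ x, η x)) (Icc a b) ∧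
      ∀ t ∈ Ico a b, HasDerivWithinAt (fun x => (φ x, η x)) (v t (φ t, η t)) (Ici t) t := by
    intro φ η hφ hη
    refine ⟨ContinuousOn.prodMk (fun x hx => (hφ x hx).continuousWithinAt)
      (fun x hx => (hη x hx).continuousWithinAt), fun t ht => ?_⟩
    have := (hφ t (Ico_subset_Icc_self ht)).prodMk (hη t (Ico_subset_Icc_self ht))
    exact this.mono_of_mem_nhdsWithin (Icc_mem_nhdsGE_of_mem ht)
  obtain ⟨c1, c2⟩ := hcont hφ hη
  obtain ⟨c3, c4⟩ := hcont hψ hθ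
  have := ODE_solution_unique_of_mem_Icc_right hlip c1 c2 (fun _ _ => mem_univ _) c3 c4
    (fun _ _ => mem_univ _) (by rw [h0, h1])
  exact fun x hx => congrArg Prod.fst (this hx)

lemma isInitialSolution_sturmSol (hab : a < b) (hf : ContDiffOn ℝ 2 f (Icc a b))
    (hpos : ∀ x ∈ Icc a b, 0 < f x) (lam : ℂ) :
    IsInitialSolution f a b 0 lam (sturmSol (coeffP f a b) (coeffρ f a b) a lam) := by
  obtain ⟨M, h⟩ := exists_sturmCoeff hab hf hpos
  set p := coeffP f a b
  set ρ := coeffρ f a b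
  set P1 : ℝ → ℝ := fun x => d1 a b f x / f x - d1 a b f x * d2 a b f x / (1 + d1 a b f x ^ 2)
    with hP1
  set φ := sturmSol p ρ a lam
  set η := sturmFlux p ρ a lam
  have hpc : ∀ x, (p x : ℂ) ≠ 0 := fun x => by exact_mod_cast (h.p_pos x).ne'
  have hφd : ∀ x ∈ Icc a b, HasDerivWithinAt φ (η x / p x) (Icc a b) x :=
    fun x _ => (h.hasDerivAt_sturmSol a lam x).hasDerivWithinAt
  have hηd : ∀ x ∈ Icc a b, HasDerivWithinAt (fun x => η x / p x)
      (-lam * ((1 + d1 a b f x ^ 2 : ℝ) : ℂ) * φ x - (P1 x : ℂ) * (η x / p x)) (Icc a b) x := by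
    intro x hx
    have e1 := (h.hasDerivAt_sturmFlux a lam x).hasDerivWithinAt (s := Icc a b)
    have e2 := (hasDerivWithinAt_coeffP hab hf hpos hx).ofReal_comp
    refine (e1.div e2 (hpc x)).congr_deriv ?_
    have e3 : (ρ x : ℂ) = p x * ((1 + d1 a b f x ^ 2 : ℝ) : ℂ) := by
      rw [← Complex.ofReal_mul]
      exact congrArg _ (coeffρ_eq_coeffP_mul hx)
    have := hpc x
    change (-lam * ρ x * φ x * p x - η x * ((p x * P1 x : ℝ) : ℂ)) / (p x : ℂ) ^ 2 = _
    rw [e3, Complex.ofReal_mul]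
    field_simp
  obtain ⟨hd1, hd2, hd3⟩ := hasDerivWithinAt_d1_d2 hab hf
  have hd1c : ContinuousOn (d1 a b f) (Icc a b) := fun x hx => (hd2 x hx).continuousWithinAt
  have hP1c : ContinuousOn P1 (Icc a b) := by
    refine ContinuousOn.sub (hd1c.div hf.continuousOn fun x hx => (hpos x hx).ne') ?_
    exact (hd1c.mul hd3).div (by fun_prop) fun x _ => by positivity
  have hηc : ContinuousOn (fun x => η x / p x) (Icc a b) := fun x hx =>
    (hηd x hx).continuousWithinAt
  have hφc : ContinuousOn φ (Icc a b) := fun x hx => (hφd x hx).continuousWithinAt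
  have hc : ContinuousOn (fun x => -lam * ((1 + d1 a b f x ^ 2 : ℝ) : ℂ) * φ x
      - (P1 x : ℂ) * (η x / p x)) (Icc a b) := by
    have h1 : ContinuousOn (fun x => ((1 + d1 a b f x ^ 2 : ℝ) : ℂ)) (Icc a b) :=
      Complex.continuous_ofReal.comp_continuousOn (by fun_prop)
    have h2 : ContinuousOn (fun x => (P1 x : ℂ)) (Icc a b) :=
      Complex.continuous_ofReal.comp_continuousOn hP1c
    exact ((continuousOn_const.mul h1).mul hφc).sub (h2.mul hηc)
  obtain ⟨hC, hE1, hE2⟩ := contDiffOn_two_of_hasDerivWithinAt hab hφd hηd hc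
  refine ⟨⟨hC, fun x hx => ?_⟩, SturmCoeff.sturmSol_left _ _ _ _, ?_⟩
  · rw [hE1 hx, hE2 hx]
    simp only [hP1]
    push_cast
    ring
  · have ha : a ∈ Icc a b := left_mem_Icc.2 hab.le
    rw [hE1 ha]
    simp only [η]
    rw [SturmCoeff.sturmFlux_left, div_self (hpc a)]

/-- A radial solution vanishing at `a` is a multiple of the initial solution. -/
lemma IsRadialSolution.eqOn_smul_sturmSol (hab : a < b) (hf : ContDiffOn ℝ 2 f (Icc a b))
    (hpos : ∀ x ∈ Icc a b, 0 < f x) {lam : ℂ} {φ : ℝ → ℂ} (hφ : IsRadialSolution f a b 0 lam φ)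
    (hφa : φ a = 0) :
    EqOn φ (fun x => d1 a b φ a * sturmSol (coeffP f a b) (coeffρ f a b) a lam x) (Icc a b) := by
  obtain ⟨M, h⟩ := exists_sturmCoeff hab hf hpos
  obtain ⟨hC, hode⟩ := hφ
  obtain ⟨hd1, hd2, -⟩ := hasDerivWithinAt_d1_d2 hab hC
  set p := coeffP f a b
  set ρ := coeffρ f a b
  have hpc : ∀ x, (p x : ℂ) ≠ 0 := fun x => by exact_mod_cast (h.p_pos x).ne'
  refine h.eqOn_of_system (lam := lam) (η := fun x => p x * d1 a b φ x)
    (θ := fun x => d1 a b φ a * sturmFlux p ρ a lam x) (fun x hx => ?_) (fun x hx => ?_)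
    (fun x hx => ?_) (fun x hx => ?_) ?_ ?_
  · rw [mul_div_cancel_left₀ _ (hpc x)]
    exact hd1 x hx
  · have e1 := ((hasDerivWithinAt_coeffP hab hf hpos hx).ofReal_comp).mul (hd2 x hx)
    refine e1.congr_deriv ?_
    have e3 : (ρ x : ℂ) = p x * ((1 + d1 a b f x ^ 2 : ℝ) : ℂ) := by
      rw [← Complex.ofReal_mul]
      exact congrArg _ (coeffρ_eq_coeffP_mul hx)
    have e4 := hode x hx
    rw [e3, Complex.ofReal_mul]
    simp only [Int.cast_zero, ne_eq, OfNat.ofNat_ne_zero, not_false_eq_true, zero_pow, zero_div,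
      Complex.ofReal_zero, sub_zero] at e4
    linear_combination (p x : ℂ) * e4
  · exact (((h.hasDerivAt_sturmSol a lam x).const_mul _).congr_deriv
      (by ring)).hasDerivWithinAt
  · exact (((h.hasDerivAt_sturmFlux a lam x).const_mul _).congr_deriv
      (by ring)).hasDerivWithinAt
  · rw [hφa, SturmCoeff.sturmSol_left, mul_zero]
  · rw [SturmCoeff.sturmFlux_left, mul_comm]

lemma IsInitialSolution.eqOn_sturmSol (hab : a < b) (hf : ContDiffOn ℝ 2 f (Icc a b))
    (hpos : ∀ x ∈ Icc a b, 0 < f x) {lam : ℂ} {φ : ℝ → ℂ} (hφ : IsInitialSolution f a b 0 lam φ) :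
    EqOn φ (sturmSol (coeffP f a b) (coeffρ f a b) a lam) (Icc a b) := by
  intro x hx
  have := IsRadialSolution.eqOn_smul_sturmSol hab hf hpos hφ.1 hφ.2.1 hx
  rw [this, hφ.2.2]
  exact one_mul _

lemma isInitialSolution_phi (hab : a < b) (hf : ContDiffOn ℝ 2 f (Icc a b))
    (hpos : ∀ x ∈ Icc a b, 0 < f x) (lam : ℂ) :
    IsInitialSolution f a b 0 lam (phi f a b 0 lam) := by
  have h : ∃ φ, IsInitialSolution f a b 0 lam φ := ⟨_, isInitialSolution_sturmSol hab hf hpos lam⟩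
  rw [phi, dif_pos h]
  exact h.choose_spec

lemma phi_right (hab : a < b) (hf : ContDiffOn ℝ 2 f (Icc a b))
    (hpos : ∀ x ∈ Icc a b, 0 < f x) (lam : ℂ) :
    phi f a b 0 lam b = sturmSol (coeffP f a b) (coeffρ f a b) a lam b :=
  (isInitialSolution_phi hab hf hpos lam).eqOn_sturmSol hab hf hpos (right_mem_Icc.2 hab.le)

/-- A radial solution vanishing at `a` is a multiple of `sturmSol`, so the eigenvalues are the zeros
of `lam ↦ sturmSol lam b`. -/
lemma mem_radialSpectrum_iff (hab : a < b) (hf : ContDiffOn ℝ 2 f (Icc a b))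
    (hpos : ∀ x ∈ Icc a b, 0 < f x) (lam : ℂ) :
    lam ∈ radialSpectrum f a b 0 ↔ sturmSol (coeffP f a b) (coeffρ f a b) a lam b = 0 := by
  have hb : b ∈ Icc a b := right_mem_Icc.2 hab.le
  constructor
  · rintro ⟨φ, hφ, hφa, hφb, x, hx, hne⟩
    have key := IsRadialSolution.eqOn_smul_sturmSol hab hf hpos hφ hφa
    have h1 := key hb
    rw [hφb] at h1
    refine (mul_eq_zero.1 h1.symm).resolve_left fun h0 => hne ?_
    rw [key hx, h0]
    exact zero_mul _
  · intro h
    obtain ⟨h1, h2, h3⟩ := isInitialSolution_sturmSol hab hf hpos lam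
    refine ⟨_, h1, h2, h, ?_⟩
    -- a solution vanishing on `[a, b]` would have derivative `0` at `a`
    by_contra! hz
    have ha : a ∈ Icc a b := left_mem_Icc.2 hab.le
    have h4 : d1 a b (sturmSol (coeffP f a b) (coeffρ f a b) a lam) a = 0 := by
      rw [d1, derivWithin_congr (f := fun _ => (0 : ℂ)) (fun x hx => hz x hx) (hz a ha)]
      simp
    rw [h3] at h4
    exact one_ne_zero h4

end

/-! ### Positivity and simplicity of the eigenvalues -/

namespace SturmCoeff

variable {p ρ : ℝ → ℝ} {M a b : ℝ}

lemma continuous_sturmSol (h : SturmCoeff p ρ M) (a : ℝ) (lam : ℂ) :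
    Continuous (sturmSol p ρ a lam) :=
  continuous_iff_continuousAt.2 fun x => (h.hasDerivAt_sturmSol a lam x).continuousAt

lemma continuous_sturmFlux (h : SturmCoeff p ρ M) (a : ℝ) (lam : ℂ) :
    Continuous (sturmFlux p ρ a lam) :=
  continuous_iff_continuousAt.2 fun x => (h.hasDerivAt_sturmFlux a lam x).continuousAt

lemma ofReal_p_ne_zero (h : SturmCoeff p ρ M) (x : ℝ) : (p x : ℂ) ≠ 0 := by
  exact_mod_cast (h.p_pos x).ne'

/-- At a Dirichlet eigenvalue, integration by parts of `(p φ')' φ̄` gives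
`∫ p |φ'|² = lam ∫ ρ |φ|²`. -/
lemma integral_norm_flux_sq (h : SturmCoeff p ρ M) {lam : ℂ} (hb : sturmSol p ρ a lam b = 0) :
    ((∫ x in a..b, ‖sturmFlux p ρ a lam x‖ ^ 2 / p x : ℝ) : ℂ)
      = lam * ((∫ x in a..b, ρ x * ‖sturmSol p ρ a lam x‖ ^ 2 : ℝ) : ℂ) := by
  have hcφ := h.continuous_sturmSol a lam
  have hcη := h.continuous_sturmFlux a lam
  have c1 : Continuous fun x => ((‖sturmFlux p ρ a lam x‖ ^ 2 / p x : ℝ) : ℂ) :=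
    Complex.continuous_ofReal.comp ((hcη.norm.pow 2).div h.cont_p fun x => (h.p_pos x).ne')
  have c2 : Continuous fun x => lam * ((ρ x * ‖sturmSol p ρ a lam x‖ ^ 2 : ℝ) : ℂ) :=
    continuous_const.mul (Complex.continuous_ofReal.comp (h.cont_ρ.mul (hcφ.norm.pow 2)))
  have hd : ∀ x ∈ uIcc a b, HasDerivAt
      (fun x => sturmFlux p ρ a lam x * (starRingEnd ℂ) (sturmSol p ρ a lam x))
      (((‖sturmFlux p ρ a lam x‖ ^ 2 / p x : ℝ) : ℂ)
        - lam * ((ρ x * ‖sturmSol p ρ a lam x‖ ^ 2 : ℝ) : ℂ)) x := by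
    intro x _
    have e1 := (h.hasDerivAt_sturmFlux a lam x).mul (h.hasDerivAt_sturmSol a lam x).star
    refine e1.congr_deriv ?_
    have n1 := Complex.mul_conj' (sturmFlux p ρ a lam x)
    have n2 := Complex.mul_conj' (sturmSol p ρ a lam x)
    change -lam * ρ x * sturmSol p ρ a lam x * (starRingEnd ℂ) (sturmSol p ρ a lam x) +
      sturmFlux p ρ a lam x * (starRingEnd ℂ) (sturmFlux p ρ a lam x / p x) = _
    rw [map_div₀, Complex.conj_ofReal]
    push_cast
    rw [← n1, ← n2]
    ring
  have key := intervalIntegral.integral_eq_sub_of_hasDerivAt hd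
    ((c1.sub c2).intervalIntegrable _ _)
  rw [intervalIntegral.integral_sub (c1.intervalIntegrable _ _) (c2.intervalIntegrable _ _),
    intervalIntegral.integral_const_mul, intervalIntegral.integral_ofReal,
    intervalIntegral.integral_ofReal, hb, sturmSol_left, map_zero, mul_zero, mul_zero,
    sub_zero, sub_eq_zero] at key
  exact key

lemma eigenvalue_pos (h : SturmCoeff p ρ M) (hab : a < b) {lam : ℂ}
    (hb : sturmSol p ρ a lam b = 0) :
    (∃ r : ℝ, 0 < r ∧ lam = r) ∧ (∫ x in a..b, ρ x * ‖sturmSol p ρ a lam x‖ ^ 2) ≠ 0 := by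
  have key := h.integral_norm_flux_sq hb
  have hcφ := h.continuous_sturmSol a lam
  have hcη := h.continuous_sturmFlux a lam
  set I1 := ∫ x in a..b, ‖sturmFlux p ρ a lam x‖ ^ 2 / p x
  set I2 := ∫ x in a..b, ρ x * ‖sturmSol p ρ a lam x‖ ^ 2
  have hI1 : 0 < I1 := by
    refine intervalIntegral.integral_pos hab
      ((hcη.norm.pow 2).div h.cont_p fun x => (h.p_pos x).ne').continuousOn
      (fun x _ => div_nonneg (sq_nonneg _) (h.p_pos x).le) ⟨a, left_mem_Icc.2 hab.le, ?_⟩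
    have h1 := h.p_pos a
    rw [sturmFlux_left]
    have : ‖(p a : ℂ)‖ = p a := by rw [norm_real, Real.norm_of_nonneg h1.le]
    rw [this]
    positivity
  have hI2 : 0 ≤ I2 := intervalIntegral.integral_nonneg hab.le fun x _ =>
    mul_nonneg (h.ρ_pos x).le (sq_nonneg _)
  have hI2' : I2 ≠ 0 := by
    intro h0
    rw [h0, Complex.ofReal_zero, mul_zero] at key
    exact hI1.ne' (by exact_mod_cast key)
  refine ⟨⟨I1 / I2, div_pos hI1 (lt_of_le_of_ne hI2 hI2'.symm), ?_⟩, hI2'⟩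
  have : (I2 : ℂ) ≠ 0 := by exact_mod_cast hI2'
  rw [Complex.ofReal_div, key, mul_div_cancel_right₀ _ this]

/-- The Lagrange identity for the solutions with parameters `lam` and `mu`. -/
lemma wronskian_eq (h : SturmCoeff p ρ M) (a b : ℝ) (lam mu : ℂ) :
    sturmSol p ρ a lam b * sturmFlux p ρ a mu b - sturmFlux p ρ a lam b * sturmSol p ρ a mu b
      = (lam - mu) * ∫ x in a..b, ρ x * sturmSol p ρ a lam x * sturmSol p ρ a mu x := by
  have c1 := h.continuous_sturmSol a lam
  have c2 := h.continuous_sturmSol a mu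
  have c3 : Continuous fun x => (ρ x : ℂ) := Complex.continuous_ofReal.comp h.cont_ρ
  have hd : ∀ x ∈ uIcc a b, HasDerivAt
      (fun x => sturmSol p ρ a lam x * sturmFlux p ρ a mu x
        - sturmFlux p ρ a lam x * sturmSol p ρ a mu x)
      ((lam - mu) * (ρ x * sturmSol p ρ a lam x * sturmSol p ρ a mu x)) x := by
    intro x _
    have e1 := ((h.hasDerivAt_sturmSol a lam x).mul (h.hasDerivAt_sturmFlux a mu x)).sub
      ((h.hasDerivAt_sturmFlux a lam x).mul (h.hasDerivAt_sturmSol a mu x))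
    refine e1.congr_deriv ?_
    have := h.ofReal_p_ne_zero x
    field_simp
    ring
  have key := intervalIntegral.integral_eq_sub_of_hasDerivAt hd
    ((continuous_const.mul ((c3.mul c1).mul c2)).intervalIntegrable _ _)
  rw [intervalIntegral.integral_const_mul] at key
  rw [key]
  simp [sturmSol_left]

/-- The zeros of `lam ↦ φ (lam; b)` are simple, since the Lagrange identity expresses the
derivative at a zero by `∫ ρ φ²`. -/
lemma deriv_sturmSol_ne_zero (h : SturmCoeff p ρ M) (hab : a < b) {mu : ℂ}
    (hb : sturmSol p ρ a mu b = 0) : deriv (fun lam => sturmSol p ρ a lam b) mu ≠ 0 := by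
  obtain ⟨⟨r, hr, hmu⟩, hI⟩ := h.eigenvalue_pos hab hb
  set J : ℂ → ℂ := fun lam => ∫ x in a..b, ρ x * sturmSol p ρ a lam x * sturmSol p ρ a mu x
    with hJ
  have hM := h.M_pos
  have hpa := h.p_pos a
  have hJc : ContinuousAt J mu := by
    set K : ℝ → ℝ := fun t => p a * (M * (b - a)) * Real.exp (√t * (M * (b - a))) with hK
    have hba : 0 < b - a := sub_pos.2 hab
    have hbound : ∀ (lam : ℂ) (t : ℝ), ‖lam‖ ≤ t → ∀ x ∈ uIoc a b,
        ‖sturmSol p ρ a lam x‖ ≤ K t := by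
      intro lam t ht x hx
      rw [uIoc_of_le hab.le] at hx
      refine (h.norm_sturmSol_le lam (R := b - a) ?_).trans ?_
      · rw [abs_of_pos (sub_pos.2 hx.1)]
        linarith [hx.2]
      · simp only [hK]
        gcongr
    refine intervalIntegral.continuousAt_of_dominated_interval
      (bound := fun _ => M * K (‖mu‖ + 1) * K (‖mu‖)) ?_ ?_ (by simp) ?_
    · refine Eventually.of_forall fun lam => Continuous.aestronglyMeasurable ?_
      exact ((Complex.continuous_ofReal.comp h.cont_ρ).mul (h.continuous_sturmSol a lam)).mul
        (h.continuous_sturmSol a mu)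
    · filter_upwards [Metric.ball_mem_nhds mu one_pos] with lam hlam
      refine Eventually.of_forall fun x hx => ?_
      have h1 : ‖lam‖ ≤ ‖mu‖ + 1 := by
        rw [mem_ball_iff_norm] at hlam
        have := norm_add_le (lam - mu) mu
        rw [sub_add_cancel] at this
        linarith
      rw [norm_mul, norm_mul, norm_real, Real.norm_of_nonneg (h.ρ_pos x).le]
      have e1 := hbound lam _ h1 x hx
      have e2 := hbound mu _ le_rfl x hx
      exact mul_le_mul (mul_le_mul (h.ρ_le x) e1 (norm_nonneg _) hM.le) e2 (norm_nonneg _)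
        (mul_nonneg hM.le ((norm_nonneg _).trans e1))
    · refine Eventually.of_forall fun x _ => ?_
      exact (continuousAt_const.mul
        (h.differentiable_sturmSol_param a x mu).continuousAt).mul continuousAt_const
  have hJne : J mu ≠ 0 := by
    have : J mu = ((∫ x in a..b, ρ x * ‖sturmSol p ρ a mu x‖ ^ 2 : ℝ) : ℂ) := by
      rw [← intervalIntegral.integral_ofReal]
      refine intervalIntegral.integral_congr fun x _ => ?_
      have him : (sturmSol p ρ a mu x).im = 0 := by rw [hmu]; exact im_sturmSol_ofReal _ _ _ _ _
      have hre : (starRingEnd ℂ) (sturmSol p ρ a mu x) = sturmSol p ρ a mu x :=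
        Complex.conj_eq_iff_im.2 him
      have n2 := Complex.mul_conj' (sturmSol p ρ a mu x)
      rw [hre] at n2
      push_cast
      rw [← n2]
      ring
    rw [this]
    exact_mod_cast hI
  have hW : (fun lam => sturmSol p ρ a lam b * sturmFlux p ρ a mu b)
      = fun lam => (lam - mu) * J lam := by
    ext lam
    have := h.wronskian_eq a b lam mu
    rw [hb, mul_zero, sub_zero] at this
    exact this
  have hder : HasDerivAt (fun lam => (lam - mu) * J lam) (J mu) mu := by
    rw [hasDerivAt_iff_tendsto_slope]
    refine (hJc.tendsto.mono_left nhdsWithin_le_nhds).congr' ?_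
    filter_upwards [self_mem_nhdsWithin] with lam hlam
    have : lam - mu ≠ 0 := sub_ne_zero.2 hlam
    rw [slope_def_field]
    field_simp
    ring
  intro h0
  have h1 := ((h.differentiable_sturmSol_param a b mu).hasDerivAt).mul_const
    (sturmFlux p ρ a mu b)
  rw [hW, h0, zero_mul] at h1
  exact hJne (hder.unique h1)

end SturmCoeff

/-! ### Large-parameter asymptotics in Liouville normal form -/

/-- If `‖F'‖ ≤ B'` on `[a, b]` and `‖F a‖ ≤ B a`, then `‖F‖ ≤ B`. -/
lemma norm_le_of_norm_derivWithin_le {a b : ℝ} {F F' : ℝ → ℂ} {B B' : ℝ → ℝ}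
    (hF : ∀ x ∈ Icc a b, HasDerivWithinAt F (F' x) (Icc a b) x)
    (hB : ∀ x ∈ Icc a b, HasDerivWithinAt B (B' x) (Icc a b) x)
    (ha : ‖F a‖ ≤ B a) (hle : ∀ x ∈ Icc a b, ‖F' x‖ ≤ B' x) :
    ∀ x ∈ Icc a b, ‖F x‖ ≤ B x := by
  intro x hx
  exact image_norm_le_of_norm_deriv_right_le_deriv_boundary'
    (fun x hx => (hF x hx).continuousWithinAt)
    (fun x hx => (hF x (Ico_subset_Icc_self hx)).mono_of_mem_nhdsWithin (Icc_mem_nhdsGE_of_mem hx))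
    ha (fun x hx => (hB x hx).continuousWithinAt)
    (fun x hx => (hB x (Ico_subset_Icc_self hx)).mono_of_mem_nhdsWithin (Icc_mem_nhdsGE_of_mem hx))
    (fun x hx => hle x (Ico_subset_Icc_self hx)) hx

/-- Large-`κ` asymptotics for the system `u' = w v`, `v' = (κ² w + q) u` with `u a = 0`,
`v a = c`. Here `S` and `R` are primitives of `w` and `q`, and `w ≥ 1`. The functions
`U = e^{-κS} (v + κu)` and `Y = e^{-κS} (v - κu)` satisfy `U - Y = 2κ e^{-κS} u`; the first is
nearly constant and the second nearly `c e^{-2κS}`. -/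
lemma norm_sub_le_of_liouville_system {a b : ℝ} (hab : a < b) {S R w q : ℝ → ℝ} {u v : ℝ → ℂ}
    {c : ℂ} {m κ : ℝ}
    (hS : ∀ x ∈ Icc a b, HasDerivWithinAt S (w x) (Icc a b) x) (hSa : S a = 0)
    (hR : ∀ x ∈ Icc a b, HasDerivWithinAt R (q x) (Icc a b) x) (hRa : R a = 0)
    (hw : ∀ x ∈ Icc a b, 1 ≤ w x) (hq : ∀ x ∈ Icc a b, |q x| ≤ m)
    (hu : ∀ x ∈ Icc a b, HasDerivWithinAt u (w x * v x) (Icc a b) x)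
    (hv : ∀ x ∈ Icc a b, HasDerivWithinAt v ((κ ^ 2 * w x + q x) * u x) (Icc a b) x)
    (hua : u a = 0) (hva : v a = c) (hκ1 : 1 ≤ κ) (hκ : m * (b - a + 1) ≤ κ) :
    ‖2 * κ * Real.exp (-(κ * S b)) * u b - c * (1 + R b / (2 * κ))‖
      ≤ ‖c‖ * ((m / 2) * (1 / 2 + m * (2 * (b - a) + 1) * (b - a)) + m + 1 / (b - a) ^ 2) / κ ^ 2
      := by
  have haI : a ∈ Icc a b := left_mem_Icc.2 hab.le
  have hbI : b ∈ Icc a b := right_mem_Icc.2 hab.le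
  set T := b - a with hT
  have hT0 : 0 < T := sub_pos.2 hab
  have hm : 0 ≤ m := (abs_nonneg _).trans (hq a haI)
  have hκ0 : 0 < κ := by linarith
  have hκc : (κ : ℂ) ≠ 0 := by exact_mod_cast hκ0.ne'
  have hSx : ∀ x ∈ Icc a b, x - a ≤ S x := by
    intro x hx
    have hmono : MonotoneOn (fun x => S x - x) (Icc a b) := by
      refine monotoneOn_of_hasDerivWithinAt_nonneg (f' := fun x => w x - 1) (convex_Icc a b) ?_ ?_ ?_
      · exact ContinuousOn.sub (fun x hx => (hS x hx).continuousWithinAt) continuousOn_id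
      · intro y hy
        exact ((hS y (interior_subset hy)).sub (hasDerivWithinAt_id _ _)).mono interior_subset
      · intro y hy
        exact sub_nonneg.2 (hw y (interior_subset hy))
    have := hmono haI hx hx.1
    simp only [hSa] at this
    linarith
  set W : ℝ → ℂ := fun x => 2 * κ * Real.exp (-(κ * S x)) * u x with hW
  set U : ℝ → ℂ := fun x => Real.exp (-(κ * S x)) * (v x + κ * u x) with hU
  set V : ℝ → ℂ := fun x => Real.exp (κ * S x) * (v x - κ * u x) with hV
  have hexp1 : ∀ x ∈ Icc a b, HasDerivWithinAt (fun x => (Real.exp (-(κ * S x)) : ℂ))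
      (((Real.exp (-(κ * S x)) * -(κ * w x) : ℝ)) : ℂ) (Icc a b) x := fun x hx =>
    (((hS x hx).const_mul κ).neg.exp).ofReal_comp
  have hexp2 : ∀ x ∈ Icc a b, HasDerivWithinAt (fun x => (Real.exp (κ * S x) : ℂ))
      (((Real.exp (κ * S x) * (κ * w x) : ℝ)) : ℂ) (Icc a b) x := fun x hx =>
    (((hS x hx).const_mul κ).exp).ofReal_comp
  have hUd : ∀ x ∈ Icc a b, HasDerivWithinAt U ((q x / (2 * κ)) * W x) (Icc a b) x := by
    intro x hx
    refine ((hexp1 x hx).mul ((hv x hx).add ((hu x hx).const_mul (κ : ℂ)))).congr_deriv ?_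
    simp only [hW]
    push_cast
    field_simp
    simp only [Pi.add_apply]
    ring
  have hVd : ∀ x ∈ Icc a b, HasDerivWithinAt V
      (Real.exp (2 * κ * S x) * ((q x / (2 * κ)) * W x)) (Icc a b) x := by
    intro x hx
    refine ((hexp2 x hx).mul ((hv x hx).sub ((hu x hx).const_mul (κ : ℂ)))).congr_deriv ?_
    have e1 : (Real.exp (2 * κ * S x) : ℂ) * Real.exp (-(κ * S x)) = Real.exp (κ * S x) := by
      rw [← Complex.ofReal_mul, ← Real.exp_add]
      ring_nf
    have e2 : (Real.exp (2 * κ * S x) : ℂ) * ((q x / (2 * κ)) * W x)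
        = Real.exp (κ * S x) * (q x * u x) := by
      rw [← e1]
      simp only [hW]
      field_simp
    rw [e2]
    push_cast
    simp only [Pi.sub_apply]
    ring
  have hWUV : ∀ x, W x = U x - Real.exp (-(2 * κ * S x)) * V x := by
    intro x
    have e1 : (Real.exp (-(2 * κ * S x)) : ℂ) * Real.exp (κ * S x) = Real.exp (-(κ * S x)) := by
      rw [← Complex.ofReal_mul, ← Real.exp_add]
      ring_nf
    simp only [hW, hU, hV]
    linear_combination (v x - κ * u x) * e1
  have hUa : U a = c := by simp [hU, hSa, hua, hva]
  have hVa : V a = c := by simp [hV, hSa, hua, hva]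
  have hucont : ContinuousOn u (Icc a b) := fun x hx => (hu x hx).continuousWithinAt
  have hWcont : ContinuousOn W (Icc a b) := by
    refine ContinuousOn.mul (ContinuousOn.mul continuousOn_const ?_) hucont
    exact fun x hx => (hexp1 x hx).continuousWithinAt
  obtain ⟨z, hz, hzmax⟩ := isCompact_Icc.exists_isMaxOn ⟨a, haI⟩ hWcont.norm
  set N := ‖W z‖ with hN
  have hWN : ∀ x ∈ Icc a b, ‖W x‖ ≤ N := fun x hx => hzmax hx
  have hN0 : 0 ≤ N := norm_nonneg _
  have hqW : ∀ x ∈ Icc a b, ‖(q x / (2 * κ) : ℂ) * W x‖ ≤ m / (2 * κ) * N := by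
    intro x hx
    have e1 : ‖(q x / (2 * κ) : ℂ)‖ = |q x| / (2 * κ) := by
      rw [norm_div, norm_real, Real.norm_eq_abs, norm_mul, norm_real, Real.norm_of_nonneg hκ0.le]
      simp
    rw [norm_mul, e1]
    gcongr
    · exact hq x hx
    · exact hWN x hx
  have hUc : ∀ x ∈ Icc a b, ‖U x - c‖ ≤ m / (2 * κ) * N * T := by
    intro x hx
    have := (convex_Icc a b).norm_image_sub_le_of_norm_hasDerivWithin_le hUd hqW haI hx
    rw [hUa, Real.norm_of_nonneg (sub_nonneg.2 hx.1)] at this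
    refine this.trans ?_
    gcongr
    linarith [hx.2]
  have hYc : ∀ x ∈ Icc a b, ‖(Real.exp (-(2 * κ * S x)) : ℂ) * (V x - c)‖
      ≤ m * N / (4 * κ ^ 2) := by
    intro x hx
    have key := norm_le_of_norm_derivWithin_le (F := fun x => V x - c)
      (B := fun x => m * N / (4 * κ ^ 2) * (Real.exp (2 * κ * S x) - 1))
      (fun x hx => (hVd x hx).sub_const c)
      (fun x hx => ((((hS x hx).const_mul (2 * κ)).exp).sub_const 1).const_mul _)
      (by simp [hVa, hSa]) (fun x hx => by
        rw [norm_mul, norm_real, Real.norm_of_nonneg (Real.exp_pos _).le]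
        calc Real.exp (2 * κ * S x) * ‖(q x / (2 * κ) : ℂ) * W x‖
            ≤ Real.exp (2 * κ * S x) * (m / (2 * κ) * N) := by gcongr; exact hqW x hx
          _ ≤ Real.exp (2 * κ * S x) * (m / (2 * κ) * N) * w x :=
            le_mul_of_one_le_right (by positivity) (hw x hx)
          _ = _ := by field_simp; ring) x hx
    rw [norm_mul, norm_real, Real.norm_of_nonneg (Real.exp_pos _).le]
    calc Real.exp (-(2 * κ * S x)) * ‖V x - c‖
        ≤ Real.exp (-(2 * κ * S x)) * (m * N / (4 * κ ^ 2) * Real.exp (2 * κ * S x)) := by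
          gcongr
          refine key.trans ?_
          gcongr
          linarith
      _ = m * N / (4 * κ ^ 2) * (Real.exp (-(2 * κ * S x)) * Real.exp (2 * κ * S x)) := by ring
      _ = _ := by rw [← Real.exp_add, neg_add_cancel, Real.exp_zero, mul_one]
  have hexple : ∀ x ∈ Icc a b, Real.exp (-(2 * κ * S x)) ≤ Real.exp (-(2 * κ * (x - a))) := by
    intro x hx
    have := hSx x hx
    gcongr
  have hWc : ∀ x ∈ Icc a b, ‖W x - c‖
      ≤ m / (2 * κ) * N * T + m * N / (4 * κ ^ 2) + ‖c‖ * Real.exp (-(2 * κ * (x - a))) := by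
    intro x hx
    have e1 : W x - c = (U x - c) - (Real.exp (-(2 * κ * S x)) : ℂ) * (V x - c)
        - c * Real.exp (-(2 * κ * S x)) := by
      rw [hWUV]
      ring
    rw [e1]
    refine (norm_sub_le _ _).trans (add_le_add ((norm_sub_le _ _).trans
      (add_le_add (hUc x hx) (hYc x hx))) ?_)
    rw [norm_mul, norm_real, Real.norm_of_nonneg (Real.exp_pos _).le]
    gcongr
    exact hSx x hx
  have hκκ : κ ≤ κ ^ 2 := by nlinarith
  -- the maximum of `‖W‖` is absorbed on the left for large `κ`
  have hN4 : N ≤ 4 * ‖c‖ := by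
    have e1 : N ≤ ‖W z - c‖ + ‖c‖ := by
      have := norm_add_le (W z - c) c
      rwa [sub_add_cancel] at this
    have e2 := hWc z hz
    have e3 : Real.exp (-(2 * κ * (z - a))) ≤ 1 := by
      refine Real.exp_le_one_iff.2 (neg_nonpos.2 ?_)
      have := sub_nonneg.2 hz.1
      positivity
    have e4 : m / (2 * κ) * N * T + m * N / (4 * κ ^ 2) ≤ N / 2 := by
      have e5 : m * N / (4 * κ ^ 2) ≤ m * N / (2 * κ) := by
        gcongr
        linarith
      calc m / (2 * κ) * N * T + m * N / (4 * κ ^ 2)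
          ≤ m / (2 * κ) * N * T + m * N / (2 * κ) := by linarith
        _ = (m * (T + 1)) / κ * (N / 2) := by field_simp
        _ ≤ 1 * (N / 2) := by
          gcongr
          exact (div_le_one hκ0).2 hκ
        _ = _ := one_mul _
    have e6 : ‖c‖ * Real.exp (-(2 * κ * (z - a))) ≤ ‖c‖ :=
      mul_le_of_le_one_right (norm_nonneg _) e3
    linarith
  have hWc2 : ∀ x ∈ Icc a b, ‖W x - c‖
      ≤ ‖c‖ * (Real.exp (-(2 * κ * (x - a))) + m * (2 * T + 1) / κ) := by
    intro x hx
    refine (hWc x hx).trans ?_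
    have e1 : m / (2 * κ) * N * T ≤ m / (2 * κ) * (4 * ‖c‖) * T := by gcongr
    have e2 : m * N / (4 * κ ^ 2) ≤ m * (4 * ‖c‖) / (4 * κ) := by gcongr
    calc _ ≤ m / (2 * κ) * (4 * ‖c‖) * T + m * (4 * ‖c‖) / (4 * κ)
          + ‖c‖ * Real.exp (-(2 * κ * (x - a))) := by linarith
      _ = _ := by field_simp; ring
  have hUb := norm_le_of_norm_derivWithin_le
    (F := fun x => U x - c - c * (R x / (2 * κ) : ℝ))
    (B := fun x => m / (2 * κ) * ‖c‖ * ((1 - Real.exp (-(2 * κ * (x - a)))) / (2 * κ)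
      + m * (2 * T + 1) / κ * (x - a)))
    (B' := fun x => m / (2 * κ) * ‖c‖ * (Real.exp (-(2 * κ * (x - a))) + m * (2 * T + 1) / κ))
    (F' := fun x => (q x / (2 * κ)) * W x - c * (q x / (2 * κ) : ℝ))
    (fun x hx => ((hUd x hx).sub_const c).sub
      ((((hR x hx).div_const (2 * κ)).ofReal_comp).const_mul c))
    (fun x hx => by
      have e1 : HasDerivAt (fun x : ℝ => x - a) 1 x := (hasDerivAt_id x).sub_const a
      have e2 := (((e1.const_mul (2 * κ)).neg.exp).const_sub 1).div_const (2 * κ)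
      have e3 := (e2.add (e1.const_mul (m * (2 * T + 1) / κ))).const_mul (m / (2 * κ) * ‖c‖)
      refine (e3.congr_deriv ?_).hasDerivWithinAt
      simp only [Pi.neg_apply]
      field_simp)
    (by simp [hUa, hRa]) (fun x hx => by
      have e1 : (q x / (2 * κ) : ℂ) * W x - c * (q x / (2 * κ) : ℝ)
          = ((q x / (2 * κ) : ℝ) : ℂ) * (W x - c) := by
        push_cast
        ring
      rw [e1, norm_mul, norm_real, Real.norm_eq_abs, abs_div, abs_of_pos (by positivity : 0 < 2 * κ),
        mul_assoc]
      exact mul_le_mul (by gcongr; exact hq x hx) (hWc2 x hx) (norm_nonneg _) (by positivity)) b hbI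
  have hfin : W b - c * (1 + R b / (2 * κ))
      = (U b - c - c * (R b / (2 * κ) : ℝ)) - (Real.exp (-(2 * κ * S b)) : ℂ) * (V b - c)
        - c * Real.exp (-(2 * κ * S b)) := by
    rw [hWUV]
    push_cast
    ring
  change ‖W b - c * (1 + R b / (2 * κ))‖ ≤ _
  rw [hfin]
  have f1 : m / (2 * κ) * ‖c‖ * ((1 - Real.exp (-(2 * κ * (b - a)))) / (2 * κ)
      + m * (2 * T + 1) / κ * (b - a))
      ≤ m / (2 * κ) * ‖c‖ * (1 / (2 * κ) + m * (2 * T + 1) / κ * T) := by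
    rw [← hT]
    gcongr
    have := Real.exp_pos (-(2 * κ * T))
    linarith
  have f2 : m * N / (4 * κ ^ 2) ≤ m * (4 * ‖c‖) / (4 * κ ^ 2) := by gcongr
  have f3 : ‖c * (Real.exp (-(2 * κ * S b)) : ℂ)‖ ≤ ‖c‖ * (1 / (κ * T) ^ 2) := by
    rw [norm_mul, norm_real, Real.norm_of_nonneg (Real.exp_pos _).le]
    gcongr
    refine (hexple b hbI).trans ?_
    rw [← hT, Real.exp_neg, one_div]
    refine inv_anti₀ (by positivity) ?_
    have e1 : κ * T ≤ Real.exp (κ * T) := by linarith [Real.add_one_le_exp (κ * T)]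
    calc (κ * T) ^ 2 ≤ Real.exp (κ * T) ^ 2 := by gcongr
      _ = Real.exp (2 * κ * T) := by rw [← Real.exp_nat_mul]; push_cast; ring_nf
  refine (norm_sub_le _ _).trans ((add_le_add ((norm_sub_le _ _).trans
    (add_le_add (hUb.trans f1) ((hYc b hbI).trans f2))) f3).trans (le_of_eq ?_))
  field_simp

/-! ### Asymptotics of the initial solution -/

/-- The potential `(√f)'' / √f` of the Liouville normal form, derivatives being taken with respect
to arc length, multiplied by the arc length density. -/
noncomputable def potentialDensity (f : ℝ → ℝ) (a b x : ℝ) : ℝ :=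
  d2 a b f x / (2 * f x * speed f a b x ^ 3) - d1 a b f x ^ 2 / (4 * f x ^ 2 * speed f a b x)

section

variable {f : ℝ → ℝ} {a b : ℝ}

lemma continuousOn_potentialDensity (hab : a < b) (hf : ContDiffOn ℝ 2 f (Icc a b))
    (hpos : ∀ x ∈ Icc a b, 0 < f x) : ContinuousOn (potentialDensity f a b) (Icc a b) := by
  obtain ⟨-, hd2, hd3⟩ := hasDerivWithinAt_d1_d2 hab hf
  have hd1c : ContinuousOn (d1 a b f) (Icc a b) := fun x hx => (hd2 x hx).continuousWithinAt
  have hfc := hf.continuousOn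
  have hw := continuousOn_speed hab hf
  refine ContinuousOn.sub (hd3.div (by fun_prop) fun x hx => ?_)
    (ContinuousOn.div (by fun_prop) (by fun_prop) fun x hx => ?_)
  · have := hpos x hx
    have := speed_pos f a b x
    positivity
  · have := hpos x hx
    have := speed_pos f a b x
    positivity

/-- A continuous function on `[a, b]` has `x ↦ ∫ₐˣ` as a primitive, the integrand being continued
by constants. -/
lemma hasDerivWithinAt_integral_clamp (hab : a < b) {q : ℝ → ℝ} (hq : ContinuousOn q (Icc a b)) :
    (∀ x ∈ Icc a b, HasDerivWithinAt (fun x => ∫ t in a..x, q (clamp a b t)) (q x) (Icc a b) x) ∧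
    ∫ t in a..b, q (clamp a b t) = ∫ t in a..b, q t := by
  have hclamp : Continuous (clamp a b) := by unfold clamp; fun_prop
  have hc : Continuous fun x => q (clamp a b x) := hq.comp_continuous hclamp (clamp_mem hab)
  refine ⟨fun x hx => ?_, intervalIntegral.integral_congr fun x hx => ?_⟩
  · have := (hc.integral_hasStrictDerivAt a x).hasDerivAt.hasDerivWithinAt (s := Icc a b)
    rwa [clamp_of_mem hx] at this
  · rw [uIcc_of_le hab.le] at hx
    simp only [clamp_of_mem hx]

lemma hasDerivWithinAt_sqrt (hab : a < b) (hf : ContDiffOn ℝ 2 f (Icc a b))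
    (hpos : ∀ x ∈ Icc a b, 0 < f x) {x : ℝ} (hx : x ∈ Icc a b) :
    HasDerivWithinAt (fun x => √(f x)) (d1 a b f x / (2 * √(f x))) (Icc a b) x :=
  ((hasDerivWithinAt_d1_d2 hab hf).1 x hx).sqrt (hpos x hx).ne'

/-- The second arc length derivative of `√f` is the potential times `√f`. -/
lemma hasDerivWithinAt_sqrt_arcLength_deriv (hab : a < b) (hf : ContDiffOn ℝ 2 f (Icc a b))
    (hpos : ∀ x ∈ Icc a b, 0 < f x) {x : ℝ} (hx : x ∈ Icc a b) :
    HasDerivWithinAt (fun x => d1 a b f x / (2 * √(f x) * speed f a b x))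
      (potentialDensity f a b x * √(f x)) (Icc a b) x := by
  have hw := speed_pos f a b x
  have hr : 0 < √(f x) := Real.sqrt_pos.2 (hpos x hx)
  have hr2 : f x = √(f x) ^ 2 := (Real.sq_sqrt (hpos x hx).le).symm
  have e1 := ((hasDerivWithinAt_d1_d2 hab hf).2.1 x hx).div
    (((hasDerivWithinAt_sqrt hab hf hpos hx).const_mul 2).mul (hasDerivWithinAt_speed hab hf hx))
    (mul_pos (mul_pos two_pos hr) hw).ne'
  refine e1.congr_deriv ?_
  have hw2 := speed_sq f a b x
  simp only [potentialDensity, Pi.mul_apply]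
  rw [hr2]
  simp only [Real.sqrt_sq hr.le]
  generalize speed f a b x = w at *
  generalize √(f x) = r at *
  generalize d1 a b f x = f1 at *
  generalize d2 a b f x = f2 at *
  field_simp
  linear_combination (8 * f2 * r ^ 2) * hw2

/-- Asymptotics of the initial solution at `b` for `lam = -κ²`, `κ → ∞`, from the Liouville normal
form. -/
lemma exists_norm_sturmSol_sub_le (hab : a < b) (hf : ContDiffOn ℝ 2 f (Icc a b))
    (hpos : ∀ x ∈ Icc a b, 0 < f x) :
    ∃ C κ₀ : ℝ, ∀ κ : ℝ, κ₀ ≤ κ →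
      ‖2 * κ * Real.exp (-(κ * ∫ x in a..b, speed f a b x)) *
          (√(f b) * sturmSol (coeffP f a b) (coeffρ f a b) a (-(κ : ℂ) ^ 2) b)
        - ((coeffP f a b a / √(f a) : ℝ) : ℂ) *
          (1 + ((∫ x in a..b, potentialDensity f a b x : ℝ) : ℂ) / (2 * κ))‖ ≤ C / κ ^ 2 := by
  obtain ⟨M, h⟩ := exists_sturmCoeff hab hf hpos
  set p := coeffP f a b with hp
  set ρ := coeffρ f a b with hρ
  obtain ⟨hS, hSb⟩ := hasDerivWithinAt_integral_clamp hab (continuousOn_speed hab hf)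
  have hqc := continuousOn_potentialDensity hab hf hpos
  obtain ⟨hR, hRb⟩ := hasDerivWithinAt_integral_clamp hab hqc
  obtain ⟨m, hm⟩ := isCompact_Icc.exists_bound_of_continuousOn hqc
  refine ⟨‖((p a / √(f a) : ℝ) : ℂ)‖ *
    ((m / 2) * (1 / 2 + m * (2 * (b - a) + 1) * (b - a)) + m + 1 / (b - a) ^ 2),
    max 1 (m * (b - a + 1)), fun κ hκ => ?_⟩
  have key := norm_sub_le_of_liouville_system hab (κ := κ) (m := m)
    (u := fun x => √(f x) * sturmSol p ρ a (-(κ : ℂ) ^ 2) x)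
    (v := fun x => (d1 a b f x / (2 * √(f x) * speed f a b x) : ℝ) *
      sturmSol p ρ a (-(κ : ℂ) ^ 2) x + sturmFlux p ρ a (-(κ : ℂ) ^ 2) x / √(f x))
    (c := ((p a / √(f a) : ℝ) : ℂ))
    hS intervalIntegral.integral_same hR intervalIntegral.integral_same
    (fun x _ => one_le_speed f a b x) (fun x hx => hm x hx) (fun x hx => ?_) (fun x hx => ?_)
    (by simp [SturmCoeff.sturmSol_left])
    (by simp [SturmCoeff.sturmSol_left, SturmCoeff.sturmFlux_left])
    ((le_max_left _ _).trans hκ) ((le_max_right _ _).trans hκ)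
  · rw [hSb, hRb] at key
    exact key
  · have hw := speed_pos f a b x
    have hr : 0 < √(f x) := Real.sqrt_pos.2 (hpos x hx)
    have hr2 : f x = √(f x) ^ 2 := (Real.sq_sqrt (hpos x hx).le).symm
    have hwc : (speed f a b x : ℂ) ≠ 0 := by exact_mod_cast hw.ne'
    have hrc : (√(f x) : ℂ) ≠ 0 := by exact_mod_cast hr.ne'
    have hpx : (p x : ℂ) = (√(f x) : ℂ) ^ 2 / speed f a b x := by
      rw [hp, coeffP_of_mem hx]
      nth_rewrite 1 [hr2]
      push_cast
      rfl
    have e1 := (hasDerivWithinAt_sqrt hab hf hpos hx).ofReal_comp.mul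
      (h.hasDerivAt_sturmSol a (-(κ : ℂ) ^ 2) x).hasDerivWithinAt
    refine e1.congr_deriv ?_
    rw [hpx]
    push_cast
    field_simp
  · have hw := speed_pos f a b x
    have hr : 0 < √(f x) := Real.sqrt_pos.2 (hpos x hx)
    have hr2 : f x = √(f x) ^ 2 := (Real.sq_sqrt (hpos x hx).le).symm
    have hwc : (speed f a b x : ℂ) ≠ 0 := by exact_mod_cast hw.ne'
    have hrc : (√(f x) : ℂ) ≠ 0 := by exact_mod_cast hr.ne'
    have hpx : (p x : ℂ) = (√(f x) : ℂ) ^ 2 / speed f a b x := by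
      rw [hp, coeffP_of_mem hx]
      nth_rewrite 1 [hr2]
      push_cast
      rfl
    have hρx : (ρ x : ℂ) = (√(f x) : ℂ) ^ 2 * speed f a b x := by
      rw [hρ, coeffρ_of_mem hx]
      nth_rewrite 1 [hr2]
      push_cast
      rfl
    have e1 := ((hasDerivWithinAt_sqrt_arcLength_deriv hab hf hpos hx).ofReal_comp.mul
      (h.hasDerivAt_sturmSol a (-(κ : ℂ) ^ 2) x).hasDerivWithinAt).add
      ((h.hasDerivAt_sturmFlux a (-(κ : ℂ) ^ 2) x).hasDerivWithinAt.div
        (hasDerivWithinAt_sqrt hab hf hpos hx).ofReal_comp hrc)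
    refine e1.congr_deriv ?_
    rw [hpx, hρx]
    push_cast
    field_simp
    ring

end

/-! ### The characteristic function on the negative axis -/

lemma isBigO_log_one_add_sub : (fun z : ℝ => Real.log (1 + z) - z) =O[𝓝 0] fun z => z ^ 2 := by
  refine Asymptotics.IsBigO.of_bound 2 ?_
  filter_upwards [Metric.ball_mem_nhds (0 : ℝ) (show (0 : ℝ) < 1 / 2 by norm_num)] with z hz
  rw [mem_ball_zero_iff, Real.norm_eq_abs, abs_lt] at hz
  have h0 : 0 < 1 + z := by linarith
  have h1 := Real.log_le_sub_one_of_pos h0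
  have h2 := Real.one_sub_inv_le_log_of_pos h0
  have h3 : 1 - (1 + z)⁻¹ = z - z ^ 2 / (1 + z) := by
    field_simp
    ring
  have h4 : z ^ 2 / (1 + z) ≤ 2 * z ^ 2 := by
    rw [div_le_iff₀ h0]
    nlinarith [sq_nonneg z]
  rw [Real.norm_eq_abs, Real.norm_of_nonneg (sq_nonneg z), abs_le]
  constructor
  · linarith
  · nlinarith [sq_nonneg z]

section

variable {f : ℝ → ℝ} {a b : ℝ}

lemma constA_pos_and_sturmSol_zero (hab : a < b) (hf : ContDiffOn ℝ 2 f (Icc a b))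
    (hpos : ∀ x ∈ Icc a b, 0 < f x) :
    0 < constA f a b ∧ sturmSol (coeffP f a b) (coeffρ f a b) a 0 b
      = ((coeffP f a b a * constA f a b : ℝ) : ℂ) := by
  have hA : constA f a b = ∫ t in a..b, 1 / coeffP f a b t := by
    refine intervalIntegral.integral_congr fun x hx => ?_
    rw [uIcc_of_le hab.le] at hx
    simp only [coeffP_of_mem hx, one_div_div, speed]
  refine ⟨?_, by rw [SturmCoeff.sturmSol_zero, hA]⟩
  obtain ⟨M, h⟩ := exists_sturmCoeff hab hf hpos
  rw [hA]
  exact intervalIntegral.intervalIntegral_pos_of_pos_on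
    ((continuous_const.div h.cont_p fun x => (h.p_pos x).ne').intervalIntegrable _ _)
    (fun x _ => one_div_pos.2 (h.p_pos x)) hab

lemma charFun_eq (hab : a < b) (hf : ContDiffOn ℝ 2 f (Icc a b))
    (hpos : ∀ x ∈ Icc a b, 0 < f x) (lam : ℂ) :
    charFun f a b 0 lam = sturmSol (coeffP f a b) (coeffρ f a b) a lam b /
      ((coeffP f a b a * constA f a b : ℝ) : ℂ) := by
  rw [charFun, phi_right hab hf hpos, phi_right hab hf hpos,
    (constA_pos_and_sturmSol_zero hab hf hpos).2]

lemma coeffP_mul_constA_pos (hab : a < b) (hf : ContDiffOn ℝ 2 f (Icc a b))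
    (hpos : ∀ x ∈ Icc a b, 0 < f x) : 0 < coeffP f a b a * constA f a b := by
  obtain ⟨M, h⟩ := exists_sturmCoeff hab hf hpos
  exact mul_pos (h.p_pos a) (constA_pos_and_sturmSol_zero hab hf hpos).1

lemma charFun_eq_zero_iff (hab : a < b) (hf : ContDiffOn ℝ 2 f (Icc a b))
    (hpos : ∀ x ∈ Icc a b, 0 < f x) (lam : ℂ) :
    charFun f a b 0 lam = 0 ↔ sturmSol (coeffP f a b) (coeffρ f a b) a lam b = 0 := by
  have : ((coeffP f a b a * constA f a b : ℝ) : ℂ) ≠ 0 := by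
    exact_mod_cast (coeffP_mul_constA_pos hab hf hpos).ne'
  rw [charFun_eq hab hf hpos, div_eq_zero_iff, or_iff_left this]

lemma radialSpectrum_eq (hab : a < b) (hf : ContDiffOn ℝ 2 f (Icc a b))
    (hpos : ∀ x ∈ Icc a b, 0 < f x) :
    radialSpectrum f a b 0 = {lam | charFun f a b 0 lam = 0} := by
  ext lam
  rw [mem_radialSpectrum_iff hab hf hpos, mem_ofPred_eq, charFun_eq_zero_iff hab hf hpos]

lemma radialSpectrum_pos (hab : a < b) (hf : ContDiffOn ℝ 2 f (Icc a b))
    (hpos : ∀ x ∈ Icc a b, 0 < f x) :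
    ∀ lam ∈ radialSpectrum f a b 0, ∃ r : ℝ, 0 < r ∧ lam = (r : ℂ) := by
  intro lam hlam
  obtain ⟨M, h⟩ := exists_sturmCoeff hab hf hpos
  exact (h.eigenvalue_pos hab ((mem_radialSpectrum_iff hab hf hpos lam).1 hlam)).1

lemma differentiable_charFun (hab : a < b) (hf : ContDiffOn ℝ 2 f (Icc a b))
    (hpos : ∀ x ∈ Icc a b, 0 < f x) : Differentiable ℂ (charFun f a b 0) := by
  obtain ⟨M, h⟩ := exists_sturmCoeff hab hf hpos
  rw [show charFun f a b 0 = _ from funext (charFun_eq hab hf hpos)]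
  exact (h.differentiable_sturmSol_param a b).div_const _

lemma charFun_zero (hab : a < b) (hf : ContDiffOn ℝ 2 f (Icc a b))
    (hpos : ∀ x ∈ Icc a b, 0 < f x) : charFun f a b 0 0 = 1 := by
  have : ((coeffP f a b a * constA f a b : ℝ) : ℂ) ≠ 0 := by
    exact_mod_cast (coeffP_mul_constA_pos hab hf hpos).ne'
  rw [charFun_eq hab hf hpos, (constA_pos_and_sturmSol_zero hab hf hpos).2, div_self this]

lemma deriv_charFun_ne_zero (hab : a < b) (hf : ContDiffOn ℝ 2 f (Icc a b))
    (hpos : ∀ x ∈ Icc a b, 0 < f x) {lam : ℂ} (hlam : charFun f a b 0 lam = 0) :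
    deriv (charFun f a b 0) lam ≠ 0 := by
  obtain ⟨M, h⟩ := exists_sturmCoeff hab hf hpos
  have : ((coeffP f a b a * constA f a b : ℝ) : ℂ) ≠ 0 := by
    exact_mod_cast (coeffP_mul_constA_pos hab hf hpos).ne'
  rw [show charFun f a b 0 = _ from funext (charFun_eq hab hf hpos), deriv_div_const]
  exact div_ne_zero
    (h.deriv_sturmSol_ne_zero hab ((charFun_eq_zero_iff hab hf hpos lam).1 hlam)) this

lemma exists_norm_charFun_le (hab : a < b) (hf : ContDiffOn ℝ 2 f (Icc a b))
    (hpos : ∀ x ∈ Icc a b, 0 < f x) :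
    ∃ C : ℝ, ∀ lam, ‖charFun f a b 0 lam‖ ≤ Real.exp (C * (1 + √‖lam‖)) := by
  obtain ⟨M, h⟩ := exists_sturmCoeff hab hf hpos
  have hP := coeffP_mul_constA_pos hab hf hpos
  have hM := h.M_pos
  have hpa := h.p_pos a
  have hba : 0 < b - a := sub_pos.2 hab
  set K := coeffP f a b a * (M * (b - a)) / (coeffP f a b a * constA f a b)
  have hK : 0 ≤ K := by positivity
  refine ⟨K + M * (b - a), fun lam => ?_⟩
  rw [charFun_eq hab hf hpos, norm_div, norm_real, Real.norm_of_nonneg hP.le]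
  have h1 := h.norm_sturmSol_le lam (a := a) (x := b) (R := b - a) (by rw [abs_of_pos hba])
  have h2 : K ≤ Real.exp K := by linarith [Real.add_one_le_exp K]
  calc _ ≤ coeffP f a b a * (M * (b - a)) * Real.exp (√‖lam‖ * (M * (b - a))) /
        (coeffP f a b a * constA f a b) := by gcongr
    _ = K * Real.exp (√‖lam‖ * (M * (b - a))) := by ring
    _ ≤ Real.exp K * Real.exp (√‖lam‖ * (M * (b - a))) := by gcongr
    _ = Real.exp (K + √‖lam‖ * (M * (b - a))) := (Real.exp_add _ _).symm
    _ ≤ _ := by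
      refine Real.exp_le_exp.2 ?_
      have := Real.sqrt_nonneg ‖lam‖
      nlinarith [mul_nonneg hK this, mul_pos hM hba]

/-- On the negative half-axis `D₀` is real and positive. -/
lemma charFun_neg_eq_ofReal (hab : a < b) (hf : ContDiffOn ℝ 2 f (Icc a b))
    (hpos : ∀ x ∈ Icc a b, 0 < f x) {y : ℝ} (hy : 0 ≤ y) :
    charFun f a b 0 (-y) = ((charFun f a b 0 (-y)).re : ℂ) ∧ 0 < (charFun f a b 0 (-y)).re := by
  have him : ∀ y : ℝ, (charFun f a b 0 (-y)).im = 0 := by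
    intro y
    have := SturmCoeff.im_sturmSol_ofReal (coeffP f a b) (coeffρ f a b) a (-y) b
    rw [Complex.ofReal_neg] at this
    rw [charFun_eq hab hf hpos, Complex.div_ofReal_im, this, zero_div]
  refine ⟨Complex.ext rfl (by simp [him]), ?_⟩
  by_contra! hle
  have hcont : Continuous fun t : ℝ => (charFun f a b 0 (-t)).re :=
    Complex.continuous_re.comp ((differentiable_charFun hab hf hpos).continuous.comp
      (Complex.continuous_ofReal.neg))
  obtain ⟨t, ht, ht0⟩ := intermediate_value_Icc' hy hcont.continuousOn
    (show (0 : ℝ) ∈ Icc _ _ from ⟨hle, by simp [charFun_zero hab hf hpos]⟩)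
  have hz : charFun f a b 0 (-t) = 0 := Complex.ext ht0 (him t)
  have hmem : (-t : ℂ) ∈ radialSpectrum f a b 0 := by
    rw [radialSpectrum_eq hab hf hpos]
    exact hz
  obtain ⟨r, hr, hrt⟩ := radialSpectrum_pos hab hf hpos _ hmem
  have : -t = r := by exact_mod_cast hrt
  linarith [ht.1]

lemma hasDerivAt_log_charFun (hab : a < b) (hf : ContDiffOn ℝ 2 f (Icc a b))
    (hpos : ∀ x ∈ Icc a b, 0 < f x) {y : ℝ} (hy : 0 ≤ y) :
    HasDerivAt (fun y : ℝ => Real.log (charFun f a b 0 (-y)).re)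
      (-(deriv (charFun f a b 0) (-y) / charFun f a b 0 (-y)).re) y := by
  obtain ⟨hre, hp⟩ := charFun_neg_eq_ofReal hab hf hpos hy
  have h1 : HasDerivAt (fun z : ℂ => charFun f a b 0 (-z))
      (deriv (charFun f a b 0) (-y) * -1) (y : ℂ) :=
    ((differentiable_charFun hab hf hpos) (-(y : ℂ))).hasDerivAt.comp (y : ℂ)
      (hasDerivAt_neg (y : ℂ))
  refine (h1.real_of_complex.log hp.ne').congr_deriv ?_
  rw [hre, Complex.div_ofReal_re]
  simp only [Complex.ofReal_re, mul_neg, mul_one, Complex.neg_re]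
  ring

/-- On the negative axis `D₀` is real and positive, so the complex logarithm in the integrand is the
real one. -/
lemma zetaOneIntegrand_eq (hab : a < b) (hf : ContDiffOn ℝ 2 f (Icc a b))
    (hpos : ∀ x ∈ Icc a b, 0 < f x) (s : ℂ) {y : ℝ} (hy : 0 < y) :
    zetaOneIntegrand f a b s y = (y : ℂ) ^ (-s) *
      ((-(deriv (charFun f a b 0) (-y) / charFun f a b 0 (-y)).re : ℝ) : ℂ) := by
  have h1 := (hasDerivAt_log_charFun hab hf hpos hy.le).ofReal_comp
  have h2 : (fun t : ℝ => Complex.log (charFun f a b 0 (-(t : ℂ))))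
      =ᶠ[𝓝 y] fun t => ((Real.log (charFun f a b 0 (-t)).re : ℝ) : ℂ) := by
    filter_upwards [eventually_gt_nhds hy] with t ht
    obtain ⟨hre, hp⟩ := charFun_neg_eq_ofReal hab hf hpos ht.le
    rw [Complex.ofReal_log hp.le, ← hre]
  rw [zetaOneIntegrand, (h1.congr_of_eventuallyEq h2).deriv]

/-- The trace formula `(log D₀(-y))' = ∑ 1 / (lam + y)`. -/
lemma hasSum_inv_radialSpectrum_add (hab : a < b) (hf : ContDiffOn ℝ 2 f (Icc a b))
    (hpos : ∀ x ∈ Icc a b, 0 < f x) {y : ℝ} (hy : 0 ≤ y) :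
    HasSum (fun l : radialSpectrum f a b 0 => 1 / ((l : ℂ).re + y))
      (-(deriv (charFun f a b 0) (-y) / charFun f a b 0 (-y)).re) := by
  obtain ⟨C, hC⟩ := exists_norm_charFun_le hab hf hpos
  have hset := radialSpectrum_eq hab hf hpos
  obtain ⟨d, hd, hd'⟩ := hasSum_inv_zeros_add (differentiable_charFun hab hf hpos)
    (charFun_zero hab hf hpos) hC (fun z hz => deriv_charFun_ne_zero hab hf hpos hz)
    (fun z hz => radialSpectrum_pos hab hf hpos z (by rw [hset]; exact hz)) hy
  rw [hd', Complex.neg_re, Complex.ofReal_re, neg_neg, hset]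
  exact hd

/-- The large-`y` expansion of `log D₀(-y)`. -/
lemma isBigO_log_charFun_sub (hab : a < b) (hf : ContDiffOn ℝ 2 f (Icc a b))
    (hpos : ∀ x ∈ Icc a b, 0 < f x) :
    (fun y : ℝ => Real.log (charFun f a b 0 (-y)).re -
      ((∫ x in a..b, speed f a b x) * √y - Real.log y / 2
        + (-(Real.log (f a) + Real.log (f b)) / 2 - Real.log (2 * constA f a b))
        + (∫ x in a..b, potentialDensity f a b x) / 2 / √y)) =O[atTop] fun y => y⁻¹ := by
  obtain ⟨C, κ₀, hC⟩ := exists_norm_sturmSol_sub_le hab hf hpos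
  obtain ⟨M, h⟩ := exists_sturmCoeff hab hf hpos
  have hpa := h.p_pos a
  have hA := (constA_pos_and_sturmSol_zero hab hf hpos).1
  have hfa : 0 < f a := hpos a (left_mem_Icc.2 hab.le)
  have hfb : 0 < f b := hpos b (right_mem_Icc.2 hab.le)
  have hra : 0 < √(f a) := Real.sqrt_pos.2 hfa
  have hrb : 0 < √(f b) := Real.sqrt_pos.2 hfb
  set L := ∫ x in a..b, speed f a b x
  set Q := ∫ x in a..b, potentialDensity f a b x
  set pa := coeffP f a b a
  set A := constA f a b
  set D : ℝ → ℝ := fun y => (charFun f a b 0 (-y)).re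
  -- `1 + z y` is the quotient of `D₀(-y)` by its leading asymptotics
  set z : ℝ → ℝ := fun y => 2 * √y * Real.exp (-(√y * L)) * √(f a) * √(f b) * A * D y - 1 with hz
  have hinv : (fun y : ℝ => (√y)⁻¹ ^ 2) =ᶠ[atTop] fun y => y⁻¹ := by
    filter_upwards [eventually_ge_atTop 0] with y hy
    rw [inv_pow, Real.sq_sqrt hy]
  have h1 : (fun y => z y - Q / (2 * √y)) =O[atTop] fun y => y⁻¹ := by
    refine Asymptotics.IsBigO.of_bound (C * (√(f a) / pa)) ?_
    filter_upwards [eventually_gt_atTop 0,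
      Real.tendsto_sqrt_atTop.eventually_ge_atTop κ₀] with y hy hκ
    have hy' : 0 < √y := Real.sqrt_pos.2 hy
    have key := hC (√y) hκ
    have e1 : -((√y : ℝ) : ℂ) ^ 2 = -(y : ℂ) := by
      rw [← Complex.ofReal_pow, Real.sq_sqrt hy.le]
    have e2 : sturmSol (coeffP f a b) (coeffρ f a b) a (-(y : ℂ)) b
        = ((D y * (pa * A) : ℝ) : ℂ) := by
      have e3 := charFun_eq hab hf hpos (-(y : ℂ))
      have e4 : ((pa * A : ℝ) : ℂ) ≠ 0 := by exact_mod_cast (mul_pos hpa hA).ne'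
      rw [eq_div_iff e4, (charFun_neg_eq_ofReal hab hf hpos hy.le).1] at e3
      rw [← e3, ← Complex.ofReal_mul]
    rw [e1, e2] at key
    have e5 : (2 : ℂ) * (√y : ℝ) * (Real.exp (-(√y * L)) : ℝ) *
          ((√(f b) : ℝ) * ((D y * (pa * A) : ℝ) : ℂ))
        - ((pa / √(f a) : ℝ) : ℂ) * (1 + (Q : ℂ) / (2 * (√y : ℝ)))
        = ((pa / √(f a) * (z y - Q / (2 * √y)) : ℝ) : ℂ) := by
      have e6 : pa / √(f a) * (z y - Q / (2 * √y))
          = 2 * √y * Real.exp (-(√y * L)) * (√(f b) * (D y * (pa * A)))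
            - pa / √(f a) * (1 + Q / (2 * √y)) := by
        simp only [hz]
        field_simp
        ring
      rw [e6]
      push_cast
      ring
    rw [e5, norm_real, norm_mul, Real.norm_of_nonneg (by positivity), Real.sq_sqrt hy.le] at key
    rw [Real.norm_of_nonneg (inv_nonneg.2 hy.le)]
    calc ‖z y - Q / (2 * √y)‖
        = (√(f a) / pa) * (pa / √(f a) * ‖z y - Q / (2 * √y)‖) := by field_simp
      _ ≤ (√(f a) / pa) * (C / y) := by gcongr
      _ = _ := by ring
  have hinvO : (fun y : ℝ => y⁻¹) =O[atTop] fun y : ℝ => (√y)⁻¹ := by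
    refine Asymptotics.IsBigO.of_bound 1 ?_
    filter_upwards [eventually_ge_atTop 1] with y hy
    have e1 : 1 ≤ √y := Real.one_le_sqrt.2 hy
    rw [Real.norm_of_nonneg (by positivity), Real.norm_of_nonneg (by positivity), one_mul]
    refine inv_anti₀ (by positivity) ?_
    nlinarith [Real.sq_sqrt (show (0 : ℝ) ≤ y by linarith)]
  have h2 : z =O[atTop] fun y => (√y)⁻¹ := by
    have e1 : (fun y : ℝ => Q / (2 * √y)) =O[atTop] fun y => (√y)⁻¹ := by
      refine ((Asymptotics.isBigO_refl (fun y : ℝ => (√y)⁻¹) atTop).const_mul_left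
        (Q / 2)).congr_left fun y => ?_
      rw [div_mul_eq_div_div, div_eq_mul_inv (Q / 2)]
    refine ((h1.trans hinvO).add e1).congr_left fun y => ?_
    ring
  have hz0 : Tendsto z atTop (𝓝 0) :=
    h2.trans_tendsto (tendsto_inv_atTop_zero.comp Real.tendsto_sqrt_atTop)
  have h3 : (fun y => Real.log (1 + z y) - z y) =O[atTop] fun y => y⁻¹ :=
    ((isBigO_log_one_add_sub.comp_tendsto hz0).trans (h2.pow 2)).trans_eventuallyEq hinv
  refine (h3.add h1).congr' ?_ EventuallyEq.rfl
  filter_upwards [eventually_gt_atTop 0] with y hy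
  have hy' : 0 < √y := Real.sqrt_pos.2 hy
  have hDy : 0 < D y := (charFun_neg_eq_ofReal hab hf hpos hy.le).2
  have hlog : Real.log (1 + z y) = Real.log (2 * A) + Real.log y / 2 - √y * L
      + Real.log (f a) / 2 + Real.log (f b) / 2 + Real.log (D y) := by
    have e1 : 1 + z y = (2 * A) * √y * Real.exp (-(√y * L)) * √(f a) * √(f b) * D y := by
      simp only [hz]
      ring
    rw [e1, Real.log_mul (by positivity) hDy.ne', Real.log_mul (by positivity) hrb.ne',
      Real.log_mul (by positivity) hra.ne', Real.log_mul (by positivity) (Real.exp_pos _).ne',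
      Real.log_mul (by positivity) hy'.ne', Real.log_exp, Real.log_sqrt hy.le,
      Real.log_sqrt hfa.le, Real.log_sqrt hfb.le]
    ring
  rw [hlog]
  ring

end

end RevolutionSurface

theorem mainTheorem3 (f : ℝ → ℝ) (a b : ℝ) (hab : a < b)
    (hf : ContDiffOn ℝ 2 f (Set.Icc a b)) (hpos : ∀ x ∈ Set.Icc a b, 0 < f x) :
    (∀ lam : ℂ, RevolutionSurface.IsInitialSolution f a b 0 lam
        (RevolutionSurface.phi f a b 0 lam)) ∧
    (∀ (lam : ℂ) (φ : ℝ → ℂ), RevolutionSurface.IsInitialSolution f a b 0 lam φ →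
      Set.EqOn φ (RevolutionSurface.phi f a b 0 lam) (Set.Icc a b)) ∧
    (∀ lam ∈ RevolutionSurface.radialSpectrum f a b 0, ∃ r : ℝ, 0 < r ∧ lam = (r : ℂ)) ∧
    ∃ Z : ℂ → ℂ, RevolutionSurface.IsZetaOne f a b Z ∧
      HasDerivAt Z
        ((-(Real.log (f a) + Real.log (f b)) / 2
          - Real.log (2 * RevolutionSurface.constA f a b) : ℝ) : ℂ) 0 ∧
      Z 0 = -1 / 2 ∧
      Filter.Tendsto (fun s : ℂ => (s - 1 / 2) * Z s) (nhdsWithin (1 / 2) {1 / 2}ᶜ)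
        (nhds ((1 / (2 * Real.pi) *
          ∫ x in a..b, Real.sqrt (1 + RevolutionSurface.d1 a b f x ^ 2) : ℝ) : ℂ)) ∧
      Filter.Tendsto (fun s : ℂ => (s + 1 / 2) * Z s) (nhdsWithin (-1 / 2) {-1 / 2}ᶜ)
        (nhds ((1 / (2 * Real.pi) *
          ∫ x in a..b,
            (-(1 / 8) * (RevolutionSurface.d1 a b f x ^ 2
                / (f x ^ 2 * Real.sqrt (1 + RevolutionSurface.d1 a b f x ^ 2)))
              + 1 / 4 * (RevolutionSurface.d2 a b f x
                / (f x * Real.sqrt (1 + RevolutionSurface.d1 a b f x ^ 2) ^ 3))) : ℝ) : ℂ)) := by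
  open RevolutionSurface in
  refine ⟨isInitialSolution_phi hab hf hpos, fun lam φ hφ => ?_, radialSpectrum_pos hab hf hpos, ?_⟩
  · exact (hφ.eqOn_sturmSol hab hf hpos).trans
      ((isInitialSolution_phi hab hf hpos lam).eqOn_sturmSol hab hf hpos).symm
  have hre : ∀ l : radialSpectrum f a b 0, (((l : ℂ).re : ℝ) : ℂ) = l ∧ 0 < (l : ℂ).re := by
    intro l
    obtain ⟨r, hr, hl⟩ := radialSpectrum_pos hab hf hpos l l.2
    rw [hl, Complex.ofReal_re]
    exact ⟨rfl, hr⟩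
  obtain ⟨Z, hmer, hhol, hsum, hint, hintegral, hder, h0, hres, hres'⟩ :=
    exists_meromorphic_zeta (fun l => (hre l).2)
      (fun y hy => hasDerivAt_log_charFun hab hf hpos hy)
      (by simp [charFun_zero hab hf hpos])
      (fun y hy => hasSum_inv_radialSpectrum_add hab hf hpos hy)
      (isBigO_log_charFun_sub hab hf hpos)
  have hpot : (∫ x in a..b, potentialDensity f a b x) / 2 = ∫ x in a..b,
      (-(1 / 8) * (d1 a b f x ^ 2 / (f x ^ 2 * Real.sqrt (1 + d1 a b f x ^ 2)))
        + 1 / 4 * (d2 a b f x / (f x * Real.sqrt (1 + d1 a b f x ^ 2) ^ 3))) := by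
    rw [← intervalIntegral.integral_div]
    refine intervalIntegral.integral_congr fun x hx => ?_
    rw [Set.uIcc_of_le hab.le] at hx
    have hw := speed_pos f a b x
    have hfx := hpos x hx
    have hs : Real.sqrt (1 + d1 a b f x ^ 2) = speed f a b x := rfl
    simp only [potentialDensity, hs]
    field_simp
    ring
  refine ⟨Z, ⟨hmer, hhol, fun s hs => ?_, fun s h1 h2 => ?_, fun s h1 h2 => ?_⟩, hder, h0, hres,
    ?_⟩
  · simpa only [(hre _).1] using hsum s hs
  · exact (hint s h1 h2).congr_fun (fun y hy => (zetaOneIntegrand_eq hab hf hpos s hy).symm)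
      measurableSet_Ioi
  · rw [hintegral s h1 h2]
    congr 1
    exact MeasureTheory.setIntegral_congr_fun measurableSet_Ioi fun y hy =>
      (zetaOneIntegrand_eq hab hf hpos s hy).symm
  · rw [← hpot]
    exact hres'
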